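/- Let $K$ be a field of characteristic $0$, let $\Gamma$ be the category of finite pointed sets and base point preserving maps, and let $\mathrm{Ch}$ be the category of ($\mathbb Z$-graded, possibly unbounded) chain complexes of $K$-vector spaces. A right $\Gamma$-module is a functor $\Gamma^{op}\to \mathrm{Ch}$; equivalently, it is a chain complex in the abelian category of functors from $\Gamma^{op}$ to $K$-vector spaces. For a pointed space $Y$, let $C_*(Y^{\times -})$ be the right $\Gamma$-module $S\mapsto C_*(\mathrm{Map}_*(S,Y);K)$, the singular chain complex of the space of pointed maps $S\to Y$ (so that $k_+=\{0,1,\dots,k\}$, pointed at $0$, is sent to $C_*(Y^{\times k};K)$). For right $\Gamma$-modules $M$ and $A$, let $\mathrm{hRmod}_\Gamma(M,A)$ be the derived chain complex of morphisms from $M$ to $A$, that is, the complex $\mathrm{Hom}_\Gamma(P,A)$, where $P\to M$ is a quasi-isomorphism and $P$ is K-projective (every morphism from $P$ to an acyclic complex is null-homotopic), and where $\mathrm{Hom}_\Gamma(P,A)_n=\prod_{i\in\mathbb Z}\mathrm{Nat}(P_i,A_{i+n})$ with its usual differential. For a cosimplicial chain complex $B^\bullet$, let $\mathrm{Tot}\,B^\bullet$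 be its (product) totalization $$(\mathrm{Tot}\,B^\bullet)_n=\prod_{p\ge 0} (B^p)_{n+p},$$ whose differential is the sum of the alternating sum of the cofaces and of $(-1)^p$ times the differential of $B^p$. Let $X_\bullet\colon\Delta^{op}\to\Gamma$ be a simplicial object in $\Gamma$, with geometric realization $|X_\bullet|$ pointed by the base point of $X_0$, and let $A\colon\Gamma^{op}\to\mathrm{Ch}$ be a right $\Gamma$-module. Then $C_*(|X_\bullet|^{\times -})$ admits a K-projective resolution, and for every such resolution, used to compute the right-hand side, there is a quasi-isomorphism of chain complexes of $K$-vector spaces $$\mathrm{Tot}\,A(X_\bullet)\;\xrightarrow{\ \simeq\ }\;\mathrm{hRmod}_\Gamma\bigl(C_*(|X_\bullet|^{\times -}),A\bigr).$$ -/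

import Mathlib

open CategoryTheory Opposite Simplicial

universe u

noncomputable section

namespace GammaModules

/-! ### Finite pointed sets and right `Γ`-modules -/

/-- The category `Γ` of finite pointed sets and base point preserving maps. -/
abbrev FinPointed : Type 1 :=
  ObjectProperty.FullSubcategory (C := Pointed.{0}) (fun S => Finite S.X)

/-- `K`-vector spaces. The universe is large enough to contain the `K`-module of all natural
transformations between two functors from `Γᵒᵖ` to vector spaces. -/
abbrev Vect (K : Type u) [Field K] := ModuleCat.{max 1 u} K

/-- The category of (unbounded) chain complexes of `K`-vector spaces. They are written
cohomologically: a chain complex `C_*` is regarded as a cochain complex through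
`C ^ n = C_{-n}`, so that the differential raises the upper degree by one. -/
abbrev Ch (K : Type u) [Field K] := CochainComplex (Vect K) ℤ

/-- Right `Γ`-modules: contravariant functors from `Γ` to chain complexes. -/
abbrev RightModule (K : Type u) [Field K] := FinPointedᵒᵖ ⥤ Ch K

/-- A contravariant functor from `Γ` to chain complexes, seen as a complex in the abelian category
of contravariant functors from `Γ` to vector spaces. This is the standard identification: a chain
map or a natural transformation is the same thing on both sides. -/
def RightModule.complex {K : Type u} [Field K] (M : RightModule K) :
    CochainComplex (FinPointedᵒᵖ ⥤ Vect K) ℤ where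
  X n := M ⋙ HomologicalComplex.eval (Vect K) (ComplexShape.up ℤ) n
  d i j :=
    { app := fun k => (M.obj k).d i j
      naturality := fun _ _ f => (M.map f).comm i j }
  shape i j h := by
    ext k : 2
    exact (M.obj k).shape i j h
  d_comp_d' i j l _ _ := by
    ext k : 2
    exact (M.obj k).d_comp_d i j l

/-! ### Derived morphisms of right `Γ`-modules -/

/-- The chain complex of `K`-linear maps between two complexes of contravariant functors from `Γ` to
vector spaces: in degree `n` it is the vector space of all families of natural transformations
`F ^ p ⟶ G ^ (p + n)`, with the usual differential. -/
def homComplex {K : Type u} [Field K] (F G : CochainComplex (FinPointedᵒᵖ ⥤ Vect K) ℤ) :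
    Ch K where
  X n := ModuleCat.of K (CochainComplex.HomComplex.Cochain F G n)
  d i j := ModuleCat.ofHom (CochainComplex.HomComplex.δ_hom K F G i j)
  shape i j h := by
    ext z : 2
    exact CochainComplex.HomComplex.δ_shape i j h z
  d_comp_d' i j l _ _ := by
    ext z : 2
    exact CochainComplex.HomComplex.δ_δ i j l z

/-- A K-projective resolution of a right `Γ`-module `M`, that is, a quasi-isomorphism `P ⟶ M`
with `P` K-projective. (For instance, a cofibrant replacement of `M` in the projective model
structure.) -/
structure Resolution {K : Type u} [Field K] (M : RightModule K) where
  /-- the resolving complex -/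
  P : CochainComplex (FinPointedᵒᵖ ⥤ Vect K) ℤ
  /-- the augmentation -/
  π : P ⟶ M.complex
  quasiIso : QuasiIso π
  isKProjective : P.IsKProjective

/-- The derived chain complex of morphisms from `M` to `A`, computed with
the resolution `R` of `M`. -/
def hRmod {K : Type u} [Field K] {M : RightModule K} (R : Resolution M) (A : RightModule K) :
    Ch K :=
  homComplex R.P A.complex

/-! ### The right `Γ`-module `C_*(Y^{×-})` of a pointed space `Y` -/

/-- The space of pointed maps from a finite pointed set `S` to the pointed
space `(Y, y)`, as a subspace of the product `Y ^ S`. For `S` of cardinality `k + 1`, it is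
homeomorphic to `Y ^ k`. -/
abbrev pointedMaps (Y : TopCat.{0}) (y : Y) (S : FinPointed) : TopCat.{0} :=
  TopCat.of { f : S.obj.X → Y // f S.obj.point = y }

/-- Precomposition with a map of finite pointed sets. -/
def precompose (Y : TopCat.{0}) (y : Y) {S T : FinPointed} (g : T ⟶ S) :
    C(pointedMaps Y y S, pointedMaps Y y T) where
  toFun f := ⟨fun t => f.1 (g.hom.toFun t), (congrArg f.1 g.hom.map_point).trans f.2⟩
  continuous_toFun :=
    Continuous.subtype_mk
      ((Pi.continuous_precomp g.hom.toFun).comp continuous_subtype_val) _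

/-- The contravariant functor `Y^{×-}` from `Γ` to spaces that sends `S` to the space of pointed maps
from `S` to `Y`. -/
def powerFunctor (Y : TopCat.{0}) (y : Y) : FinPointedᵒᵖ ⥤ TopCat.{0} where
  obj S := pointedMaps Y y S.unop
  map g := TopCat.ofHom (precompose Y y g.unop)
  map_id _ := rfl
  map_comp _ _ := rfl

/-- The singular chain complex functor, with coefficients in `K`. -/
def singularChains (K : Type u) [Field K] : TopCat.{0} ⥤ Ch K :=
  (AlgebraicTopology.singularChainComplexFunctor (Vect K)).obj
      (ModuleCat.of K (ULift.{1} K)) ⋙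
    ComplexShape.embeddingDownNat.extendFunctor (Vect K)

/-- The right `Γ`-module `C_*(Y^{×-})` of a pointed space `(Y, y)`. -/
def singularModule (K : Type u) [Field K] (Y : TopCat.{0}) (y : Y) : RightModule K :=
  powerFunctor Y y ⋙ singularChains K

/-! ### Simplicial finite pointed sets -/

/-- The underlying simplicial set of a simplicial object of `Γ`. -/
def underlying (X : SimplicialObject FinPointed) : SSet.{0} :=
  X ⋙ ObjectProperty.ι _ ⋙ forget Pointed

/-- The base point of the set of `0`-simplices. -/
def basePoint₀ (X : SimplicialObject FinPointed) : (underlying X) _⦋0⦌ :=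
  (X.obj (op ⦋0⦌)).obj.point

/-- The geometric realization of `X`. -/
def realization (X : SimplicialObject FinPointed) : TopCat.{0} :=
  SSet.toTop.obj (underlying X)

/-- The base point of the geometric realization: the point given by the `0`-simplex that is the
base point of `X_0`. -/
def basePoint (X : SimplicialObject FinPointed) : realization X :=
  TopCat.toSSetObj₀Equiv ((sSetTopAdj.unit.app (underlying X)).app (op ⦋0⦌) (basePoint₀ X))

/-! ### Totalization -/

/-- The cosimplicial chain complex `A(X_•)`. -/
def evalSimplicial {K : Type u} [Field K] (A : RightModule K) (X : SimplicialObject FinPointed) :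
    CosimplicialObject (Ch K) :=
  X.rightOp ⋙ A

/-- The bidegrees `(p, q)` of total degree `n`; here `p` is the cosimplicial degree. -/
structure Bidegree (n : ℤ) where
  /-- the cosimplicial degree -/
  p : ℕ
  /-- the degree in the chain complex -/
  q : ℤ
  /-- the total degree is `n` -/
  h : (p : ℤ) + q = n

section Tot

variable {K : Type u} [Field K] (B : CosimplicialObject (Ch K))

/-- The alternating sum of the cofaces `B ^ p ⟶ B ^ (p + 1)`, in degree `q`. -/
def cofaceSum (p : ℕ) (q : ℤ) : (B.obj ⦋p⦌).X q ⟶ (B.obj ⦋p + 1⦌).X q :=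
  (∑ i : Fin (p + 2), (-1 : ℤ) ^ (i : ℕ) • B.δ i).f q

/-- The degree `n` part of the totalization: the product, over all `p ≥ 0`, of the degree `n - p`
parts of the complexes `B ^ p`. -/
abbrev TotX (n : ℤ) : Type (max 1 u) := ∀ T : Bidegree n, (B.obj ⦋T.p⦌).X T.q

/-- The horizontal part of the differential of the totalization: the alternating sum of the
cofaces. -/
def totDh (n m : ℤ) (h : n + 1 = m) : TotX B n →ₗ[K] TotX B m :=
  LinearMap.pi fun T => match T with
    | ⟨0, _, _⟩ => 0
    | ⟨p + 1, q, hT⟩ => (cofaceSum B p q).hom ∘ₗ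
        LinearMap.proj (⟨p, q, by push_cast at hT; lia⟩ : Bidegree n)

/-- The vertical part of the differential of the totalization: `(-1) ^ p` times the differential
of the complex `B ^ p`. -/
def totDv (n m : ℤ) (h : n + 1 = m) : TotX B n →ₗ[K] TotX B m :=
  LinearMap.pi fun T => (-1 : ℤ) ^ T.p • (((B.obj ⦋T.p⦌).d (T.q - 1) T.q).hom ∘ₗ
    LinearMap.proj (⟨T.p, T.q - 1, by have := T.h; lia⟩ : Bidegree n))

open Classical in
/-- The differential of the totalization. -/
def totD (n m : ℤ) : TotX B n →ₗ[K] TotX B m :=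
  if h : n + 1 = m then totDh B n m h + totDv B n m h else 0

lemma cofaceSum_comp (p : ℕ) (q : ℤ) (x : (B.obj ⦋p⦌).X q) :
    (cofaceSum B (p + 1) q).hom ((cofaceSum B p q).hom x) = 0 := by
  have h := HomologicalComplex.congr_hom
    (AlgebraicTopology.AlternatingCofaceMapComplex.d_squared B p) q
  exact congrArg (fun f => f.hom x) h

lemma cofaceSum_d (p : ℕ) (q r : ℤ) (x : (B.obj ⦋p⦌).X q) :
    ((B.obj ⦋p + 1⦌).d q r).hom ((cofaceSum B p q).hom x) =
      (cofaceSum B p r).hom (((B.obj ⦋p⦌).d q r).hom x) := by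
  have h := HomologicalComplex.Hom.comm
    (AlgebraicTopology.AlternatingCofaceMapComplex.objD B p) q r
  exact congrArg (fun f => f.hom x) h

lemma d_d_apply (C : Ch K) (i j k : ℤ) (x : C.X i) :
    (C.d j k).hom ((C.d i j).hom x) = 0 :=
  congrArg (fun f => f.hom x) (C.d_comp_d i j k)

lemma totD_comp (i j k : ℤ) (hij : i + 1 = j) (hjk : j + 1 = k) :
    totD B j k ∘ₗ totD B i j = 0 := by
  ext x T
  obtain ⟨p, q, hT⟩ := T
  rw [totD, totD, dif_pos hij, dif_pos hjk]
  match p, hT with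
  | 0, hT => simp [totDh, totDv, d_d_apply]
  | 1, hT =>
    simp [totDh, totDv, d_d_apply, cofaceSum_d]
  | p + 2, hT =>
    simp [totDh, totDv, d_d_apply, cofaceSum_d, cofaceSum_comp, pow_succ]

/-- The totalization of a cosimplicial chain complex `B`: the product total complex, with
`Tot B` in degree `n` the product over `p ≥ 0` of the degree `n - p` part of `B ^ p`, and
differential the sum of the alternating sum of the cofaces and of `(-1) ^ p` times the differential
of `B ^ p`. In homological grading, this is the product of the desuspensions `s ^ (-p) B ^ p`. -/
def Tot : Ch K where
  X n := ModuleCat.of K (TotX B n)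
  d i j := ModuleCat.ofHom (totD B i j)
  shape i j h := by
    have h' : ¬ i + 1 = j := h
    rw [totD, dif_neg h']
    rfl
  d_comp_d' i j k hij hjk := by
    have h := totD_comp B i j k hij hjk
    rw [← ModuleCat.ofHom_comp, h]
    rfl

end Tot

end GammaModules

end

/-!
The singular chains of the spaces of pointed maps from finite pointed sets `S` to `|X|` are
resolved by the simplicial chains of the simplicial sets `Hom(S, X)` (`homs`). A morphism from `S`
to `X_p` defines a singular `p`-simplex of the space of pointed maps from `S` to `|X|`, and this
gives a map of right `Γ`-modules (`comparisonModule`). Three facts make the theorem true.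

*The module of simplicial chains is K-projective.* In homological degree `p` it sends `S` to the
vector space with basis `Hom(S, X_p)`, so by the Yoneda lemma natural transformations out of it are
the elements of the value at `X_p`. Hence it is projective in each degree, and it vanishes in
negative homological degrees.

*The comparison is a quasi-isomorphism* (`homologyIso_comparison`). For fixed `S`, a pointed map is
an arbitrary map on the complement of the base point, and the comparison is a finite power of the
unit `X ⟶ Sing |X|`. Two results on the homology of simplicial sets are therefore needed: the unit
is a homology isomorphism (`homologyIso_unit`), and products preserve homology isomorphisms
(`homologyIso_whiskerRight`). Both are instances of an induction on the nondegenerate simplices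
(`homologyIso_app_of_cells`), which compares two functors of simplicial sets that are compatible
with attaching cells and with the filtration by skeleta. For products, compatibility with attaching
cells holds because chains turn pushouts along monomorphisms into isomorphisms of relative chains.
For the functor `Sing |-|`, it is excision: the boundary of a simplex has a collar, and collars are
inherited by pushouts (`Collar.relSingularIso_of_isPushout`), so that excision for open coverings
applies (`relSingularIso_of_isOpenEmbedding`), which rests on barycentric subdivision
(`homologyIso_small`). The compatibility with skeleta holds because a compact subset of a
realization lies in a skeleton (`exists_subset_range_sk`); the necessary facts on the topology of
realizations come from the normal form of their points (`IsNormalForm.eq_of_point_eq`).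

*The complex of morphisms is the totalization.* Evaluation on the generators given by the Yoneda
lemma is an isomorphism, up to signs (`totSign`), from the complex of morphisms out of the module
of simplicial chains to the totalization of `A(X)` (`toTot`). Any other K-projective resolution is
homotopy equivalent to the module of simplicial chains (`nonempty_homotopyEquiv`), and
precomposition with a homotopy equivalence is a quasi-isomorphism (`quasiIso_precomp`).
-/

noncomputable section

namespace GammaModules

open Limits MonoidalCategory

variable {K : Type u} [Field K] (R : Vect K)

/-! ### Homology isomorphisms of simplicial sets -/

/-- A map of simplicial sets is a homology isomorphism (with coefficients in `R`) if it induces a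
quasi-isomorphism on simplicial chains. -/
def homologyIso : MorphismProperty SSet.{0} :=
  fun _ _ f => QuasiIso (SSet.chainComplexMap f R)

lemma chainComplexMap_comp {X Y Z : SSet.{0}} (f : X ⟶ Y) (g : Y ⟶ Z) :
    SSet.chainComplexMap (f ≫ g) R = SSet.chainComplexMap f R ≫ SSet.chainComplexMap g R :=
  Functor.map_comp _ _ _

lemma homologyIso_eq_inverseImage :
    homologyIso R = (HomologicalComplex.quasiIso (Vect K) (ComplexShape.down ℕ)).inverseImage
      ((SSet.chainComplexFunctor (Vect K)).obj R) := rfl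

instance : (homologyIso R).HasTwoOutOfThreeProperty := by
  rw [homologyIso_eq_inverseImage]; infer_instance

instance : (homologyIso R).RespectsIso := by
  rw [homologyIso_eq_inverseImage]; infer_instance

instance : (homologyIso R).IsMultiplicative := by
  rw [homologyIso_eq_inverseImage]; infer_instance

lemma homologyIso_of_isIso {X Y : SSet.{0}} (f : X ⟶ Y) [IsIso f] : homologyIso R f :=
  MorphismProperty.of_isIso _ f

/-- A map of simplicial sets with a homotopy inverse is a homology isomorphism. -/
lemma homologyIso_of_homotopy {X Y : SSet.{0}} (f : X ⟶ Y) (g : Y ⟶ X)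
    (h : SSet.Homotopy (f ≫ g) (𝟙 X)) (h' : SSet.Homotopy (g ≫ f) (𝟙 Y)) : homologyIso R f := by
  let e : HomotopyEquiv (X.chainComplex R) (Y.chainComplex R) :=
    { hom := SSet.chainComplexMap f R
      inv := SSet.chainComplexMap g R
      homotopyHomInvId := (Homotopy.ofEq (by simp)).trans
        ((h.chainComplexMap R).trans (Homotopy.ofEq (by simp)))
      homotopyInvHomId := (Homotopy.ofEq (by simp)).trans
        ((h'.chainComplexMap R).trans (Homotopy.ofEq (by simp))) }
  exact e.quasiIso_hom

/-- A homotopy equivalence of spaces induces a homology isomorphism on singular simplicial sets. -/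
lemma homologyIso_toSSet_of_homotopy {X Y : TopCat.{0}} (f : X ⟶ Y) (g : Y ⟶ X)
    (h : TopCat.Homotopy (f ≫ g) (𝟙 X)) (h' : TopCat.Homotopy (g ≫ f) (𝟙 Y)) :
    homologyIso R (TopCat.toSSet.map f) := by
  refine homologyIso_of_homotopy R _ (TopCat.toSSet.map g) ?_ ?_
  · rw [← Functor.map_comp, ← TopCat.toSSet.map_id]
    exact h.toSSet
  · rw [← Functor.map_comp, ← TopCat.toSSet.map_id]
    exact h'.toSSet

/-! ### Simplicial chains and colimits -/

instance : ((SSet.chainComplexFunctor.{0} (Vect K)).obj R).PreservesMonomorphisms where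
  preserves f _ := by
    dsimp [SSet.chainComplexFunctor]
    apply +allowSynthFailures Functor.map_mono
    apply +allowSynthFailures Functor.map_mono
    dsimp [SSet, SimplicialObject.whiskering, SimplicialObject]
    infer_instance

instance {X Y : SSet.{0}} (f : X ⟶ Y) [Mono f] : Mono (SSet.chainComplexMap f R) :=
  inferInstanceAs (Mono (((SSet.chainComplexFunctor.{0} (Vect K)).obj R).map f))

instance {J : Type} [SmallCategory J] :
    PreservesColimitsOfShape J ((SSet.chainComplexFunctor.{0} (Vect K)).obj R) :=
  HomologicalComplex.preservesColimitsOfShape_of_eval _ (fun n =>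
    inferInstanceAs (PreservesColimitsOfShape J
      ((CategoryTheory.evaluation _ _).obj (op ⦋n⦌) ⋙ sigmaConst.obj R)))

/-- Simplices generate the module of simplicial chains. -/
lemma chains_eq_top {X : SSet.{0}} {n : ℕ} (p : Submodule K ((X.chainComplex R).X n))
    (hp : ∀ (x : X _⦋n⦌) (r : R), (X.ιChainComplex x : R ⟶ _) r ∈ p) : p = ⊤ := by
  have : ModuleCat.ofHom p.mkQ = 0 := by
    apply SSet.chainComplex_hom_ext
    intro x
    ext r
    simpa using hp x r
  have h2 : p.mkQ = 0 := by
    ext x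
    exact congr($(this) x)
  rw [← Submodule.ker_mkQ p, h2, LinearMap.ker_zero]

lemma chains_induction {X : SSet.{0}} {n : ℕ} {P : (X.chainComplex R).X n → Prop}
    (hs : ∀ (x : X _⦋n⦌) (r : R), P ((X.ιChainComplex x : R ⟶ _) r)) (h0 : P 0)
    (hadd : ∀ x y, P x → P y → P (x + y))
    (c : (X.chainComplex R).X n) : P c := by
  let p : Submodule K ((X.chainComplex R).X n) :=
    { carrier := {c | ∀ a : K, P (a • c)}
      add_mem' := fun {x y} hx hy a => by
        rw [smul_add]
        exact hadd _ _ (hx a) (hy a)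
      zero_mem' := fun a => by rwa [smul_zero]
      smul_mem' := fun a x hx b => by
        rw [smul_smul]
        exact hx _ }
  have hp : p = ⊤ := chains_eq_top R p (fun x r a => by
    rw [← map_smul]
    exact hs x _)
  have hc : c ∈ p := by rw [hp]; trivial
  simpa using hc 1

/-- Detection of quasi-isomorphisms of complexes of vector spaces on elements. -/
lemma quasiIso_of_elements {ι : Type*} {c : ComplexShape ι} {C D : HomologicalComplex (Vect K) c}
    (φ : C ⟶ D)
    (inj : ∀ i j k, c.prev j = i → c.next j = k →
      ∀ x : C.X j, C.d j k x = 0 → ∀ y : D.X i, φ.f j x = D.d i j y → ∃ x', x = C.d i j x')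
    (surj : ∀ i j k, c.prev j = i → c.next j = k →
      ∀ y : D.X j, D.d j k y = 0 → ∃ x : C.X j, C.d j k x = 0 ∧ ∃ z : D.X i,
        y = φ.f j x + D.d i j z) : QuasiIso φ := by
  rw [quasiIso_iff]
  intro j
  rw [quasiIsoAt_iff_isIso_homologyMap]
  have h1 : Mono (HomologicalComplex.homologyMap φ j) := by
    rw [HomologicalComplex.mono_homologyMap_iff_up_to_refinements _ _ j _ rfl rfl]
    intro A x₂ hx₂ y₁ hy₁
    refine ⟨ModuleCat.of K (LinearMap.eqLocus (x₂.hom ∘ₗ LinearMap.fst K A (C.X (c.prev j)))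
      ((C.d _ j).hom ∘ₗ LinearMap.snd K A (C.X (c.prev j)))),
      ModuleCat.ofHom (LinearMap.fst K _ _ ∘ₗ Submodule.subtype _), ?_,
      ModuleCat.ofHom (LinearMap.snd K _ _ ∘ₗ Submodule.subtype _), ?_⟩
    · rw [ModuleCat.epi_iff_surjective]
      intro a
      obtain ⟨x', hx'⟩ := inj _ j _ rfl rfl (x₂ a) congr($hx₂ a) (y₁ a) congr($hy₁ a)
      exact ⟨⟨(a, x'), hx'⟩, rfl⟩
    · ext ⟨p, hp⟩
      exact hp
  have h2 : Epi (HomologicalComplex.homologyMap φ j) := by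
    rw [HomologicalComplex.epi_homologyMap_iff_up_to_refinements _ _ j _ rfl rfl]
    intro A y₂ hy₂
    refine ⟨ModuleCat.of K (LinearMap.eqLocus
        ((y₂.hom ∘ₗ LinearMap.fst K A (C.X j × D.X (c.prev j))).prod 0)
      (((φ.f j).hom ∘ₗ LinearMap.fst K _ _ ∘ₗ LinearMap.snd K A (C.X j × D.X (c.prev j)) +
        (D.d _ j).hom ∘ₗ LinearMap.snd K _ _ ∘ₗ LinearMap.snd K A (C.X j × D.X (c.prev j))).prod
          ((C.d j (c.next j)).hom ∘ₗ LinearMap.fst K _ _ ∘ₗ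
            LinearMap.snd K A (C.X j × D.X (c.prev j))))),
      ModuleCat.ofHom (LinearMap.fst K _ _ ∘ₗ Submodule.subtype _), ?_,
      ModuleCat.ofHom (LinearMap.fst K _ _ ∘ₗ LinearMap.snd K _ _ ∘ₗ Submodule.subtype _), ?_,
      ModuleCat.ofHom (LinearMap.snd K _ _ ∘ₗ LinearMap.snd K _ _ ∘ₗ Submodule.subtype _), ?_⟩
    · rw [ModuleCat.epi_iff_surjective]
      intro a
      obtain ⟨x, hx, z, hz⟩ := surj _ j _ rfl rfl (y₂ a) congr($hy₂ a)
      exact ⟨⟨(a, x, z), Prod.ext hz hx.symm⟩, rfl⟩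
    · ext ⟨p, hp⟩
      exact congr($(hp).2).symm
    · ext ⟨p, hp⟩
      exact congr($(hp).1)
  exact isIso_of_mono_of_epi _

lemma eq_zero_of_next (C : ChainComplex (Vect K) ℕ) (j : ℕ) (x : C.X j)
    (hx : C.d j ((ComplexShape.down ℕ).next j) x = 0) (m : ℕ) : C.d j m x = 0 := by
  by_cases h : (ComplexShape.down ℕ).Rel j m
  · obtain rfl := (ComplexShape.down ℕ).next_eq' h
    exact hx
  · rw [C.shape _ _ h]
    rfl

/-- Detection of homology isomorphisms on cycles. -/
lemma homologyIso_of_elements {X Y : SSet.{0}} (f : X ⟶ Y)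
    (inj : ∀ n, ∀ x : (X.chainComplex R).X n, (∀ m, (X.chainComplex R).d n m x = 0) →
      ∀ y : (Y.chainComplex R).X (n + 1), (SSet.chainComplexMap f R).f n x =
        (Y.chainComplex R).d (n + 1) n y → ∃ x', x = (X.chainComplex R).d (n + 1) n x')
    (surj : ∀ n, ∀ y : (Y.chainComplex R).X n, (∀ m, (Y.chainComplex R).d n m y = 0) →
      ∃ x : (X.chainComplex R).X n, (∀ m, (X.chainComplex R).d n m x = 0) ∧
        ∃ z : (Y.chainComplex R).X (n + 1),
        y = (SSet.chainComplexMap f R).f n x + (Y.chainComplex R).d (n + 1) n z) :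
    homologyIso R f := by
  refine quasiIso_of_elements _ ?_ ?_
  · intro i j k hi hk x hx y hy
    obtain rfl : j + 1 = i := by rw [← hi]; exact (ChainComplex.prev ℕ j).symm
    subst hk
    exact inj _ x (eq_zero_of_next _ _ _ hx) y hy
  · intro i j k hi hk y hy
    obtain rfl : j + 1 = i := by rw [← hi]; exact (ChainComplex.prev ℕ j).symm
    subst hk
    obtain ⟨x, hx, z, hz⟩ := surj _ y (eq_zero_of_next _ _ _ hy)
    exact ⟨x, hx _, z, hz⟩

/-- The five lemma in the middle of a short exact sequence of chain complexes. -/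
lemma quasiIso_τ₂ {S₁ S₂ : ShortComplex (ChainComplex (Vect K) ℕ)} (φ : S₁ ⟶ S₂)
    (hS₁ : S₁.ShortExact) (hS₂ : S₂.ShortExact) (h₁ : QuasiIso φ.τ₁) (h₃ : QuasiIso φ.τ₃) :
    QuasiIso φ.τ₂ := by
  open HomologicalComplex HomologicalComplex.HomologySequence ComposableArrows in
  rw [quasiIso_iff]
  intro i
  rw [quasiIsoAt_iff_isIso_homologyMap]
  have : Mono (homologyMap φ.τ₂ i) :=
    Abelian.mono_of_epi_of_mono_of_mono'' (show 2 + 3 ≤ 5 by lia)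
      (composableArrows₅_exact hS₁ (i + 1) i rfl) (composableArrows₅_exact hS₂ (i + 1) i rfl)
      (mapComposableArrows₅ φ hS₁ hS₂ (i + 1) i rfl) 2 3 4 5 rfl rfl rfl rfl
      (inferInstance : Epi (homologyMap φ.τ₃ (i + 1)))
      (inferInstance : Mono (homologyMap φ.τ₁ i)) (inferInstance : Mono (homologyMap φ.τ₃ i))
  have : Epi (homologyMap φ.τ₂ i) := by
    cases i with
    | zero =>
      refine Abelian.epi_of_epi_of_epi_of_epi (mapComposableArrows₂ φ 0)
        (composableArrows₂_exact hS₂ 0) ?_ ?_ ?_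
      · have := hS₁.epi_g
        exact epi_homologyMap_of_epi_of_not_rel S₁.g 0 (by simp)
      · exact inferInstanceAs (Epi (homologyMap φ.τ₁ 0))
      · exact inferInstanceAs (Epi (homologyMap φ.τ₃ 0))
    | succ i =>
      exact Abelian.epi_of_epi_of_epi_of_mono'' (show 0 + 3 ≤ 5 by lia)
        (composableArrows₅_exact hS₁ (i + 1) i rfl) (composableArrows₅_exact hS₂ (i + 1) i rfl)
        (mapComposableArrows₅ φ hS₁ hS₂ (i + 1) i rfl) 0 1 2 3 rfl rfl rfl rfl
        (inferInstance : Epi (homologyMap φ.τ₁ (i + 1)))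
        (inferInstance : Epi (homologyMap φ.τ₃ (i + 1)))
        (inferInstance : Mono (homologyMap φ.τ₁ i))
  exact isIso_of_mono_of_epi _

/-- The linear map out of the one-dimensional vector space that is given by an element. -/
def ofElement {M : Vect K} (x : M) : ModuleCat.of K (ULift.{max 1 u} K) ⟶ M :=
  ModuleCat.ofHom (LinearMap.toSpanSingleton K _ x ∘ₗ ULift.moduleEquiv.toLinearMap)

lemma ofElement_one {M : Vect K} (x : M) : ofElement x ⟨1⟩ = x := one_smul K x

lemma ofElement_comp {M N : Vect K} (x : M) (f : M ⟶ N) : ofElement x ≫ f = ofElement (f x) := by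
  ext ⟨a⟩
  exact map_smul f.hom a x

lemma ofElement_zero {M : Vect K} : ofElement (0 : M) = 0 := by
  ext ⟨a⟩
  exact smul_zero a

/-- The converse of `homologyIso_of_elements`: homologous cycles of the source. -/
lemma homologyIso.exists_eq_d {X Y : SSet.{0}} {f : X ⟶ Y} (hf : homologyIso R f) (n : ℕ)
    (x : (X.chainComplex R).X n) (hx : ∀ m, (X.chainComplex R).d n m x = 0)
    (y : (Y.chainComplex R).X (n + 1))
    (hy : (SSet.chainComplexMap f R).f n x = (Y.chainComplex R).d (n + 1) n y) :
    ∃ x', x = (X.chainComplex R).d (n + 1) n x' := by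
  have : QuasiIso (SSet.chainComplexMap f R) := hf
  obtain ⟨A, π, hπ, x₁, h⟩ :=
    (HomologicalComplex.mono_homologyMap_iff_up_to_refinements (SSet.chainComplexMap f R)
      (n + 1) n _ (ChainComplex.prev ℕ n) rfl).1 inferInstance (ofElement x)
      (by rw [ofElement_comp, hx, ofElement_zero]) (ofElement y)
      (by rw [ofElement_comp, ofElement_comp, hy])
  obtain ⟨a, ha⟩ := (ModuleCat.epi_iff_surjective π).1 hπ ⟨1⟩
  refine ⟨x₁ a, ?_⟩
  rw [← ofElement_one x, ← ha]
  exact congr($h a)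

/-- The converse of `homologyIso_of_elements`: cycles of the target come from the source. -/
lemma homologyIso.exists_cycle {X Y : SSet.{0}} {f : X ⟶ Y} (hf : homologyIso R f) (n : ℕ)
    (y : (Y.chainComplex R).X n) (hy : ∀ m, (Y.chainComplex R).d n m y = 0) :
    ∃ x : (X.chainComplex R).X n, (∀ m, (X.chainComplex R).d n m x = 0) ∧
      ∃ z : (Y.chainComplex R).X (n + 1),
        y = (SSet.chainComplexMap f R).f n x + (Y.chainComplex R).d (n + 1) n z := by
  have : QuasiIso (SSet.chainComplexMap f R) := hf
  obtain ⟨A, π, hπ, x₂, hx₂, y₁, h⟩ :=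
    (HomologicalComplex.epi_homologyMap_iff_up_to_refinements (SSet.chainComplexMap f R)
      (n + 1) n _ (ChainComplex.prev ℕ n) rfl).1 inferInstance (ofElement y)
      (by rw [ofElement_comp, hy, ofElement_zero])
  obtain ⟨a, ha⟩ := (ModuleCat.epi_iff_surjective π).1 hπ ⟨1⟩
  refine ⟨x₂ a, eq_zero_of_next _ _ _ congr($hx₂ a), y₁ a, ?_⟩
  conv_lhs => rw [← ofElement_one y, ← ha]
  exact congr($h a)

/-! ### Relative chains -/

/-- Simplicial chains of the target of a map of simplicial sets modulo the image of the chains of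
the source. -/
def relChains (R : Vect K) : Arrow SSet.{0} ⥤ ChainComplex (Vect K) ℕ where
  obj f := cokernel (SSet.chainComplexMap f.hom R)
  map φ := cokernel.map _ _ (SSet.chainComplexMap φ.left R) (SSet.chainComplexMap φ.right R) (by
    dsimp only [SSet.chainComplexMap]
    rw [← Functor.map_comp, ← Functor.map_comp, φ.w])
  map_id f := by
    rw [← cancel_epi (cokernel.π _), cokernel.π_desc, Arrow.id_right, Category.comp_id]
    exact (congrArg (· ≫ _) (CategoryTheory.Functor.map_id _ _)).trans (Category.id_comp _)
  map_comp f g := by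
    rw [← cancel_epi (cokernel.π _), cokernel.π_desc, cokernel.π_desc_assoc, Category.assoc,
      cokernel.π_desc, Arrow.comp_right, ← Category.assoc]
    exact congrArg (· ≫ _) (Functor.map_comp _ _ _)

/-- A commutative square, seen as a map of arrows, is a relative homology isomorphism if it induces
a quasi-isomorphism on relative chains. -/
def relHomologyIso : MorphismProperty (Arrow SSet.{0}) :=
  fun _ _ φ => QuasiIso ((relChains R).map φ)

lemma relHomologyIso_eq_inverseImage :
    relHomologyIso R = (HomologicalComplex.quasiIso (Vect K) (ComplexShape.down ℕ)).inverseImage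
      (relChains R) := rfl

instance : (relHomologyIso R).HasTwoOutOfThreeProperty := by
  rw [relHomologyIso_eq_inverseImage]; infer_instance

/-- The short exact sequence of the relative chains of a monomorphism. -/
def relSequence (R : Vect K) (f : Arrow SSet.{0}) : ShortComplex (ChainComplex (Vect K) ℕ) :=
  ShortComplex.mk (SSet.chainComplexMap f.hom R) (cokernel.π _) (cokernel.condition _)

lemma relSequence_shortExact (f : Arrow SSet.{0}) [Mono f.hom] : (relSequence R f).ShortExact where
  exact := ShortComplex.exact_of_g_is_cokernel _ (cokernelIsCokernel _)
  mono_f := by dsimp [relSequence]; infer_instance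
  epi_g := by dsimp [relSequence]; infer_instance

/-- Functoriality of `relSequence`. -/
def relSequenceMap {f g : Arrow SSet.{0}} (φ : f ⟶ g) : relSequence R f ⟶ relSequence R g where
  τ₁ := SSet.chainComplexMap φ.left R
  τ₂ := SSet.chainComplexMap φ.right R
  τ₃ := (relChains R).map φ
  comm₁₂ := by
    dsimp only [SSet.chainComplexMap, relSequence]
    rw [← Functor.map_comp, ← Functor.map_comp, φ.w]
  comm₂₃ := by simp [relSequence, relChains]

lemma relHomologyIso_of_homologyIso {f g : Arrow SSet.{0}} [Mono f.hom] [Mono g.hom] (φ : f ⟶ g)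
    (h₁ : homologyIso R φ.left) (h₂ : homologyIso R φ.right) : relHomologyIso R φ :=
  HomologicalComplex.HomologySequence.quasiIso_τ₃ (relSequenceMap R φ)
    (relSequence_shortExact R f) (relSequence_shortExact R g) h₁ h₂

lemma homologyIso_right_of_relHomologyIso {f g : Arrow SSet.{0}} [Mono f.hom] [Mono g.hom]
    (φ : f ⟶ g) (h₁ : homologyIso R φ.left) (h₃ : relHomologyIso R φ) :
    homologyIso R φ.right :=
  quasiIso_τ₂ (relSequenceMap R φ) (relSequence_shortExact R f) (relSequence_shortExact R g) h₁ h₃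

lemma relHomologyIso_of_isPushout {f g : Arrow SSet.{0}} (φ : f ⟶ g)
    (h : IsPushout f.hom φ.left φ.right g.hom) : relHomologyIso R φ := by
  have := isIso_cokernel_map_of_isPushout
    (h.map ((SSet.chainComplexFunctor.{0} (Vect K)).obj R))
  have : IsIso ((relChains R).map φ) := this
  exact inferInstanceAs (QuasiIso ((relChains R).map φ))

/-! ### Unions and coproducts -/

lemma chainComplexMap_injective {X Y : SSet.{0}} (f : X ⟶ Y) [Mono f] (n : ℕ) :
    Function.Injective ((SSet.chainComplexMap f R).f n) :=
  (ModuleCat.mono_iff_injective _).1 (inferInstance : Mono ((SSet.chainComplexMap f R).f n))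

lemma chainComplexMap_comp_apply {X Y Z : SSet.{0}} (f : X ⟶ Y) (g : Y ⟶ Z) (n : ℕ)
    (x : (X.chainComplex R).X n) : (SSet.chainComplexMap (f ≫ g) R).f n x =
      (SSet.chainComplexMap g R).f n ((SSet.chainComplexMap f R).f n x) := by
  rw [SSet.chainComplexMap, Functor.map_comp]
  rfl

lemma d_chainComplexMap {X Y : SSet.{0}} (f : X ⟶ Y) (n m : ℕ) (x : (X.chainComplex R).X n) :
    (Y.chainComplex R).d n m ((SSet.chainComplexMap f R).f n x) =
      (SSet.chainComplexMap f R).f m ((X.chainComplex R).d n m x) :=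
  congr($((SSet.chainComplexMap f R).comm n m) x)

/-- A chain involves finitely many simplices, so it comes from a step of an exhausting sequence. -/
lemma exists_chains_of_sequence {X : SSet.{0}} (F : ℕ ⥤ SSet.{0})
    (a : ∀ i, F.obj i ⟶ X) (wa : ∀ i j (h : i ⟶ j), F.map h ≫ a j = a i)
    (ha : ∀ n (x : X _⦋n⦌), ∃ i y, (a i).app _ y = x) (n : ℕ) (c : (X.chainComplex R).X n) :
    ∃ i, ∀ j ≥ i, ∃ c', (SSet.chainComplexMap (a j) R).f n c' = c := by
  induction c using chains_induction with
  | h0 => exact ⟨0, fun j _ => ⟨0, map_zero _⟩⟩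
  | hadd x y hx hy =>
    obtain ⟨i, hi⟩ := hx
    obtain ⟨j, hj⟩ := hy
    refine ⟨max i j, fun k hk => ?_⟩
    obtain ⟨c, rfl⟩ := hi k (le_trans (le_max_left _ _) hk)
    obtain ⟨c', rfl⟩ := hj k (le_trans (le_max_right _ _) hk)
    exact ⟨c + c', map_add _ _ _⟩
  | hs x r =>
    obtain ⟨i, y, rfl⟩ := ha n x
    refine ⟨i, fun j hj => ⟨((F.obj j).ιChainComplex ((F.map (homOfLE hj)).app _ y) : R ⟶ _) r, ?_⟩⟩
    have := congr($(SSet.ι_chainComplexMap_f _ _ (a j) R ((F.map (homOfLE hj)).app _ y)) r)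
    rw [← wa _ _ (homOfLE hj)]
    exact this

/-- A map of simplicial sets is a homology isomorphism if it is so on the steps of exhausting
increasing sequences of subobjects. -/
lemma homologyIso_of_sequence {X Y : SSet.{0}} (f : X ⟶ Y) (F G : ℕ ⥤ SSet.{0})
    (a : ∀ i, F.obj i ⟶ X) (b : ∀ i, G.obj i ⟶ Y) (φ : F ⟶ G) (comm : ∀ i, a i ≫ f = φ.app i ≫ b i)
    (wa : ∀ i j (h : i ⟶ j), F.map h ≫ a j = a i)
    (wb : ∀ i j (h : i ⟶ j), G.map h ≫ b j = b i)
    [∀ i, Mono (a i)] [∀ i, Mono (b i)]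
    (ha : ∀ n (x : X _⦋n⦌), ∃ i y, (a i).app _ y = x)
    (hb : ∀ n (x : Y _⦋n⦌), ∃ i y, (b i).app _ y = x)
    (hφ : ∀ i, homologyIso R (φ.app i)) : homologyIso R f := by
  apply homologyIso_of_elements
  · intro n x hx y hy
    obtain ⟨i₁, h₁⟩ := exists_chains_of_sequence R F a wa ha _ x
    obtain ⟨i₂, h₂⟩ := exists_chains_of_sequence R G b wb hb _ y
    obtain ⟨x, rfl⟩ := h₁ (max i₁ i₂) (le_max_left _ _)
    obtain ⟨y, rfl⟩ := h₂ (max i₁ i₂) (le_max_right _ _)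
    obtain ⟨x', rfl⟩ := (hφ (max i₁ i₂)).exists_eq_d R n x (fun m =>
      chainComplexMap_injective R (a (max i₁ i₂)) _ (by
        rw [← d_chainComplexMap, hx, map_zero])) y
      (chainComplexMap_injective R (b (max i₁ i₂)) _ (by
        rw [← d_chainComplexMap, ← hy, ← chainComplexMap_comp_apply, ← chainComplexMap_comp_apply,
          comm]))
    exact ⟨_, (d_chainComplexMap R _ _ _ _).symm⟩
  · intro n y hy
    obtain ⟨i, h⟩ := exists_chains_of_sequence R G b wb hb _ y
    obtain ⟨y, rfl⟩ := h i le_rfl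
    obtain ⟨x, hx, z, rfl⟩ := (hφ i).exists_cycle R n y (fun m =>
      chainComplexMap_injective R (b i) _ (by rw [← d_chainComplexMap, hy, map_zero]))
    refine ⟨(SSet.chainComplexMap (a i) R).f n x, fun m => ?_,
      (SSet.chainComplexMap (b i) R).f _ z, ?_⟩
    · rw [d_chainComplexMap, hx, map_zero]
    · rw [map_add, ← chainComplexMap_comp_apply, ← chainComplexMap_comp_apply, comm,
        d_chainComplexMap]

section Coproducts

variable {I : Type} {F G : I → SSet.{0}} {c : Cofan F} {d : Cofan G}

/-- Simplicial chains commute with coproducts. -/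
def isColimitChains (hc : IsColimit c) : IsColimit (Cofan.mk (SSet.chainComplex c.pt R)
    (fun i => SSet.chainComplexMap (c.inj i) R)) :=
  isColimitMapCoconeCofanMkEquiv ((SSet.chainComplexFunctor (Vect K)).obj R) _ _
    (isColimitOfPreserves _ (hc.ofIsoColimit (Cofan.ext (Iso.refl _))))

open Classical in
/-- The projection of the chains of a coproduct to the chains of a summand. -/
def chainsProj (hc : IsColimit c) (i : I) : SSet.chainComplex c.pt R ⟶ (F i).chainComplex R :=
  Cofan.IsColimit.desc (isColimitChains R hc) (fun j =>
    if h : j = i then eqToHom (by subst h; rfl) else 0)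

lemma map_inj_chainsProj (hc : IsColimit c) (i : I) :
    SSet.chainComplexMap (c.inj i) R ≫ chainsProj R hc i = 𝟙 _ :=
  (Cofan.IsColimit.fac (isColimitChains R hc) _ i).trans (by simp)

lemma map_inj_chainsProj_of_ne (hc : IsColimit c) (i j : I) (h : j ≠ i) :
    SSet.chainComplexMap (c.inj j) R ≫ chainsProj R hc i = 0 :=
  (Cofan.IsColimit.fac (isColimitChains R hc) _ j).trans (by simp [h])

lemma chainsProj_naturality (hc : IsColimit c) (hd : IsColimit d) (φ : ∀ i, F i ⟶ G i)
    (f : c.pt ⟶ d.pt) (hf : ∀ i, c.inj i ≫ f = φ i ≫ d.inj i) (i : I) :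
    SSet.chainComplexMap f R ≫ chainsProj R hd i =
      chainsProj R hc i ≫ SSet.chainComplexMap (φ i) R := by
  refine Cofan.IsColimit.hom_ext (isColimitChains R hc) _ _ (fun j => ?_)
  have h : SSet.chainComplexMap (c.inj j) R ≫ SSet.chainComplexMap f R =
      SSet.chainComplexMap (φ j) R ≫ SSet.chainComplexMap (d.inj j) R := by
    dsimp only [SSet.chainComplexMap]
    rw [← Functor.map_comp, hf, Functor.map_comp]
  change SSet.chainComplexMap (c.inj j) R ≫ _ = SSet.chainComplexMap (c.inj j) R ≫ _
  rw [reassoc_of% h]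
  by_cases hij : j = i
  · subst hij
    rw [map_inj_chainsProj, reassoc_of% (map_inj_chainsProj R hc j), Category.comp_id]
  · rw [map_inj_chainsProj_of_ne R hd i j hij, reassoc_of% (map_inj_chainsProj_of_ne R hc i j hij),
      comp_zero, zero_comp]

lemma exists_finset_sum_chainsProj (hc : IsColimit c) (n : ℕ) (x : (c.pt.chainComplex R).X n) :
    ∃ s : Finset I, ∀ t, s ⊆ t →
      x = ∑ i ∈ t, (SSet.chainComplexMap (c.inj i) R).f n ((chainsProj R hc i).f n x) := by
  classical
  induction x using chains_induction with
  | h0 => exact ⟨∅, fun t _ => by simp⟩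
  | hadd x y hx hy =>
    obtain ⟨s, hs⟩ := hx
    obtain ⟨s', hs'⟩ := hy
    refine ⟨s ∪ s', fun t ht => ?_⟩
    conv_lhs => rw [hs t (Finset.union_subset_left ht), hs' t (Finset.union_subset_right ht)]
    simp [Finset.sum_add_distrib]
  | hs x r =>
    have hc' := isColimitOfPreserves ((CategoryTheory.evaluation _ _).obj (op ⦋n⦌)) hc
    obtain ⟨⟨i⟩, y, rfl⟩ := Types.jointly_surjective _ hc' x
    refine ⟨{i}, fun t ht => ?_⟩
    have h : (SSet.ιChainComplex c.pt ((c.inj i).app _ y) : R ⟶ _) r =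
        (SSet.chainComplexMap (c.inj i) R).f n (((F i).ιChainComplex y : R ⟶ _) r) :=
      congr($(SSet.ι_chainComplexMap_f _ _ (c.inj i) R y) r).symm
    change (SSet.ιChainComplex c.pt ((c.inj i).app _ y) : R ⟶ _) r = ∑ j ∈ t,
      (SSet.chainComplexMap (c.inj j) R).f n ((chainsProj R hc j).f n
        ((SSet.ιChainComplex c.pt ((c.inj i).app _ y) : R ⟶ _) r))
    rw [h, Finset.sum_eq_single i]
    · have := congr(($(map_inj_chainsProj R hc i)).f n
        (((F i).ιChainComplex y : R ⟶ _) r))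
      exact congrArg _ this.symm
    · intro j _ hj
      have := congr(($(map_inj_chainsProj_of_ne R hc j i hj.symm)).f n
        (((F i).ιChainComplex y : R ⟶ _) r))
      exact (congrArg _ this).trans (map_zero _)
    · intro hi
      exact absurd (ht (Finset.mem_singleton_self i)) hi

/-- Homology isomorphisms are stable under coproducts. -/
lemma homologyIso_of_isColimit_cofan
    (hc : IsColimit c) (hd : IsColimit d) (φ : ∀ i, F i ⟶ G i) (hφ : ∀ i, homologyIso R (φ i))
    (f : c.pt ⟶ d.pt) (hf : ∀ i, c.inj i ≫ f = φ i ≫ d.inj i) : homologyIso R f := by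
  have hp (i : I) (n : ℕ) (x : (c.pt.chainComplex R).X n) :
      (chainsProj R hd i).f n ((SSet.chainComplexMap f R).f n x) =
        (SSet.chainComplexMap (φ i) R).f n ((chainsProj R hc i).f n x) :=
    congr(($(chainsProj_naturality R hc hd φ f hf i)).f n x)
  have hf' (i : I) (n : ℕ) (x : ((F i).chainComplex R).X n) :
      (SSet.chainComplexMap f R).f n ((SSet.chainComplexMap (c.inj i) R).f n x) =
      (SSet.chainComplexMap (d.inj i) R).f n ((SSet.chainComplexMap (φ i) R).f n x) := by
    rw [← chainComplexMap_comp_apply, ← chainComplexMap_comp_apply, hf]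
  have hd' {C D : ChainComplex (Vect K) ℕ} (p : C ⟶ D) (i j : ℕ) (x : C.X i) :
      D.d i j (p.f i x) = p.f j (C.d i j x) := congr($(p.comm i j) x)
  apply homologyIso_of_elements
  · intro n x hx y hy
    choose x' hx' using fun i => (hφ i).exists_eq_d R n ((chainsProj R hc i).f n x)
      (fun m => by rw [hd', hx, map_zero]) ((chainsProj R hd i).f _ y)
      (by rw [← hp, hy, hd'])
    obtain ⟨s, hs⟩ := exists_finset_sum_chainsProj R hc n x
    refine ⟨∑ i ∈ s, (SSet.chainComplexMap (c.inj i) R).f _ (x' i), ?_⟩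
    rw [map_sum, hs s subset_rfl]
    refine Finset.sum_congr rfl (fun i _ => ?_)
    rw [hd', ← hx']
  · intro n y hy
    choose x hx z hz using fun i => (hφ i).exists_cycle R n ((chainsProj R hd i).f n y)
      (fun m => by rw [hd', hy, map_zero])
    obtain ⟨s, hs⟩ := exists_finset_sum_chainsProj R hd n y
    refine ⟨∑ i ∈ s, (SSet.chainComplexMap (c.inj i) R).f _ (x i), fun m => ?_,
      ∑ i ∈ s, (SSet.chainComplexMap (d.inj i) R).f _ (z i), ?_⟩
    · rw [map_sum]
      exact Finset.sum_eq_zero (fun i _ => by rw [hd', hx, map_zero])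
    · rw [map_sum, map_sum, ← Finset.sum_add_distrib, hs s subset_rfl]
      refine Finset.sum_congr rfl (fun i _ => ?_)
      rw [hf', hd', ← map_add, ← hz]

end Coproducts

/-! ### Barycentric subdivision of tuples -/

/-- The linear map out of simplicial chains that is given by its values on simplices. -/
def chainsDesc {S : SSet.{0}} {n : ℕ} {M : Vect K} (f : S _⦋n⦌ → (R ⟶ M)) :
    (S.chainComplex R).X n ⟶ M :=
  Cofan.IsColimit.desc (S.isColimitChainComplexXCofan R n) f

@[simp]
lemma ι_chainsDesc {S : SSet.{0}} {n : ℕ} {M : Vect K} (f : S _⦋n⦌ → (R ⟶ M)) (x : S _⦋n⦌) :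
    S.ιChainComplex x ≫ chainsDesc R f = f x :=
  Cofan.IsColimit.fac _ _ _

/-- The simplicial set of all tuples of points of `Q`. -/
def tuples (Q : Type) : SSet.{0} where
  obj n := Fin (n.unop.len + 1) → Q
  map f := ↾ fun v => v ∘ f.unop.toOrderHom

/-- Functoriality of `tuples`. -/
def tuplesMap {Q Q' : Type} (g : Q → Q') : tuples Q ⟶ tuples Q' where
  app _ := ↾ fun v => g ∘ v

/-- The tuple `v`, as a generator of the chains of `tuples Q`. -/
abbrev ιTuple {Q : Type} {n : ℕ} (v : Fin (n + 1) → Q) : R ⟶ ((tuples Q).chainComplex R).X n :=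
  (tuples Q).ιChainComplex (n := n) v

lemma ιTuple_d {Q : Type} {n : ℕ} (v : Fin (n + 2) → Q) :
    ιTuple R v ≫ ((tuples Q).chainComplex R).d (n + 1) n =
      ∑ i : Fin (n + 2), (-1) ^ i.val • ιTuple R (v ∘ i.succAbove) :=
  SSet.ιChainComplex_d _ _ _

lemma ιTuple_map {Q Q' : Type} (g : Q → Q') {n : ℕ} (v : Fin (n + 1) → Q) :
    ιTuple R v ≫ (SSet.chainComplexMap (tuplesMap g) R).f n = ιTuple R (g ∘ v) :=
  SSet.ι_chainComplexMap_f _ _ _ _ _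

lemma tuples_hom_ext {Q : Type} {n : ℕ} {M : Vect K} {f g : ((tuples Q).chainComplex R).X n ⟶ M}
    (h : ∀ v : Fin (n + 1) → Q, ιTuple R v ≫ f = ιTuple R v ≫ g) : f = g :=
  SSet.chainComplex_hom_ext h

section Subdivision

variable {Q : Type}

/-- The cone with vertex `b`: the operator on chains that puts `b` in front of a tuple. -/
def cone (b : Q) (n : ℕ) :
    ((tuples Q).chainComplex R).X n ⟶ ((tuples Q).chainComplex R).X (n + 1) :=
  chainsDesc R (fun v => ιTuple R (Fin.cons b v : Fin (n + 2) → Q))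

lemma ι_cone (b : Q) {n : ℕ} (v : Fin (n + 1) → Q) :
    ιTuple R v ≫ cone R b n = ιTuple R (Fin.cons b v : Fin (n + 2) → Q) :=
  ι_chainsDesc _ _ _

lemma cons_comp_succAbove_succ (b : Q) {n : ℕ} (v : Fin (n + 2) → Q) (i : Fin (n + 2)) :
    (Fin.cons b v : Fin (n + 3) → Q) ∘ i.succ.succAbove =
      (Fin.cons b (v ∘ i.succAbove) : Fin (n + 2) → Q) := by
  ext j
  cases j using Fin.cases <;> simp

lemma cone_d (b : Q) (n : ℕ) :
    cone R b (n + 1) ≫ ((tuples Q).chainComplex R).d (n + 2) (n + 1) =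
      𝟙 _ - ((tuples Q).chainComplex R).d (n + 1) n ≫ cone R b n := by
  apply tuples_hom_ext
  intro v
  rw [← Category.assoc]
  rw [ι_cone]
  rw [ιTuple_d, Preadditive.comp_sub, Category.comp_id, ← Category.assoc, Fin.sum_univ_succ]
  rw [ιTuple_d R v]
  rw [sub_eq_add_neg, Preadditive.sum_comp, ← Finset.sum_neg_distrib]
  congr 1
  · simp
  · refine Finset.sum_congr rfl (fun i _ => ?_)
    rw [cons_comp_succAbove_succ, Preadditive.zsmul_comp, ι_cone, Fin.val_succ, pow_succ]
    simp

lemma cone_d_zero (b : Q) (v : Fin 1 → Q) :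
    ιTuple R v ≫ cone R b 0 ≫ ((tuples Q).chainComplex R).d 1 0 =
      ιTuple R v - ιTuple R (n := 0) (fun _ => b) := by
  rw [← Category.assoc, ι_cone, ιTuple_d, Fin.sum_univ_two]
  have h1 : (Fin.cons b v : Fin 2 → Q) ∘ (0 : Fin 2).succAbove = v := by ext i; simp
  have h2 : (Fin.cons b v : Fin 2 → Q) ∘ (1 : Fin 2).succAbove = fun _ => b := by
    ext i
    obtain rfl := Subsingleton.elim i 0
    simp
  rw [h1, h2]
  simp [sub_eq_add_neg]

/-- A boundary is the boundary of the cone over it. -/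
lemma d_cone_d (b : Q) (n : ℕ) :
    ((tuples Q).chainComplex R).d (n + 1) n ≫ cone R b n ≫
      ((tuples Q).chainComplex R).d (n + 1) n = ((tuples Q).chainComplex R).d (n + 1) n := by
  cases n with
  | succ n => rw [cone_d, Preadditive.comp_sub]; simp
  | zero =>
    apply tuples_hom_ext
    intro v
    rw [← Category.assoc]
    rw [ιTuple_d R v]
    rw [Preadditive.sum_comp, Fin.sum_univ_two, Fin.sum_univ_two, Preadditive.zsmul_comp,
      Preadditive.zsmul_comp, cone_d_zero, cone_d_zero]
    simp
    abel

variable (β : ∀ n : ℕ, (Fin (n + 1) → Q) → Q)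

/-- Barycentric subdivision of tuples: a tuple `v` goes to the cone, with vertex the barycenter
`β v`, over the subdivision of the boundary of `v`. -/
def subdivision (n : ℕ) : ((tuples Q).chainComplex R).X n ⟶ ((tuples Q).chainComplex R).X n :=
  Nat.rec (𝟙 _) (fun n f => chainsDesc R (fun v => (tuples Q).ιChainComplex v ≫
    ((tuples Q).chainComplex R).d (n + 1) n ≫ f ≫ cone R (β _ v) n)) n

/-- The homotopy from the identity to barycentric subdivision. -/
def subdivisionHomotopy (n : ℕ) :
    ((tuples Q).chainComplex R).X n ⟶ ((tuples Q).chainComplex R).X (n + 1) :=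
  Nat.rec 0 (fun n f => chainsDesc R (fun v => (tuples Q).ιChainComplex v ≫
    (𝟙 _ - ((tuples Q).chainComplex R).d (n + 1) n ≫ f) ≫ cone R (β _ v) (n + 1))) n

lemma subdivisionHomotopy_zero : subdivisionHomotopy R β 0 = 0 := rfl

lemma subdivision_zero : subdivision R β 0 = 𝟙 _ := rfl

lemma ι_subdivision_succ {n : ℕ} (v : Fin (n + 2) → Q) :
    ιTuple R v ≫ subdivision R β (n + 1) = ιTuple R v ≫
      ((tuples Q).chainComplex R).d (n + 1) n ≫ subdivision R β n ≫ cone R (β _ v) n :=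
  ι_chainsDesc _ _ _

lemma ι_subdivisionHomotopy_succ {n : ℕ} (v : Fin (n + 2) → Q) :
    ιTuple R v ≫ subdivisionHomotopy R β (n + 1) = ιTuple R v ≫
      (𝟙 _ - ((tuples Q).chainComplex R).d (n + 1) n ≫ subdivisionHomotopy R β n) ≫
        cone R (β _ v) (n + 1) :=
  ι_chainsDesc _ _ _

lemma subdivision_d (n : ℕ) :
    subdivision R β (n + 1) ≫ ((tuples Q).chainComplex R).d (n + 1) n =
      ((tuples Q).chainComplex R).d (n + 1) n ≫ subdivision R β n := by
  induction n with
  | zero =>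
    apply tuples_hom_ext
    intro v
    rw [← Category.assoc]
    rw [ι_subdivision_succ R β v]
    simp only [subdivision_zero, Category.id_comp, Category.comp_id, Category.assoc]
    rw [d_cone_d]
  | succ n ih =>
    apply tuples_hom_ext
    intro v
    rw [← Category.assoc]
    rw [ι_subdivision_succ R β v]
    simp only [Category.assoc]
    rw [cone_d, Preadditive.comp_sub, reassoc_of% ih]
    simp

lemma subdivisionHomotopy_d (n : ℕ) :
    subdivisionHomotopy R β (n + 1) ≫ ((tuples Q).chainComplex R).d (n + 2) (n + 1) =
      𝟙 _ - subdivision R β (n + 1) -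
        ((tuples Q).chainComplex R).d (n + 1) n ≫ subdivisionHomotopy R β n := by
  have key : ((tuples Q).chainComplex R).d (n + 1) n ≫ subdivisionHomotopy R β n ≫
      ((tuples Q).chainComplex R).d (n + 1) n = ((tuples Q).chainComplex R).d (n + 1) n -
        ((tuples Q).chainComplex R).d (n + 1) n ≫ subdivision R β n := by
    cases n with
    | zero => simp [subdivisionHomotopy_zero, subdivision_zero]
    | succ n =>
      rw [subdivisionHomotopy_d n]
      simp [Preadditive.comp_sub]
  apply tuples_hom_ext
  intro v
  rw [← Category.assoc]
  rw [ι_subdivisionHomotopy_succ R β v]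
  rw [Category.assoc, Category.assoc, cone_d, Preadditive.comp_sub, Category.comp_id,
    Preadditive.comp_sub, Preadditive.comp_sub, Preadditive.comp_sub, Preadditive.comp_sub]
  rw [ι_subdivision_succ R β v]
  rw [← Category.assoc (𝟙 _ - _), Preadditive.sub_comp, Category.id_comp, Category.assoc, key,
    sub_sub_cancel, Category.assoc, Category.comp_id]
  abel

variable {Q' : Type} (β' : ∀ n : ℕ, (Fin (n + 1) → Q') → Q') (g : Q → Q')

lemma cone_map (b : Q) (n : ℕ) :
    cone R b n ≫ (SSet.chainComplexMap (tuplesMap g) R).f (n + 1) =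
      (SSet.chainComplexMap (tuplesMap g) R).f n ≫ cone R (g b) n := by
  apply tuples_hom_ext
  intro v
  rw [← Category.assoc, ← Category.assoc]
  rw [ι_cone, ιTuple_map, ιTuple_map]
  rw [ι_cone]
  congr 1
  exact Fin.comp_cons _ _ _

variable (hg : ∀ n v, g (β n v) = β' n (g ∘ v))
include hg

lemma subdivision_map (n : ℕ) :
    subdivision R β n ≫ (SSet.chainComplexMap (tuplesMap g) R).f n =
      (SSet.chainComplexMap (tuplesMap g) R).f n ≫ subdivision R β' n := by
  induction n with
  | zero => simp [subdivision_zero]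
  | succ n ih =>
    apply tuples_hom_ext
    intro v
    rw [← Category.assoc, ← Category.assoc]
    rw [ι_subdivision_succ R β v, ιTuple_map]
    rw [ι_subdivision_succ, Category.assoc, Category.assoc, Category.assoc, cone_map,
      reassoc_of% ih, ← ιTuple_map, Category.assoc, HomologicalComplex.Hom.comm_assoc, hg]

lemma subdivisionHomotopy_map (n : ℕ) :
    subdivisionHomotopy R β n ≫ (SSet.chainComplexMap (tuplesMap g) R).f (n + 1) =
      (SSet.chainComplexMap (tuplesMap g) R).f n ≫ subdivisionHomotopy R β' n := by
  induction n with
  | zero => simp [subdivisionHomotopy_zero]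
  | succ n ih =>
    apply tuples_hom_ext
    intro v
    rw [← Category.assoc, ← Category.assoc]
    rw [ι_subdivisionHomotopy_succ R β v, ιTuple_map]
    rw [ι_subdivisionHomotopy_succ, Category.assoc, Category.assoc, cone_map, hg, ← ιTuple_map,
      Category.assoc]
    congr 1
    simp only [Preadditive.sub_comp, Preadditive.comp_sub, Category.id_comp,
      Category.assoc, reassoc_of% ih, HomologicalComplex.Hom.comm_assoc]

end Subdivision

/-! ### Affine simplices -/

/-- The standard topological simplex of dimension `n`. -/
abbrev Simplex (n : ℕ) : Type := stdSimplex ℝ (Fin (n + 1))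

/-- The affine map of simplices that is given by the images of the vertices. -/
def affine {n m : ℕ} (v : Fin (n + 1) → Simplex m) : C(Simplex n, Simplex m) where
  toFun t := ⟨∑ i, t i • (v i).1, (convex_stdSimplex ℝ _).sum_mem (fun i _ => t.2.1 i) t.2.2
    (fun i _ => (v i).2)⟩
  continuous_toFun := by
    refine Continuous.subtype_mk (continuous_finsetSum _ (fun i _ => ?_)) _
    exact ((continuous_apply i).comp continuous_subtype_val).smul continuous_const

lemma affine_apply {n m : ℕ} (v : Fin (n + 1) → Simplex m) (t : Simplex n) (j : Fin (m + 1)) :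
    affine v t j = ∑ i, t i * v i j := by
  change (∑ i, t i • (v i).1) j = _
  rw [Finset.sum_apply]
  rfl

lemma affine_affine {n m k : ℕ} (u : Fin (m + 1) → Simplex k) (v : Fin (n + 1) → Simplex m)
    (t : Simplex n) : affine u (affine v t) = affine (fun i => affine u (v i)) t := by
  ext j
  simp_rw [affine_apply, Finset.sum_mul, Finset.mul_sum]
  rw [Finset.sum_comm]
  simp_rw [mul_assoc]

lemma affine_vertex {n m : ℕ} (v : Fin (n + 1) → Simplex m) (i : Fin (n + 1)) :
    affine v (stdSimplex.vertex i) = v i := by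
  ext j
  rw [affine_apply]
  simp [Pi.single_apply]

lemma affine_map {n m k : ℕ} (v : Fin (n + 1) → Simplex m) (f : Fin (k + 1) → Fin (n + 1))
    (t : Simplex k) : affine v (stdSimplex.map f t) = affine (v ∘ f) t := by
  ext j
  rw [affine_apply, affine_apply]
  simp only [stdSimplex.map_coe, FunOnFinite.linearMap_apply_apply, Finset.sum_mul,
    Function.comp_apply]
  rw [← Finset.sum_fiberwise Finset.univ f]
  refine Finset.sum_congr rfl (fun i _ => Finset.sum_congr rfl (fun l hl => ?_))
  rw [(Finset.mem_filter.1 hl).2]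

lemma affine_vertices {n k : ℕ} (f : Fin (k + 1) → Fin (n + 1)) (t : Simplex k) :
    affine (fun i => stdSimplex.vertex (f i)) t = stdSimplex.map f t := by
  have : stdSimplex.map f t = affine stdSimplex.vertex (stdSimplex.map f t) := by
    ext j
    rw [affine_apply]
    simp [Pi.single_apply]
  rw [this, affine_map]
  rfl

/-- The barycenter of a tuple of points of a simplex. -/
def bary {m : ℕ} (n : ℕ) (v : Fin (n + 1) → Simplex m) : Simplex m :=
  affine v stdSimplex.barycenter

lemma affine_bary {m k : ℕ} (u : Fin (m + 1) → Simplex k) (n : ℕ) (v : Fin (n + 1) → Simplex m) :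
    affine u (bary n v) = bary n (affine u ∘ v) :=
  affine_affine _ _ _

/-- The affine image is no further from a point than the images of the vertices. -/
lemma dist_affine_le {n m : ℕ} (v : Fin (n + 1) → Simplex m) (t : Simplex n) (p : Simplex m)
    (r : ℝ) (h : ∀ i, dist (v i) p ≤ r) : dist (affine v t) p ≤ r := by
  have := (convex_closedBall p.1 r).sum_mem (t := Finset.univ) (w := fun i => t i)
    (z := fun i => (v i).1) (fun i _ => t.2.1 i) t.2.2 (fun i _ => Metric.mem_closedBall.2 (h i))
  exact Metric.mem_closedBall.1 this

/-- The barycenter of a tuple of `n + 1` points of diameter at most `δ` has distance at most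
`n / (n + 1) * δ` to each of them. -/
lemma dist_bary_le {n m : ℕ} (v : Fin (n + 1) → Simplex m) (δ : ℝ)
    (h : ∀ i j, dist (v i) (v j) ≤ δ) (j : Fin (n + 1)) :
    dist (bary n v) (v j) ≤ n / (n + 1) * δ := by
  have hδ : 0 ≤ δ := dist_nonneg.trans (h 0 0)
  have e : (bary n v).1 - (v j).1 = ∑ i, ((n : ℝ) + 1)⁻¹ • ((v i).1 - (v j).1) := by
    ext k
    have h1 : (bary n v).1 k = ∑ i, ((n : ℝ) + 1)⁻¹ * v i k := by
      refine (affine_apply v stdSimplex.barycenter k).trans (Finset.sum_congr rfl (fun i _ => ?_))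
      congr 1
      change (stdSimplex.barycenter : stdSimplex ℝ (Fin (n + 1))).val i = _
      simp
    rw [Pi.sub_apply, h1, Finset.sum_apply]
    simp only [Pi.smul_apply, Pi.sub_apply, smul_eq_mul, mul_sub, Finset.sum_sub_distrib,
      Finset.sum_const, Finset.card_univ, Fintype.card_fin, nsmul_eq_mul]
    congr 1
    push_cast
    field_simp
  rw [Subtype.dist_eq, dist_eq_norm, e, ← Finset.sum_erase (a := j) _ (by simp)]
  refine (norm_sum_le_of_le (Finset.univ.erase j)
    (f := fun i => ((n : ℝ) + 1)⁻¹ • ((v i).1 - (v j).1))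
    (n := fun _ => ((n : ℝ) + 1)⁻¹ * δ) (fun i _ => ?_)).trans ?_
  · rw [norm_smul, Real.norm_of_nonneg (by positivity)]
    have := h i j
    rw [Subtype.dist_eq, dist_eq_norm] at this
    gcongr
  · rw [Finset.sum_const, Finset.card_erase_of_mem (Finset.mem_univ _), Finset.card_univ,
      Fintype.card_fin, nsmul_eq_mul]
    apply le_of_eq
    simp
    field_simp

/-! ### Supports -/

lemma sum_zsmul_apply_mem {M N : Vect K} {ι : Type} [Fintype ι] (a : ι → ℤ) (f : ι → (M ⟶ N))
    (x : M) (q : Submodule K N) (h : ∀ i, f i x ∈ q) : (∑ i, a i • f i : M ⟶ N) x ∈ q := by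
  have e : (∑ i, a i • f i : M ⟶ N) x = ∑ i, a i • f i x := by
    change (∑ i, a i • f i : M ⟶ N).hom x = _
    rw [ModuleCat.hom_sum, LinearMap.sum_apply]
    rfl
  rw [e]
  exact Submodule.sum_mem _ (fun i _ => zsmul_mem (h i) _)

/-- The chains that are supported on a set of simplices. -/
def supported {S : SSet.{0}} {n : ℕ} (P : Set (S _⦋n⦌)) : Submodule K ((S.chainComplex R).X n) :=
  ⨆ x ∈ P, LinearMap.range (S.ιChainComplex x : R ⟶ _).hom

lemma ι_mem_supported {S : SSet.{0}} {n : ℕ} {P : Set (S _⦋n⦌)} {x : S _⦋n⦌} (hx : x ∈ P) (r : R) :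
    (S.ιChainComplex x : R ⟶ _) r ∈ supported R P :=
  Submodule.mem_iSup_of_mem x (Submodule.mem_iSup_of_mem hx ⟨r, rfl⟩)

lemma map_mem_of_mem_supported {S : SSet.{0}} {n : ℕ} {P : Set (S _⦋n⦌)} {M : Vect K}
    (f : (S.chainComplex R).X n ⟶ M) (q : Submodule K M)
    (h : ∀ x ∈ P, ∀ r : R, f ((S.ιChainComplex x : R ⟶ _) r) ∈ q)
    {c : (S.chainComplex R).X n} (hc : c ∈ supported R P) : f c ∈ q := by
  have : supported R P ≤ q.comap f.hom := by
    refine iSup_le (fun x => iSup_le (fun hx => ?_))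
    rintro _ ⟨r, rfl⟩
    exact h x hx r
  exact this hc

lemma supported_univ {S : SSet.{0}} {n : ℕ} : supported R (Set.univ : Set (S _⦋n⦌)) = ⊤ :=
  chains_eq_top R _ (fun x _ => ι_mem_supported R (Set.mem_univ x) _)

lemma supported_mono {S : SSet.{0}} {n : ℕ} {P P' : Set (S _⦋n⦌)} (h : P ⊆ P') :
    supported R P ≤ supported R P' :=
  fun _ hc => map_mem_of_mem_supported R (𝟙 _) _ (fun _ hx _ => ι_mem_supported R (h hx) _) hc

/-- The image of a chain of `S` lies in a set of simplices of `S'` if the simplices of `S` do. -/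
lemma map_mem_supported {S S' : SSet.{0}} {n : ℕ} {P : Set (S _⦋n⦌)} {P' : Set (S' _⦋n⦌)}
    (f : S ⟶ S') (h : ∀ x ∈ P, f.app _ x ∈ P') {c : (S.chainComplex R).X n}
    (hc : c ∈ supported R P) : (SSet.chainComplexMap f R).f n c ∈ supported R P' :=
  map_mem_of_mem_supported R _ _ (fun x hx r => by
    have e : (SSet.chainComplexMap f R).f n ((S.ιChainComplex x : R ⟶ _) r) = _ :=
      congr($(SSet.ι_chainComplexMap_f _ _ f R x) r)
    rw [e]
    exact ι_mem_supported R (h x hx) _) hc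

lemma exists_of_mem_supported_range {S S' : SSet.{0}} {n : ℕ} (f : S ⟶ S')
    {c : (S'.chainComplex R).X n} (hc : c ∈ supported R (Set.range (f.app (op ⦋n⦌)))) :
    ∃ c', (SSet.chainComplexMap f R).f n c' = c := by
  refine map_mem_of_mem_supported R (𝟙 _)
    (LinearMap.range ((SSet.chainComplexMap f R).f n).hom) ?_ hc
  rintro _ ⟨x, rfl⟩ r
  exact ⟨_, congr($(SSet.ι_chainComplexMap_f _ _ f R x) r)⟩

/-- Tuples that are in every ball that contains `v`, and which have mutual distances at most `ε`. -/
def fine {m : ℕ} {k : ℕ} (v : Fin (k + 1) → Simplex m) (ε : ℝ) (n : ℕ) :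
    Set ((tuples (Simplex m)) _⦋n⦌) :=
  Set.ofPred fun w : Fin (n + 1) → Simplex m =>
    (∀ p r, (∀ i, dist (v i) p ≤ r) → ∀ i, dist (w i) p ≤ r) ∧ ∀ i j, dist (w i) (w j) ≤ ε

/-- Subdivision of a tuple of dimension at most `N` shrinks the diameter by the factor
`N / (N + 1)`, and it stays in every ball that contains the tuple. -/
lemma subdivision_mem {m : ℕ} (N : ℕ) {n : ℕ} (hn : n ≤ N) (v : Fin (n + 1) → Simplex m) (δ : ℝ)
    (h : ∀ i j, dist (v i) (v j) ≤ δ) (r : R) :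
    (ιTuple R v ≫ subdivision R (fun n => bary n) n) r ∈
      supported R (fine v (N / (N + 1) * δ) n) := by
  have hδ : 0 ≤ δ := dist_nonneg.trans (h 0 0)
  induction n with
  | zero =>
    rw [subdivision_zero, Category.comp_id]
    refine ι_mem_supported R (P := fine v _ 0) (x := v) ⟨fun p r h => h, fun i j => ?_⟩ r
    rw [Subsingleton.elim (α := Fin 1) i j, dist_self]
    positivity
  | succ n ih =>
    rw [ι_subdivision_succ, ← Category.assoc, ιTuple_d, Preadditive.sum_comp]
    simp_rw [Preadditive.zsmul_comp]
    refine sum_zsmul_apply_mem _ _ _ _ (fun i => ?_)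
    rw [← Category.assoc]
    refine map_mem_of_mem_supported R (cone R (bary _ v) n) _ (fun w hw r => ?_)
      (ih (by lia) (v ∘ i.succAbove) (fun _ _ => h _ _))
    have e : cone R (bary _ v) n (((tuples (Simplex m)).ιChainComplex w : R ⟶ _) r) = _ :=
      congr($(ι_cone R (bary _ v) w) r)
    rw [e]
    have hb : ∀ j, dist (bary _ v) (v j) ≤ N / (N + 1) * δ := fun j => by
      refine (dist_bary_le v δ h j).trans ?_
      have : ((n + 1 : ℕ) : ℝ) ≤ N := by exact_mod_cast hn
      gcongr ?_ * _
      rw [div_le_div_iff₀ (by positivity) (by positivity)]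
      linarith
    have hw' : ∀ j, dist (w j) (bary _ v) ≤ N / (N + 1) * δ :=
      hw.1 _ _ (fun j => by rw [dist_comm]; exact hb _)
    refine ι_mem_supported R (P := fine v _ (n + 1))
      (x := (Fin.cons (bary _ v) w : Fin (n + 2) → Simplex m))
      ⟨fun p r' hp j => ?_, fun j k => ?_⟩ r
    · cases j using Fin.cases with
      | zero => exact dist_affine_le _ _ _ _ hp
      | succ j => exact hw.1 p r' (fun _ => hp _) j
    · cases j using Fin.cases with
      | zero =>
        cases k using Fin.cases with
        | zero => rw [dist_self]; positivity
        | succ k => rw [dist_comm]; exact hw' k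
      | succ j =>
        cases k using Fin.cases with
        | zero => exact hw' j
        | succ k => exact hw.2 j k

/-! ### Subdivision of singular chains -/

/-- A continuous map from a simplex, as a simplex of the singular simplicial set. -/
def sing {Y : TopCat.{0}} {n : ℕ} (σ : C(Simplex n, Y)) : (TopCat.toSSet.obj Y) _⦋n⦌ :=
  (TopCat.toSSetObjEquiv Y (op ⦋n⦌)).symm σ

lemma sing_surjective {Y : TopCat.{0}} {n : ℕ} (x : (TopCat.toSSet.obj Y) _⦋n⦌) :
    ∃ σ : C(Simplex n, Y), sing σ = x :=
  (TopCat.toSSetObjEquiv Y (op ⦋n⦌)).symm.surjective x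

lemma toSSet_map_sing {Y Z : TopCat.{0}} (g : Y ⟶ Z) {n : ℕ} (σ : C(Simplex n, Y)) :
    (TopCat.toSSet.map g).app _ (sing σ) = sing (g.hom.comp σ) := rfl

lemma map_sing {Y : TopCat.{0}} {n m : ℕ} (f : ⦋n⦌ ⟶ ⦋m⦌) (σ : C(Simplex m, Y)) :
    (TopCat.toSSet.obj Y).map f.op (sing σ) =
      sing (σ.comp ⟨stdSimplex.map f.toOrderHom, stdSimplex.continuous_map _⟩) := rfl

section Singular

variable {Y : TopCat.{0}}

/-- A singular simplex of dimension `m` sends tuples of points of the standard simplex to affine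
singular simplices. -/
def affineMap {m : ℕ} (σ : C(Simplex m, Y)) : tuples (Simplex m) ⟶ TopCat.toSSet.obj Y where
  app n := ↾ fun v => (TopCat.toSSetObjEquiv Y n).symm (σ.comp (affine v))
  naturality n k f := by
    ext v
    change sing (σ.comp (affine (v ∘ f.unop.toOrderHom))) =
      sing ((σ.comp (affine v)).comp
        ⟨stdSimplex.map f.unop.toOrderHom, stdSimplex.continuous_map _⟩)
    congr 1
    ext t
    exact congrArg σ (affine_map v _ t).symm

lemma tuplesMap_affineMap {m n : ℕ} (σ : C(Simplex m, Y)) (v : Fin (n + 1) → Simplex m) :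
    tuplesMap (affine v) ≫ affineMap σ = affineMap (σ.comp (affine v)) := by
  ext k w
  change (TopCat.toSSetObjEquiv Y k).symm _ = (TopCat.toSSetObjEquiv Y k).symm _
  congr 1
  ext t
  exact congrArg σ (affine_affine _ _ _).symm

variable (Y)

/-- The operation on singular chains that is given by a universal chain in the standard simplex. -/
def operation {n k : ℕ} (z : R ⟶ ((tuples (Simplex n)).chainComplex R).X k) :
    ((TopCat.toSSet.obj Y).chainComplex R).X n ⟶ ((TopCat.toSSet.obj Y).chainComplex R).X k :=
  chainsDesc R (fun x =>
    z ≫ (SSet.chainComplexMap (affineMap (TopCat.toSSetObjEquiv Y (op ⦋n⦌) x)) R).f k)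

/-- A singular simplex, as a generator of the singular chains. -/
abbrev ιSing {Y : TopCat.{0}} {n : ℕ} (σ : C(Simplex n, Y)) :
    R ⟶ ((TopCat.toSSet.obj Y).chainComplex R).X n :=
  (TopCat.toSSet.obj Y).ιChainComplex (sing σ)

lemma sing_hom_ext {Y : TopCat.{0}} {n : ℕ} {M : Vect K}
    {f g : ((TopCat.toSSet.obj Y).chainComplex R).X n ⟶ M}
    (h : ∀ σ : C(Simplex n, Y), ιSing R σ ≫ f = ιSing R σ ≫ g) : f = g :=
  SSet.chainComplex_hom_ext (fun x => by
    obtain ⟨σ, rfl⟩ := sing_surjective x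
    exact h σ)

variable {Y} in
lemma ι_operation {n k : ℕ} (z : R ⟶ ((tuples (Simplex n)).chainComplex R).X k)
    (σ : C(Simplex n, Y)) :
    ιSing R σ ≫ operation R Y z = z ≫ (SSet.chainComplexMap (affineMap σ) R).f k := by
  refine (ι_chainsDesc _ _ _).trans ?_
  rw [sing, Equiv.apply_symm_apply]

/-- The tuple of the vertices of the standard simplex. -/
abbrev vertices (n : ℕ) : Fin (n + 1) → Simplex n := fun i => stdSimplex.vertex i

lemma ιTuple_affineMap {m n : ℕ} (σ : C(Simplex m, Y)) (v : Fin (n + 1) → Simplex m) :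
    ιTuple R v ≫ (SSet.chainComplexMap (affineMap σ) R).f n = ιSing R (σ.comp (affine v)) :=
  SSet.ι_chainComplexMap_f _ _ _ _ _

lemma affine_vertices' (n : ℕ) : affine (vertices n) = ContinuousMap.id _ := by
  ext t : 1
  exact (affine_vertices id t).trans (stdSimplex.map_id_apply t)

lemma operation_vertices (n : ℕ) : operation R Y (ιTuple R (vertices n)) = 𝟙 _ := by
  apply sing_hom_ext
  intro σ
  rw [ι_operation, ιTuple_affineMap, affine_vertices']
  exact (Category.comp_id _).symm

lemma operation_d {n k l : ℕ} (z : R ⟶ ((tuples (Simplex n)).chainComplex R).X k) :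
    operation R Y z ≫ ((TopCat.toSSet.obj Y).chainComplex R).d k l =
      operation R Y (z ≫ ((tuples (Simplex n)).chainComplex R).d k l) := by
  apply sing_hom_ext
  intro σ
  rw [← Category.assoc, ι_operation, ι_operation, Category.assoc, Category.assoc,
    HomologicalComplex.Hom.comm]

lemma operation_sub {n k : ℕ} (z z' : R ⟶ ((tuples (Simplex n)).chainComplex R).X k) :
    operation R Y (z - z') = operation R Y z - operation R Y z' := by
  apply sing_hom_ext
  intro σ
  rw [Preadditive.comp_sub, ι_operation, ι_operation, ι_operation, Preadditive.sub_comp]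

/-- Precomposition with the differential of an operation that comes from a natural operation `φ`
on tuples. -/
lemma d_operation {n k : ℕ}
    (φ : ∀ m : ℕ, ((tuples (Simplex m)).chainComplex R).X n ⟶
      ((tuples (Simplex m)).chainComplex R).X k)
    (hφ : ∀ (m l : ℕ) (v : Fin (l + 1) → Simplex m),
      φ l ≫ (SSet.chainComplexMap (tuplesMap (affine v)) R).f k =
        (SSet.chainComplexMap (tuplesMap (affine v)) R).f n ≫ φ m) :
    ((TopCat.toSSet.obj Y).chainComplex R).d (n + 1) n ≫
        operation R Y (ιTuple R (vertices n) ≫ φ n) =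
      operation R Y (ιTuple R (vertices (n + 1)) ≫
        ((tuples (Simplex (n + 1))).chainComplex R).d (n + 1) n ≫ φ (n + 1)) := by
  apply sing_hom_ext
  intro σ
  rw [← Category.assoc, SSet.ιChainComplex_d, ι_operation, ← Category.assoc, ιTuple_d,
    Preadditive.sum_comp, Preadditive.sum_comp, Preadditive.sum_comp]
  refine Finset.sum_congr rfl (fun i _ => ?_)
  rw [Preadditive.zsmul_comp, Preadditive.zsmul_comp, Preadditive.zsmul_comp]
  congr 1
  have h1 : (TopCat.toSSet.obj Y).δ i (sing σ) =
      sing (σ.comp (affine (vertices (n + 1) ∘ i.succAbove))) := by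
    refine (map_sing (SimplexCategory.δ i) σ).trans ?_
    congr 1
    ext t
    exact congrArg σ (affine_vertices _ t).symm
  have h2 : ιTuple R (vertices (n + 1) ∘ i.succAbove) = ιTuple R (vertices n) ≫
      (SSet.chainComplexMap (tuplesMap (affine (vertices (n + 1) ∘ i.succAbove))) R).f n := by
    rw [ιTuple_map]
    congr 1
    ext j : 1
    exact (affine_vertex _ _).symm
  rw [h1, ι_operation, h2, Category.assoc, Category.assoc, Category.assoc, ← reassoc_of% hφ]
  congr 2
  rw [← tuplesMap_affineMap]
  rw [chainComplexMap_comp, HomologicalComplex.comp_f]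

/-- Barycentric subdivision of singular chains. -/
def sd (n : ℕ) :
    ((TopCat.toSSet.obj Y).chainComplex R).X n ⟶ ((TopCat.toSSet.obj Y).chainComplex R).X n :=
  operation R Y (ιTuple R (vertices n) ≫ subdivision R (fun n => bary n) n)

/-- The homotopy from the identity to barycentric subdivision of singular chains. -/
def sdHomotopy (n : ℕ) :
    ((TopCat.toSSet.obj Y).chainComplex R).X n ⟶
      ((TopCat.toSSet.obj Y).chainComplex R).X (n + 1) :=
  operation R Y (ιTuple R (vertices n) ≫ subdivisionHomotopy R (fun n => bary n) n)

lemma sd_d (n : ℕ) : sd R Y (n + 1) ≫ ((TopCat.toSSet.obj Y).chainComplex R).d (n + 1) n =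
    ((TopCat.toSSet.obj Y).chainComplex R).d (n + 1) n ≫ sd R Y n := by
  dsimp only [sd]
  rw [operation_d, Category.assoc, subdivision_d, d_operation R Y
    (fun m => subdivision R (fun n => bary n) n)
    (fun m l v => subdivision_map R _ _ _ (affine_bary v) _)]

lemma sdHomotopy_d (n : ℕ) :
    sdHomotopy R Y (n + 1) ≫ ((TopCat.toSSet.obj Y).chainComplex R).d (n + 2) (n + 1) =
      𝟙 _ - sd R Y (n + 1) -
        ((TopCat.toSSet.obj Y).chainComplex R).d (n + 1) n ≫ sdHomotopy R Y n := by
  dsimp only [sd, sdHomotopy]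
  rw [operation_d, Category.assoc, subdivisionHomotopy_d, d_operation R Y
    (fun m => subdivisionHomotopy R (fun n => bary n) n)
    (fun m l v => subdivisionHomotopy_map R _ _ _ (affine_bary v) _), ← operation_vertices,
    ← operation_sub, ← operation_sub, Preadditive.comp_sub, Preadditive.comp_sub, Category.comp_id]

lemma sd_zero : sd R Y 0 = 𝟙 _ := by
  rw [sd, subdivision_zero, Category.comp_id, operation_vertices]

/-- Subdivision of affine simplices agrees with subdivision of tuples. -/
lemma affineMap_sd {m n : ℕ} (σ : C(Simplex m, Y)) :
    (SSet.chainComplexMap (affineMap σ) R).f n ≫ sd R Y n =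
      subdivision R (fun n => bary n) n ≫ (SSet.chainComplexMap (affineMap σ) R).f n := by
  apply tuples_hom_ext
  intro v
  rw [← Category.assoc, ιTuple_affineMap, sd, ι_operation, ← tuplesMap_affineMap]
  rw [chainComplexMap_comp, HomologicalComplex.comp_f, Category.assoc,
    ← Category.assoc (subdivision _ _ _),
    subdivision_map R _ _ _ (affine_bary v), Category.assoc, ← Category.assoc, ιTuple_map]
  congr 2
  ext i : 1
  exact affine_vertex _ _

end Singular

/-! ### Small simplices -/

section Small

variable {Y : TopCat.{0}}

lemma operation_mem_supported {n k : ℕ} (z : R ⟶ ((tuples (Simplex n)).chainComplex R).X k)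
    {P : Set ((TopCat.toSSet.obj Y) _⦋n⦌)} {P' : Set ((TopCat.toSSet.obj Y) _⦋k⦌)}
    (h : ∀ σ : C(Simplex n, Y), sing σ ∈ P → ∀ v : Fin (k + 1) → Simplex n,
      sing (σ.comp (affine v)) ∈ P')
    {c : ((TopCat.toSSet.obj Y).chainComplex R).X n} (hc : c ∈ supported R P) :
    operation R Y z c ∈ supported R P' := by
  refine map_mem_of_mem_supported R _ _ (fun x hx r => ?_) hc
  obtain ⟨σ, rfl⟩ := sing_surjective x
  have e : operation R Y z (ιSing R σ r) = (SSet.chainComplexMap (affineMap σ) R).f k (z r) :=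
    congr($(ι_operation R z σ) r)
  rw [e]
  refine map_mem_supported R (P := Set.univ) _ (fun v _ => h σ hx v) ?_
  rw [supported_univ]
  trivial

lemma sd_d_apply (n m : ℕ) (x : ((TopCat.toSSet.obj Y).chainComplex R).X n) :
    ((TopCat.toSSet.obj Y).chainComplex R).d n m (sd R Y n x) =
      sd R Y m (((TopCat.toSSet.obj Y).chainComplex R).d n m x) := by
  by_cases h : m + 1 = n
  · subst h
    exact congr($(sd_d R Y m) x)
  · rw [((TopCat.toSSet.obj Y).chainComplex R).shape _ _ h]
    exact (map_zero (sd R Y m).hom).symm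

lemma d_sdHomotopy_apply (n : ℕ) (x : ((TopCat.toSSet.obj Y).chainComplex R).X n)
    (hx : ∀ m, ((TopCat.toSSet.obj Y).chainComplex R).d n m x = 0) :
    ((TopCat.toSSet.obj Y).chainComplex R).d (n + 1) n (sdHomotopy R Y n x) = x - sd R Y n x := by
  cases n with
  | zero =>
    have h1 : sdHomotopy R Y 0 = 0 := by
      apply sing_hom_ext
      intro σ
      rw [sdHomotopy, ι_operation, subdivisionHomotopy_zero]
      simp
    rw [h1, sd_zero]
    exact (map_zero (((TopCat.toSSet.obj Y).chainComplex R).d 1 0).hom).trans (sub_self x).symm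
  | succ n =>
    have e : ((TopCat.toSSet.obj Y).chainComplex R).d (n + 2) (n + 1) (sdHomotopy R Y (n + 1) x) =
        x - sd R Y (n + 1) x -
          sdHomotopy R Y n (((TopCat.toSSet.obj Y).chainComplex R).d (n + 1) n x) :=
      congr($(sdHomotopy_d R Y n) x)
    rw [e, hx, map_zero, sub_zero]

lemma iterate_sd_d (k n m : ℕ) (x : ((TopCat.toSSet.obj Y).chainComplex R).X n) :
    ((TopCat.toSSet.obj Y).chainComplex R).d n m ((sd R Y n)^[k] x) =
      (sd R Y m)^[k] (((TopCat.toSSet.obj Y).chainComplex R).d n m x) := by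
  induction k generalizing x with
  | zero => rfl
  | succ k ih => rw [Function.iterate_succ_apply, Function.iterate_succ_apply, ih, sd_d_apply]

lemma iterate_sd_mem (P : ∀ n, Set ((TopCat.toSSet.obj Y) _⦋n⦌))
    (hP : ∀ n k (σ : C(Simplex n, Y)), sing σ ∈ P n → ∀ v : Fin (k + 1) → Simplex n,
      sing (σ.comp (affine v)) ∈ P k) (k n : ℕ)
    {x : ((TopCat.toSSet.obj Y).chainComplex R).X n} (hx : x ∈ supported R (P n)) :
    (sd R Y n)^[k] x ∈ supported R (P n) := by
  induction k generalizing x with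
  | zero => exact hx
  | succ k ih => exact ih (operation_mem_supported R _ (hP n n) hx)

/-- A cycle is homologous to its iterated subdivisions. -/
lemma exists_eq_sub_iterate_sd (P : ∀ n, Set ((TopCat.toSSet.obj Y) _⦋n⦌))
    (hP : ∀ n k (σ : C(Simplex n, Y)), sing σ ∈ P n → ∀ v : Fin (k + 1) → Simplex n,
      sing (σ.comp (affine v)) ∈ P k) (k n : ℕ)
    {x : ((TopCat.toSSet.obj Y).chainComplex R).X n} (hx : x ∈ supported R (P n))
    (hx' : ∀ m, ((TopCat.toSSet.obj Y).chainComplex R).d n m x = 0) :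
    ∃ z ∈ supported R (P (n + 1)), ((TopCat.toSSet.obj Y).chainComplex R).d (n + 1) n z =
      x - (sd R Y n)^[k] x := by
  induction k generalizing x with
  | zero => exact ⟨0, zero_mem _, by simp⟩
  | succ k ih =>
    have hx₁ : sd R Y n x ∈ supported R (P n) := operation_mem_supported R _ (hP n n) hx
    obtain ⟨z, hz, h⟩ := ih hx₁
      (fun m => by rw [sd_d_apply, hx', map_zero])
    refine ⟨sdHomotopy R Y n x + z,
      add_mem (operation_mem_supported R _ (hP n (n + 1)) hx) hz, ?_⟩
    rw [map_add, h, d_sdHomotopy_apply R n x hx', Function.iterate_succ_apply]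
    abel

/-- Iterated subdivision of the standard simplex makes simplices arbitrarily small. -/
lemma iterate_subdivision_mem (m : ℕ) (k : ℕ) (r : R) :
    (subdivision R (fun n => bary (m := m) n) m)^[k] (ιTuple R (vertices m) r) ∈
      supported R (Set.ofPred fun w : Fin (m + 1) → Simplex m =>
        ∀ i j, dist (w i) (w j) ≤ ((m : ℝ) / (m + 1)) ^ k *
          Metric.diam (Set.univ : Set (Simplex m))) := by
  induction k with
  | zero =>
    refine ι_mem_supported R (S := tuples (Simplex m)) (n := m) (x := vertices m) ?_ r
    refine fun i j => ?_
    rw [pow_zero, one_mul]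
    exact Metric.dist_le_diam_of_mem isCompact_univ.isBounded trivial trivial
  | succ k ih =>
    rw [Function.iterate_succ_apply']
    refine map_mem_of_mem_supported R (subdivision R (fun n => bary n) m) _ (fun w hw r => ?_) ih
    refine supported_mono R (fun w' hw' i j => ?_) (subdivision_mem R m le_rfl w _ hw r)
    refine (hw'.2 i j).trans (le_of_eq ?_)
    rw [pow_succ]
    ring

lemma iterate_sd_ι {m : ℕ} (σ : C(Simplex m, Y)) (k : ℕ) (r : R) :
    (sd R Y m)^[k] (ιSing R σ r) = (SSet.chainComplexMap (affineMap σ) R).f m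
      ((subdivision R (fun n => bary (m := m) n) m)^[k] (ιTuple R (vertices m) r)) := by
  induction k with
  | zero =>
    have := congr($(ιTuple_affineMap R Y σ (vertices m)) r)
    rw [affine_vertices'] at this
    exact this.symm
  | succ k ih =>
    rw [Function.iterate_succ_apply', ih, Function.iterate_succ_apply']
    exact congr($(affineMap_sd R Y σ) _)

/-- Subdividing a simplex sufficiently often makes it small for an open covering by two sets. -/
lemma exists_iterate_sd_ι_mem {U V : Set Y} (hU : IsOpen U) (hV : IsOpen V)
    (hUV : U ∪ V = Set.univ) {n : ℕ} (P : Set ((TopCat.toSSet.obj Y) _⦋n⦌))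
    (hP : ∀ σ : C(Simplex n, Y), (Set.range σ ⊆ U ∨ Set.range σ ⊆ V) → sing σ ∈ P)
    (σ : C(Simplex n, Y)) (r : R) : ∃ k, (sd R Y n)^[k] (ιSing R σ r) ∈ supported R P := by
  obtain ⟨δ, hδ, h⟩ := lebesgue_number_lemma_of_metric (s := (Set.univ : Set (Simplex n)))
    (c := fun b : Bool => σ ⁻¹' (cond b U V)) isCompact_univ
    (by rintro (_ | _); exacts [hV.preimage σ.continuous, hU.preimage σ.continuous])
    (fun x _ => by
      rcases (hUV ▸ Set.mem_univ (σ x) : σ x ∈ U ∪ V) with hx | hx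
      · exact Set.mem_iUnion.2 ⟨true, hx⟩
      · exact Set.mem_iUnion.2 ⟨false, hx⟩)
  obtain ⟨k, hk⟩ : ∃ k : ℕ, ((n : ℝ) / (n + 1)) ^ k *
      Metric.diam (Set.univ : Set (Simplex n)) < δ := by
    have := (tendsto_pow_atTop_nhds_zero_of_lt_one (r := (n : ℝ) / (n + 1)) (by positivity)
      (by rw [div_lt_one (by positivity)]; linarith)).mul_const
        (Metric.diam (Set.univ : Set (Simplex n)))
    rw [zero_mul] at this
    exact (this.eventually (gt_mem_nhds hδ)).exists
  refine ⟨k, ?_⟩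
  rw [iterate_sd_ι]
  refine map_mem_supported R _ (fun w hw => hP _ ?_) (iterate_subdivision_mem R n k r)
  obtain ⟨b, hb⟩ := h (w 0) trivial
  have : Set.range (σ.comp (affine w)) ⊆ cond b U V := by
    rintro _ ⟨t, rfl⟩
    exact hb (Metric.mem_ball.2 ((dist_affine_le w t _ _ (fun i => hw i 0)).trans_lt hk))
  cases b
  · exact Or.inr this
  · exact Or.inl this

/-- The simplices that are small for an open covering by two sets compute singular homology. -/
theorem homologyIso_small {U V : Set Y} (hU : IsOpen U) (hV : IsOpen V)
    (hUV : U ∪ V = Set.univ) (S : (TopCat.toSSet.obj Y).Subcomplex)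
    (hS : ∀ (n : ℕ) (σ : C(Simplex n, Y)),
      sing σ ∈ S.obj (op ⦋n⦌) ↔ (Set.range σ ⊆ U ∨ Set.range σ ⊆ V)) :
    homologyIso R S.ι := by
  have hS' (n k : ℕ) (σ : C(Simplex n, Y)) (hσ : sing σ ∈ S.obj (op ⦋n⦌))
      (v : Fin (k + 1) → Simplex n) : sing (σ.comp (affine v)) ∈ S.obj (op ⦋k⦌) := by
    rw [hS] at hσ ⊢
    have : Set.range (σ.comp (affine v)) ⊆ Set.range σ := by
      rintro _ ⟨t, rfl⟩
      exact ⟨_, rfl⟩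
    exact hσ.imp this.trans this.trans
  have hr (n : ℕ) : Set.range (S.ι.app (op ⦋n⦌)) = S.obj (op ⦋n⦌) := by
    ext x
    exact ⟨by rintro ⟨y, rfl⟩; exact y.2, fun hx => ⟨⟨x, hx⟩, rfl⟩⟩
  have hι (n : ℕ) (x : ((S : SSet).chainComplex R).X n) :
      (SSet.chainComplexMap S.ι R).f n x ∈ supported R (S.obj (op ⦋n⦌)) := by
    refine map_mem_supported R (P := Set.univ) S.ι (fun x _ => x.2) ?_
    rw [supported_univ]
    trivial
  have hsmall (n : ℕ) (c : ((TopCat.toSSet.obj Y).chainComplex R).X n) :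
      ∃ k, (sd R Y n)^[k] c ∈ supported R (S.obj (op ⦋n⦌)) := by
    have hadd (k : ℕ) (x y) : (sd R Y n)^[k] (x + y) = (sd R Y n)^[k] x + (sd R Y n)^[k] y :=
      Function.Semiconj₂.iterate (f := sd R Y n) (fun x y => map_add _ x y) k x y
    induction c using chains_induction with
    | hs x r =>
      obtain ⟨σ, rfl⟩ := sing_surjective x
      exact exists_iterate_sd_ι_mem R hU hV hUV _ (fun σ hσ => (hS n σ).2 hσ) σ r
    | h0 => exact ⟨0, zero_mem _⟩
    | hadd x y hx hy =>
      obtain ⟨k, hk⟩ := hx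
      obtain ⟨l, hl⟩ := hy
      refine ⟨l + k, ?_⟩
      rw [hadd]
      refine add_mem ?_ ?_
      · rw [Function.iterate_add_apply]
        exact iterate_sd_mem R (fun n => S.obj (op ⦋n⦌)) hS' _ _ hk
      · rw [add_comm, Function.iterate_add_apply]
        exact iterate_sd_mem R (fun n => S.obj (op ⦋n⦌)) hS' _ _ hl
  apply homologyIso_of_elements
  · intro n x hx y hy
    obtain ⟨k, hk⟩ := hsmall (n + 1) y
    obtain ⟨z, hz, h⟩ := exists_eq_sub_iterate_sd R (fun n => S.obj (op ⦋n⦌)) hS' k n (hι n x)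
      (fun m => by rw [d_chainComplexMap, hx, map_zero])
    obtain ⟨x', hx'⟩ := exists_of_mem_supported_range R S.ι (by rw [hr]; exact add_mem hk hz)
    refine ⟨x', chainComplexMap_injective R S.ι n ?_⟩
    rw [← d_chainComplexMap, hx', map_add, h, iterate_sd_d, ← hy]
    abel
  · intro n y hy
    obtain ⟨k, hk⟩ := hsmall n y
    obtain ⟨z, -, h⟩ := exists_eq_sub_iterate_sd R (fun n => Set.univ)
      (fun _ _ _ _ _ => trivial) k n (by rw [supported_univ]; trivial) hy
    obtain ⟨x, hx⟩ := exists_of_mem_supported_range R S.ι (by rw [hr]; exact hk)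
    refine ⟨x, fun m => chainComplexMap_injective R S.ι m ?_, z, ?_⟩
    · rw [← d_chainComplexMap, hx, map_zero, iterate_sd_d, hy]
      exact Function.iterate_fixed (map_zero (sd R Y m).hom) k
    · rw [h, hx]
      abel

end Small

/-! ### Excision -/

/-- A square of spaces, seen as a map of arrows, is a relative homology isomorphism if it induces
a quasi-isomorphism on relative singular chains. -/
def relSingularIso : MorphismProperty (Arrow TopCat.{0}) :=
  (relHomologyIso R).inverseImage TopCat.toSSet.mapArrow

instance : (relSingularIso R).HasTwoOutOfThreeProperty := by
  rw [relSingularIso]; infer_instance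

/-- A square of simplicial sets is a pushout if it is so in each degree. -/
lemma isPushout_of_app {X₁ X₂ X₃ X₄ : SSet.{0}} {t : X₁ ⟶ X₂} {l : X₁ ⟶ X₃} {r : X₂ ⟶ X₄}
    {b : X₃ ⟶ X₄} (w : t ≫ r = l ≫ b)
    (h : ∀ n, IsPushout (t.app n) (l.app n) (r.app n) (b.app n)) : IsPushout t l r b where
  w := w
  isColimit' := ⟨evaluationJointlyReflectsColimits _
    (fun n => (PushoutCocone.isColimitMapCoconeEquiv _ _).2 (h n).isColimit)⟩

/-- A continuous map lifts through an embedding if its values do. -/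
lemma exists_lift_of_isEmbedding {A B C : Type} [TopologicalSpace A] [TopologicalSpace B]
    [TopologicalSpace C] {f : A → B} (hf : Topology.IsEmbedding f) (g : C(C, B))
    (h : ∀ x, g x ∈ Set.range f) : ∃ g' : C(C, A), ∀ x, f (g' x) = g x := by
  choose k hk using h
  have hk' : f ∘ k = g := funext hk
  exact ⟨⟨k, hf.continuous_iff.2 (hk' ▸ g.continuous)⟩, hk⟩

lemma toSSet_map_app {A B : TopCat.{0}} (f : A ⟶ B) (n : SimplexCategoryᵒᵖ)
    (σ : C(stdSimplex ℝ (Fin (n.unop.len + 1)), A)) :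
    (TopCat.toSSet.map f).app n ((TopCat.toSSetObjEquiv A n).symm σ) =
      (TopCat.toSSetObjEquiv B n).symm (f.hom.comp σ) := rfl

lemma sing_injective {A : TopCat.{0}} {n : ℕ} : Function.Injective (sing (Y := A) (n := n)) :=
  (TopCat.toSSetObjEquiv A (op ⦋n⦌)).symm.injective

/-- The singular simplices in the image of a subspace. -/
lemma sing_mem_range_iff {A B : TopCat.{0}} {f : A ⟶ B} (hf : Topology.IsEmbedding f) {n : ℕ}
    (σ : C(Simplex n, B)) :
    sing σ ∈ (SSet.Subcomplex.range (TopCat.toSSet.map f)).obj (op ⦋n⦌) ↔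
      Set.range σ ⊆ Set.range f := by
  constructor
  · rintro ⟨y, hy⟩
    obtain ⟨τ, rfl⟩ := sing_surjective y
    have : f.hom.comp τ = σ := sing_injective hy
    rintro _ ⟨t, rfl⟩
    exact ⟨τ t, congr($this t)⟩
  · intro hσ
    obtain ⟨g, hg⟩ := exists_lift_of_isEmbedding hf σ (fun x => hσ (Set.mem_range_self x))
    have : f.hom.comp g = σ := ContinuousMap.ext hg
    exact ⟨sing g, congrArg sing this⟩

lemma mono_toSSet_map {A B : TopCat.{0}} {f : A ⟶ B} (hf : Function.Injective f) :
    Mono (TopCat.toSSet.map f) := by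
  have : Mono f := (TopCat.mono_iff_injective f).2 hf
  infer_instance

/-- Excision for an open covering. -/
theorem relSingularIso_of_isOpenEmbedding {W V U X : TopCat.{0}} (q : W ⟶ V) (p : W ⟶ U)
    (a : U ⟶ X) (b : V ⟶ X) (w : p ≫ a = q ≫ b) (hq : Topology.IsEmbedding q)
    (ha : Topology.IsOpenEmbedding a) (hb : Topology.IsOpenEmbedding b)
    (hab : ∀ x, x ∈ Set.range a ∨ x ∈ Set.range b)
    (h : ∀ v u, b v = a u → v ∈ Set.range q) :
    relSingularIso R (Arrow.homMk (f := Arrow.mk q) (g := Arrow.mk a) p b w) := by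
  have := mono_toSSet_map ha.injective
  have := mono_toSSet_map hb.injective
  have := mono_toSSet_map hq.injective
  let S := SSet.Subcomplex.range (TopCat.toSSet.map a) ⊔ SSet.Subcomplex.range (TopCat.toSSet.map b)
  let a' : TopCat.toSSet.obj U ⟶ S := SSet.Subcomplex.lift (TopCat.toSSet.map a) le_sup_left
  let b' : TopCat.toSSet.obj V ⟶ S := SSet.Subcomplex.lift (TopCat.toSSet.map b) le_sup_right
  have ha' : a' ≫ S.ι = TopCat.toSSet.map a := rfl
  have hb' : b' ≫ S.ι = TopCat.toSSet.map b := rfl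
  have : Mono a' := mono_of_mono_fac ha'
  have : Mono b' := mono_of_mono_fac hb'
  have w' : TopCat.toSSet.map p ≫ a' = TopCat.toSSet.map q ≫ b' := by
    rw [← cancel_mono S.ι, Category.assoc, Category.assoc, ha', hb', ← Functor.map_comp, w,
      Functor.map_comp]
  have sq : IsPushout (TopCat.toSSet.map q) (TopCat.toSSet.map p) b' a' := by
    refine isPushout_of_app w'.symm (fun n => ?_)
    refine Types.isPushout_of_isPullback_of_mono' ?_ ?_ ?_
    · rw [Types.isPullback_iff]
      refine ⟨congr_app w'.symm n, ?_, ?_⟩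
      · rintro x y ⟨hxy, -⟩
        exact (mono_iff_injective _).1 (inferInstance : Mono ((TopCat.toSSet.map q).app n)) hxy
      · intro x y hxy
        obtain ⟨σ, rfl⟩ := (TopCat.toSSetObjEquiv V n).symm.surjective x
        obtain ⟨τ, rfl⟩ := (TopCat.toSSetObjEquiv U n).symm.surjective y
        have e : b.hom.comp σ = a.hom.comp τ :=
          (TopCat.toSSetObjEquiv X n).symm.injective (congrArg Subtype.val hxy)
        obtain ⟨g, hg⟩ := exists_lift_of_isEmbedding hq σ (fun x => h _ _ congr($e x))
        have h1 : (TopCat.toSSet.map q).app n ((TopCat.toSSetObjEquiv W n).symm g) =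
            (TopCat.toSSetObjEquiv V n).symm σ :=
          (toSSet_map_app q n g).trans
            (congrArg _ (ContinuousMap.ext hg : q.hom.comp g = σ))
        refine ⟨_, h1, ?_⟩
        apply (mono_iff_injective _).1 (inferInstance : Mono (a'.app n))
        rw [← hxy, ← h1]
        exact congr($(congr_app w' n) ((TopCat.toSSetObjEquiv W n).symm g))
    · refine Set.eq_univ_of_forall ?_
      rintro ⟨x, ⟨y, hy⟩ | ⟨y, hy⟩⟩
      · exact Or.inr ⟨y, Subtype.ext hy⟩
      · exact Or.inl ⟨y, Subtype.ext hy⟩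
    · intro x y _ _ hxy
      exact (mono_iff_injective _).1 (inferInstance : Mono (a'.app n)) hxy
  have hS : homologyIso R S.ι := by
    refine homologyIso_small R ha.isOpen_range hb.isOpen_range
      (Set.eq_univ_of_forall hab) S (fun n σ => ?_)
    exact or_congr (sing_mem_range_iff ha.isEmbedding σ) (sing_mem_range_iff hb.isEmbedding σ)
  let φ₁ : Arrow.mk (TopCat.toSSet.map q) ⟶ Arrow.mk a' := Arrow.homMk (TopCat.toSSet.map p) b' w'
  let φ₂ : Arrow.mk a' ⟶ Arrow.mk (TopCat.toSSet.map a) := Arrow.homMk (𝟙 _) S.ι (by simp [ha'])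
  have h₁ : relHomologyIso R φ₁ := relHomologyIso_of_isPushout R φ₁ sq
  have : Mono (Arrow.mk a').hom := ‹Mono a'›
  have : Mono (Arrow.mk (TopCat.toSSet.map a)).hom := ‹Mono (TopCat.toSSet.map a)›
  have h₂ : relHomologyIso R φ₂ := relHomologyIso_of_homologyIso R φ₂
    (homologyIso_of_isIso R (𝟙 (TopCat.toSSet.obj U))) hS
  have h₃ := MorphismProperty.comp_mem _ _ _ h₁ h₂
  have e : φ₁ ≫ φ₂ = TopCat.toSSet.mapArrow.map
      (Arrow.homMk (f := Arrow.mk q) (g := Arrow.mk a) p b w) := by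
    ext1
    · exact Category.comp_id _
    · exact hb'
  rw [e] at h₃
  exact h₃

/-! ### Collared inclusions -/

/-- A collar of a subspace `S` of `D`: `S` is a closed subspace which is the zero set of a
function `ρ` on `D`, and a strong deformation retract of the neighbourhood `ρ < 1 / 2`. -/
structure Collar {S D : TopCat.{0}} (l : S ⟶ D) where
  /-- `S` is a closed subspace of `D`. -/
  isClosedEmbedding : Topology.IsClosedEmbedding l
  /-- a function that vanishes exactly on `S` -/
  ρ : C(D, ℝ)
  ρ_eq_zero : ∀ s, ρ (l s) = 0
  mem_range : ∀ u, ρ u = 0 → u ∈ Set.range l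
  ρ_nonneg : ∀ u, 0 ≤ ρ u
  /-- the deformation -/
  φ : C(unitInterval × D, D)
  φ_zero : ∀ u, φ (0, u) = u
  φ_apply : ∀ t s, φ (t, l s) = l s
  ρ_φ_le : ∀ t u, ρ (φ (t, u)) ≤ ρ u
  φ_one_mem : ∀ u, ρ u < 1 / 2 → φ (1, u) ∈ Set.range l

section Pushout

variable {S D A Y : TopCat.{0}} {l : S ⟶ D} {t : S ⟶ A} {b : D ⟶ Y} {r : A ⟶ Y}

lemma isOpen_iff_of_isPushout (sq : IsPushout l t b r) (O : Set Y) :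
    IsOpen O ↔ IsOpen (b ⁻¹' O) ∧ IsOpen (r ⁻¹' O) := by
  refine (TopCat.isOpen_iff_of_isColimit _ sq.isColimit O).trans ?_
  constructor
  · intro h
    exact ⟨h WalkingSpan.left, h WalkingSpan.right⟩
  · rintro ⟨h₁, h₂⟩ (_ | _ | _)
    · have e : sq.cocone.ι.app WalkingSpan.zero = l ≫ b := PushoutCocone.condition_zero _
      change IsOpen (sq.cocone.ι.app WalkingSpan.zero ⁻¹' O)
      rw [e]
      exact h₁.preimage l.hom.continuous
    · exact h₁
    · exact h₂

lemma isClosed_iff_of_isPushout (sq : IsPushout l t b r) (O : Set Y) :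
    IsClosed O ↔ IsClosed (b ⁻¹' O) ∧ IsClosed (r ⁻¹' O) := by
  simp only [← isOpen_compl_iff, isOpen_iff_of_isPushout sq, Set.preimage_compl]

lemma exists_or_of_isPushout (sq : IsPushout l t b r) (y : Y) :
    (∃ u, b u = y) ∨ ∃ a, r a = y :=
  Types.eq_or_eq_of_isPushout (sq.map (forget TopCat)) y

lemma exists_of_isPushout_of_eq (sq : IsPushout l t b r) (hl : Function.Injective l) {u : D} {a : A}
    (h : b u = r a) : ∃ s, l s = u ∧ t s = a :=
  Types.exists_of_isPullback (Types.isPullback_of_isPushout (sq.map (forget TopCat)) hl) u a h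

lemma injective_of_isPushout (sq : IsPushout l t b r) (hl : Function.Injective l) :
    Function.Injective r :=
  Types.pushoutCocone_inr_injective_of_isColimit (sq.map (forget TopCat)).isColimit hl

lemma eq_of_isPushout (sq : IsPushout l t b r) {u u' : D} (hu : u ∉ Set.range l)
    (h : b u = b u') : u = u' := by
  let sq' := sq.map (forget TopCat)
  let χ : D → ULift.{0} Prop := fun d => ⟨d = u⟩
  have w : (forget TopCat).map l ≫ (↾ χ) = (forget TopCat).map t ≫ (↾ fun _ => ⟨False⟩) := by
    ext s
    exact iff_of_false (fun h => hu ⟨s, h⟩) id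
  have key (d : D) : sq'.desc _ _ w ((forget TopCat).map b d) = χ d :=
      congr($(sq'.inl_desc _ _ w) d)
  have h1 := key u
  have h2 := key u'
  have h3 : (forget TopCat).map b u = (forget TopCat).map b u' := h
  rw [h3, h2] at h1
  have h4 : (u' = u) = (u = u) := congrArg ULift.down h1
  exact (h4.symm.mp rfl : u' = u).symm

lemma isClosedEmbedding_of_isPushout (sq : IsPushout l t b r) (hl : Topology.IsClosedEmbedding l) :
    Topology.IsClosedEmbedding r := by
  have hr := injective_of_isPushout sq hl.injective
  refine .of_continuous_injective_isClosedMap r.hom.continuous hr (fun C hC => ?_)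
  rw [isClosed_iff_of_isPushout sq, Set.preimage_image_eq _ hr]
  refine ⟨?_, hC⟩
  have : b ⁻¹' (r '' C) = l '' (t ⁻¹' C) := by
    ext u
    constructor
    · rintro ⟨a, ha, h⟩
      obtain ⟨s, rfl, rfl⟩ := exists_of_isPushout_of_eq sq hl.injective h.symm
      exact ⟨s, ha, rfl⟩
    · rintro ⟨s, hs, rfl⟩
      exact ⟨t s, hs, congr($(sq.w) s).symm⟩
  rw [this]
  exact hl.isClosedMap _ (hC.preimage t.hom.continuous)

/-- The complement of `S` is an open subspace of the pushout. -/
lemma isOpen_image_of_isPushout (sq : IsPushout l t b r) {O : Set D} (hl : Function.Injective l)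
    (hO : IsOpen O) (h : ∀ u ∈ O, u ∉ Set.range l) : IsOpen (b '' O) := by
  rw [isOpen_iff_of_isPushout sq]
  constructor
  · convert hO
    ext u
    constructor
    · rintro ⟨u', hu', e⟩
      rwa [← eq_of_isPushout sq (h u' hu') e]
    · exact fun hu => ⟨u, hu, rfl⟩
  · convert isOpen_empty
    rw [Set.eq_empty_iff_forall_notMem]
    rintro a ⟨u, hu, e⟩
    obtain ⟨s, rfl, -⟩ := exists_of_isPushout_of_eq sq hl e
    exact h _ hu ⟨s, rfl⟩

/-- Collars are stable under pushouts. -/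
theorem Collar.exists_of_isPushout (c : Collar l) (sq : IsPushout l t b r) :
    ∃ c' : Collar r, ∀ u, c'.ρ (b u) = c.ρ u := by
  have wρ : l ≫ TopCat.ofHom (Y := TopCat.of ℝ) c.ρ =
      t ≫ TopCat.ofHom (ContinuousMap.const A 0) := by
    ext s
    exact c.ρ_eq_zero s
  let ρ : C(Y, ℝ) := (sq.desc _ _ wρ).hom
  have hρb (u : D) : ρ (b u) = c.ρ u := congr($(sq.inl_desc _ _ wρ) u)
  have hρr (a : A) : ρ (r a) = 0 := congr($(sq.inr_desc _ _ wρ) a)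
  -- the deformation is glued as a map to a space of paths, which avoids a pushout with the interval
  let f : C(D, C(unitInterval, Y)) :=
    ContinuousMap.curry ((b.hom.comp c.φ).comp ContinuousMap.prodSwap)
  let g : C(A, C(unitInterval, Y)) :=
    ContinuousMap.curry (r.hom.comp (ContinuousMap.fst : C(A × unitInterval, A)))
  have wφ : l ≫ TopCat.ofHom (Y := TopCat.of C(unitInterval, Y)) f = t ≫ TopCat.ofHom g := by
    refine TopCat.hom_ext (ContinuousMap.ext (fun s => ?_))
    change f (l s) = g (t s)
    refine ContinuousMap.ext (fun x => ?_)
    change b (c.φ (x, l s)) = r (t s)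
    rw [c.φ_apply]
    exact congr($(sq.w) s)
  let F : C(Y, C(unitInterval, Y)) := (sq.desc _ _ wφ).hom
  let φ : C(unitInterval × Y, Y) := F.uncurry.comp ContinuousMap.prodSwap
  have hφb (x : unitInterval) (u : D) : φ (x, b u) = b (c.φ (x, u)) :=
    congr(($(congr($(sq.inl_desc _ _ wφ) u)) : C(unitInterval, Y)) x)
  have hφr (x : unitInterval) (a : A) : φ (x, r a) = r a :=
    congr(($(congr($(sq.inr_desc _ _ wφ) a)) : C(unitInterval, Y)) x)
  have hb : ∀ s, b (l s) = r (t s) := fun s => congr($(sq.w) s)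
  refine ⟨{ isClosedEmbedding := isClosedEmbedding_of_isPushout sq c.isClosedEmbedding
            ρ := ρ
            ρ_eq_zero := hρr
            mem_range := fun y hy => ?_
            ρ_nonneg := fun y => ?_
            φ := φ
            φ_zero := fun y => ?_
            φ_apply := hφr
            ρ_φ_le := fun x y => ?_
            φ_one_mem := fun y hy => ?_ }, hρb⟩
  all_goals obtain ⟨u, rfl⟩ | ⟨a, rfl⟩ := exists_or_of_isPushout sq y
  · rw [hρb] at hy
    obtain ⟨s, rfl⟩ := c.mem_range u hy
    exact ⟨t s, (hb s).symm⟩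
  · exact ⟨a, rfl⟩
  · rw [hρb]; exact c.ρ_nonneg u
  · rw [hρr]
  · rw [hφb, c.φ_zero]
  · rw [hφr]
  · rw [hφb, hρb, hρb]; exact c.ρ_φ_le x u
  · rw [hφr]
  · rw [hρb] at hy
    obtain ⟨s, hs⟩ := c.φ_one_mem u hy
    exact ⟨t s, by rw [hφb, ← hs, hb]⟩
  · exact ⟨a, (hφr 1 a).symm⟩

end Pushout

namespace Collar

variable {S D A Y : TopCat.{0}} {l : S ⟶ D} {t : S ⟶ A} {b : D ⟶ Y} {r : A ⟶ Y}

/-- The open neighbourhood of the subspace that deforms into it. -/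
def nbhd (c : Collar l) : TopCat.{0} := TopCat.of {u : D // c.ρ u < 1 / 2}

/-- The inclusion of the neighbourhood. -/
def nbhdι (c : Collar l) : c.nbhd ⟶ D := TopCat.ofHom ⟨Subtype.val, continuous_subtype_val⟩

/-- The inclusion of the subspace into its neighbourhood. -/
def toNbhd (c : Collar l) : S ⟶ c.nbhd :=
  TopCat.ofHom ⟨fun s => ⟨l s, by rw [c.ρ_eq_zero]; norm_num⟩, by fun_prop⟩

lemma isOpenEmbedding_nbhdι (c : Collar l) : Topology.IsOpenEmbedding c.nbhdι :=
  (isOpen_lt c.ρ.continuous continuous_const).isOpenEmbedding_subtypeVal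

lemma homologyIso_toNbhd (c : Collar l) : homologyIso R (TopCat.toSSet.map c.toNbhd) := by
  obtain ⟨g, hg⟩ := exists_lift_of_isEmbedding c.isClosedEmbedding.isEmbedding
    (C := c.nbhd) ⟨fun u => c.φ (1, u.1),
      c.φ.continuous.comp (Continuous.prodMk continuous_const continuous_subtype_val)⟩
    (fun u => c.φ_one_mem u.1 u.2)
  have hg' (u : c.nbhd) : l (g u) = c.φ (1, u.1) := hg u
  have e : c.toNbhd ≫ TopCat.ofHom g = 𝟙 _ := by
    ext s
    apply c.isClosedEmbedding.injective
    exact (hg' _).trans (c.φ_apply _ _)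
  refine homologyIso_toSSet_of_homotopy R _ (TopCat.ofHom g) ?_ ?_
  · rw [e]
    exact ContinuousMap.Homotopy.refl _
  · refine ContinuousMap.Homotopy.symm
      { toFun := fun x => ⟨c.φ (x.1, x.2.1), (c.ρ_φ_le _ _).trans_lt x.2.2⟩
        continuous_toFun := Continuous.subtype_mk (c.φ.continuous.comp (continuous_fst.prodMk
          (continuous_subtype_val.comp continuous_snd))) _
        map_zero_left := fun u => Subtype.ext (c.φ_zero _)
        map_one_left := fun u => Subtype.ext (hg' u).symm }

/-- Replacing the subspace by its neighbourhood does not change relative homology. -/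
lemma relSingularIso_nbhd (c : Collar l) :
    relSingularIso R
      (Arrow.homMk (f := Arrow.mk l) (g := Arrow.mk c.nbhdι) c.toNbhd (𝟙 D) rfl) := by
  have : Mono (TopCat.toSSet.mapArrow.obj (Arrow.mk l)).hom :=
    mono_toSSet_map c.isClosedEmbedding.injective
  have : Mono (TopCat.toSSet.mapArrow.obj (Arrow.mk c.nbhdι)).hom :=
    mono_toSSet_map c.isOpenEmbedding_nbhdι.injective
  refine relHomologyIso_of_homologyIso R _ (c.homologyIso_toNbhd R) ?_
  change homologyIso R (TopCat.toSSet.map (𝟙 D))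
  rw [TopCat.toSSet.map_id]
  exact homologyIso_of_isIso R _

/-- A pushout of a collared inclusion induces an isomorphism on relative singular homology. -/
theorem relSingularIso_of_isPushout (c : Collar l) (sq : IsPushout l t b r) :
    relSingularIso R (Arrow.homMk (f := Arrow.mk l) (g := Arrow.mk r) t b sq.w.symm) := by
  obtain ⟨c', hc'⟩ := c.exists_of_isPushout sq
  let V : TopCat.{0} := TopCat.of {u : D // 0 < c.ρ u}
  let W : TopCat.{0} := TopCat.of {u : V // c.ρ u.1 < 1 / 2}
  let q : W ⟶ V := TopCat.ofHom ⟨Subtype.val, continuous_subtype_val⟩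
  let p : W ⟶ c.nbhd := TopCat.ofHom ⟨fun u => ⟨u.1.1, u.2⟩, Continuous.subtype_mk
    (continuous_subtype_val.comp continuous_subtype_val) _⟩
  let j : V ⟶ D := TopCat.ofHom ⟨Subtype.val, continuous_subtype_val⟩
  let b' : c.nbhd ⟶ c'.nbhd := TopCat.ofHom ⟨fun u => ⟨b u.1, by rw [hc']; exact u.2⟩, by fun_prop⟩
  have hj : Topology.IsOpenEmbedding j :=
    (isOpen_lt continuous_const c.ρ.continuous).isOpenEmbedding_subtypeVal
  have hVl (u : D) (hu : 0 < c.ρ u) : u ∉ Set.range l := by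
    rintro ⟨s, rfl⟩
    rw [c.ρ_eq_zero] at hu
    exact lt_irrefl _ hu
  have hjb : Topology.IsOpenEmbedding (j ≫ b) := by
    refine .of_continuous_injective_isOpenMap (j ≫ b).hom.continuous ?_ ?_
    · intro v v' h
      exact Subtype.ext (eq_of_isPushout sq (hVl v.1 v.2) h)
    · intro O hO
      have e : (j ≫ b) '' O = b '' (j '' O) := by
        rw [Set.image_image]
        rfl
      rw [e]
      refine isOpen_image_of_isPushout sq c.isClosedEmbedding.injective (hj.isOpenMap _ hO) ?_
      rintro _ ⟨v, -, rfl⟩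
      exact hVl v.1 v.2
  -- excision of the subspace from its neighbourhood, first in `D` and then in the pushout `Y`: the
  -- pairs that remain are the same
  have h₁ := relSingularIso_of_isOpenEmbedding R q p c.nbhdι j rfl Topology.IsEmbedding.subtypeVal
    c.isOpenEmbedding_nbhdι hj (fun u => by
      by_cases hu : c.ρ u < 1 / 2
      · exact Or.inl ⟨⟨u, hu⟩, rfl⟩
      · exact Or.inr ⟨⟨u, by linarith⟩, rfl⟩)
    (fun v u e => ⟨⟨v, by
      have e' : v.1 = u.1 := e
      rw [e']; exact u.2⟩, rfl⟩)
  have h₂ := relSingularIso_of_isOpenEmbedding R q (p ≫ b') c'.nbhdι (j ≫ b) rfl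
    Topology.IsEmbedding.subtypeVal
    c'.isOpenEmbedding_nbhdι hjb (fun y => by
      by_cases hy : c'.ρ y < 1 / 2
      · exact Or.inl ⟨⟨y, hy⟩, rfl⟩
      · obtain ⟨u, rfl⟩ | ⟨a, rfl⟩ := exists_or_of_isPushout sq y
        · rw [hc'] at hy
          exact Or.inr ⟨⟨u, by linarith⟩, rfl⟩
        · rw [c'.ρ_eq_zero] at hy
          norm_num at hy)
    (fun v y e => ⟨⟨v, by
      have e' : b v.1 = y.1 := e
      rw [← hc', e']; exact y.2⟩, rfl⟩)
  have h₃ : relSingularIso R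
      (Arrow.homMk (f := Arrow.mk c.nbhdι) (g := Arrow.mk c'.nbhdι) b' b rfl) := by
    refine MorphismProperty.of_precomp _ _ _ h₁ ?_
    exact h₂
  refine MorphismProperty.of_postcomp _ _ _ (c'.relSingularIso_nbhd R) ?_
  have h₄ := MorphismProperty.comp_mem _ _ _ (c.relSingularIso_nbhd R) h₃
  convert h₄ using 1
  ext s
  · exact Subtype.ext congr($(sq.w) s).symm
  · rfl

end Collar

/-! ### Induction on the cells of a simplicial set -/

open SSet.relativeCellComplexOfMono in
/-- The attachment of the nondegenerate `d`-simplices of `X`, as a morphism from the inclusion of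
their boundaries to the inclusion of skeleta. -/
def attach (X : SSet.{0}) (d : ℕ) : Arrow.mk (l (⊥ : X.Subcomplex).ι d) ⟶
    Arrow.mk (r (⊥ : X.Subcomplex).ι d) :=
  Arrow.homMk (t _ d) (b _ d) (w _ d)

lemma isPushout_attach (X : SSet.{0}) (d : ℕ) :
    IsPushout (Arrow.mk (SSet.relativeCellComplexOfMono.l (⊥ : X.Subcomplex).ι d)).hom
      (attach X d).left (attach X d).right
      (Arrow.mk (SSet.relativeCellComplexOfMono.r (⊥ : X.Subcomplex).ι d)).hom :=
  (SSet.relativeCellComplexOfMono.isPushout _ d).flip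

/-- The subcomplex of `X` generated by the simplices of dimension less than `d`. -/
abbrev sk (X : SSet.{0}) : ℕ →o X.Subcomplex := SSet.skeletonOfMono (⊥ : X.Subcomplex).ι

instance (X : SSet.{0}) (d : ℕ) : SSet.HasDimensionLT (sk X d) d where
  degenerate_eq_top n hn := by
    by_contra h
    rw [Set.top_eq_univ, Set.eq_univ_iff_forall, not_forall] at h
    obtain ⟨x, hx⟩ := h
    replace hx := ((sk X d).mem_nonDegenerate_iff x).1 hx
    obtain ⟨y, hy⟩ | h := (SSet.mem_skeletonOfMono_obj_iff_of_nonDegenerate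
      (⊥ : X.Subcomplex).ι ⟨_, hx⟩ d).1 x.2
    · exact y.2
    · exact absurd hn (not_le.2 h)

lemma sk_eq_top (X : SSet.{0}) (d : ℕ) [X.HasDimensionLT d] : sk X d = ⊤ := by
  rw [SSet.Subcomplex.eq_top_iff_of_hasDimensionLT _ d]
  intro i hi
  rw [SSet.skeletonOfMono_obj_eq_top _ hi]
  exact Set.subset_univ _

lemma isIso_sk_ι (X : SSet.{0}) (d : ℕ) [X.HasDimensionLT d] : IsIso (sk X d).ι := by
  rw [sk_eq_top]
  exact (SSet.Subcomplex.topIso X).isIso_hom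

lemma hasDimensionLT_sigma (I : Type) (F : I → SSet.{0}) (d : ℕ) [∀ i, (F i).HasDimensionLT d] :
    (∐ F).HasDimensionLT d :=
  SSet.hasDimensionLT_of_isColimit (coproductIsCoproduct F) (fun i => inferInstanceAs
    ((F i.as).HasDimensionLT d))

/-- A natural transformation of functors of simplicial sets that are compatible with attaching
cells and with the filtration by skeleta is a homology isomorphism as soon as it is so on the
coproducts of copies of a standard simplex. -/
theorem homologyIso_app_of_cells {F G : SSet.{0} ⥤ SSet.{0}} (τ : F ⟶ G)
    [F.PreservesMonomorphisms] [G.PreservesMonomorphisms]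
    (base : ∀ (I : Type) (n : ℕ), homologyIso R (τ.app (∐ fun _ : I => Δ[n])))
    (hF : ∀ X d, relHomologyIso R (F.mapArrow.map (attach X d)))
    (hG : ∀ X d, relHomologyIso R (G.mapArrow.map (attach X d)))
    (eF : ∀ (X : SSet.{0}) (n) (x : (F.obj X) _⦋n⦌), ∃ d y, (F.map (sk X d).ι).app _ y = x)
    (eG : ∀ (X : SSet.{0}) (n) (x : (G.obj X) _⦋n⦌), ∃ d y, (G.map (sk X d).ι).app _ y = x)
    (X : SSet.{0}) : homologyIso R (τ.app X) := by
  have ht {X Y : SSet.{0}} (f : X ⟶ Y) [IsIso f] (h : homologyIso R (τ.app X)) :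
      homologyIso R (τ.app Y) := by
    rw [← MorphismProperty.cancel_left_of_respectsIso (homologyIso R) (F.map f), τ.naturality]
    exact (homologyIso R).comp_mem _ _ h (homologyIso_of_isIso R _)
  -- induction on the dimension; the boundaries of the cells and the skeleton have smaller dimension
  have key (d : ℕ) : ∀ (X : SSet.{0}) [X.HasDimensionLT d], homologyIso R (τ.app X) := by
    induction d with
    | zero =>
      intro X hX
      have := @hasDimensionLT_sigma PEmpty (fun _ => Δ[0]) 0 (fun i => i.elim)
      let e := (SSet.isInitialOfNotNonempty
        ((SSet.notNonempty_iff_hasDimensionLT_zero _).2 this)).uniqueUpToIso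
          (SSet.isInitialOfNotNonempty ((SSet.notNonempty_iff_hasDimensionLT_zero _).2 hX))
      exact ht e.hom (base PEmpty 0)
    | succ d hd =>
      intro X hX
      have := isIso_sk_ι X (d + 1)
      refine ht (sk X (d + 1)).ι ?_
      let φ : Arrow.mk (F.map (SSet.relativeCellComplexOfMono.r (⊥ : X.Subcomplex).ι d)) ⟶
        Arrow.mk (G.map (SSet.relativeCellComplexOfMono.r (⊥ : X.Subcomplex).ι d)) :=
        Arrow.homMk (τ.app _) (τ.app _) (τ.naturality _).symm
      let ψ : Arrow.mk (F.map (SSet.relativeCellComplexOfMono.l (⊥ : X.Subcomplex).ι d)) ⟶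
        Arrow.mk (G.map (SSet.relativeCellComplexOfMono.l (⊥ : X.Subcomplex).ι d)) :=
        Arrow.homMk (τ.app _) (τ.app _) (τ.naturality _).symm
      have e : F.mapArrow.map (attach X d) ≫ φ = ψ ≫ G.mapArrow.map (attach X d) :=
        CommaMorphism.ext (τ.naturality _) (τ.naturality _)
      have hψ : relHomologyIso R ψ := by
        have : Mono (Arrow.mk (F.map (SSet.relativeCellComplexOfMono.l
          (⊥ : X.Subcomplex).ι d))).hom := by dsimp; infer_instance
        have : Mono (Arrow.mk (G.map (SSet.relativeCellComplexOfMono.l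
          (⊥ : X.Subcomplex).ι d))).hom := by dsimp; infer_instance
        refine relHomologyIso_of_homologyIso R ψ ?_ (base _ _)
        have := hasDimensionLT_sigma (SSet.relativeCellComplexOfMono.Cell (⊥ : X.Subcomplex).ι d)
          (fun _ => (∂Δ[d] : SSet)) d
        exact hd _
      have hφ : relHomologyIso R φ := by
        refine (relHomologyIso R).of_precomp _ φ (hF X d) ?_
        have := (relHomologyIso R).comp_mem _ _ hψ (hG X d)
        rwa [← e] at this
      have : Mono (Arrow.mk (F.map (SSet.relativeCellComplexOfMono.r
        (⊥ : X.Subcomplex).ι d))).hom := by dsimp; infer_instance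
      have : Mono (Arrow.mk (G.map (SSet.relativeCellComplexOfMono.r
        (⊥ : X.Subcomplex).ι d))).hom := by dsimp; infer_instance
      exact homologyIso_right_of_relHomologyIso R φ (hd _) hφ
  -- a general simplicial set is the union of its skeleta
  let S : ℕ ⥤ SSet.{0} := (sk X).monotone.functor ⋙ SSet.Subcomplex.toSSetFunctor
  have w (i j : ℕ) (h : i ⟶ j) : S.map h ≫ (sk X j).ι = (sk X i).ι := rfl
  let a (d : ℕ) : (S ⋙ F).obj d ⟶ F.obj X := F.map (sk X d).ι
  let b (d : ℕ) : (S ⋙ G).obj d ⟶ G.obj X := G.map (sk X d).ι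
  have (d : ℕ) : Mono (a d) := inferInstanceAs (Mono (F.map (sk X d).ι))
  have (d : ℕ) : Mono (b d) := inferInstanceAs (Mono (G.map (sk X d).ι))
  refine homologyIso_of_sequence R (τ.app X) (S ⋙ F) (S ⋙ G) a b
    (Functor.whiskerLeft S τ) (fun d => τ.naturality _)
    (fun i j h => ?_) (fun i j h => ?_) (eF X) (eG X)
    (fun d => key d (sk X d : SSet))
  · exact (F.map_comp _ _).symm.trans (congrArg F.map (w i j h))
  · exact (G.map_comp _ _).symm.trans (congrArg G.map (w i j h))

/-! ### Products with a simplicial set -/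

/-- The contraction of a standard simplex to its first vertex. -/
def contraction (n : ℕ) : (Δ[n] ⊗ Δ[1] : SSet.{0}) ⟶ Δ[n] where
  app m := ↾ fun yz => SSet.stdSimplex.objMk
    { toFun := fun i => if SSet.stdSimplex.asOrderHom yz.2 i = 0 then 0 else
        SSet.stdSimplex.asOrderHom yz.1 i
      monotone' := fun i j hij => by
        have h₁ := (SSet.stdSimplex.asOrderHom yz.1).monotone hij
        have h₂ := (SSet.stdSimplex.asOrderHom yz.2).monotone hij
        dsimp only
        split_ifs with h h' h'
        · exact le_rfl
        · exact Fin.zero_le _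
        · exact absurd (le_antisymm (h₂.trans h'.le) (Fin.zero_le _)) h
        · exact h₁ }
  naturality _ _ _ := rfl

lemma contraction_app (n : ℕ) (m : SimplexCategoryᵒᵖ) (y : (Δ[n] : SSet.{0}).obj m)
    (z : (Δ[1] : SSet.{0}).obj m) (i : Fin (m.unop.len + 1)) :
    SSet.stdSimplex.asOrderHom ((contraction n).app m (y, z)) i =
      if SSet.stdSimplex.asOrderHom z i = 0 then 0 else SSet.stdSimplex.asOrderHom y i := rfl

lemma stdSimplex_ext {n : ℕ} {m : SimplexCategoryᵒᵖ} {y z : (Δ[n] : SSet.{0}).obj m}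
    (h : ∀ i, SSet.stdSimplex.asOrderHom y i = SSet.stdSimplex.asOrderHom z i) : y = z :=
  SSet.stdSimplex.objEquiv.injective (SimplexCategory.Hom.ext _ _ (OrderHom.ext _ _ (funext h)))

lemma ι₀_contraction (n : ℕ) :
    SSet.ι₀ ≫ contraction n = SSet.const (SSet.stdSimplex.obj₀Equiv.symm 0) :=
  NatTrans.ext (funext fun m => ConcreteCategory.hom_ext _ _ fun y =>
    stdSimplex_ext fun i => (contraction_app n m y _ i).trans (if_pos rfl))

lemma ι₁_contraction (n : ℕ) : SSet.ι₁ ≫ contraction n = 𝟙 _ :=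
  NatTrans.ext (funext fun m => ConcreteCategory.hom_ext _ _ fun y =>
    stdSimplex_ext fun i => (contraction_app n m y _ i).trans
      (if_neg (t := (0 : Fin (n + 1))) (one_ne_zero : (1 : Fin 2) ≠ 0)))

lemma bot_hom_ext {Y Z : SSet.{0}} (f g : (⊥ : Y.Subcomplex).toSSet ⊗ Δ[1] ⟶ Z) : f = g :=
  NatTrans.ext (funext fun _ => ConcreteCategory.hom_ext _ _ fun ⟨⟨_, h⟩, _⟩ => h.elim)

lemma homologyIso_fst (X : SSet.{0}) (n : ℕ) :
    homologyIso R (CartesianMonoidalCategory.fst X Δ[n]) := by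
  refine homologyIso_of_homotopy R _ (CartesianMonoidalCategory.lift (𝟙 X)
    (SSet.const (SSet.stdSimplex.obj₀Equiv.symm 0)))
    { h := CartesianMonoidalCategory.lift
        (CartesianMonoidalCategory.fst _ _ ≫ CartesianMonoidalCategory.fst _ _)
        (CartesianMonoidalCategory.snd _ _ ▷ Δ[1] ≫ contraction n)
      h₀ := ?_
      h₁ := ?_
      rel := bot_hom_ext _ _ }
    { h := CartesianMonoidalCategory.fst _ _, h₀ := rfl, h₁ := rfl, rel := bot_hom_ext _ _ }
  · apply CartesianMonoidalCategory.hom_ext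
    · rfl
    · exact congrArg (CartesianMonoidalCategory.snd X Δ[n] ≫ ·) (ι₀_contraction n)
  · apply CartesianMonoidalCategory.hom_ext
    · rfl
    · exact congrArg (CartesianMonoidalCategory.snd X Δ[n] ≫ ·) (ι₁_contraction n)

/-- The functor `X ⊗ -` commutes with the attachment of cells. -/
lemma relHomologyIso_tensorLeft_attach (X Y : SSet.{0}) (d : ℕ) :
    relHomologyIso R ((tensorLeft X).mapArrow.map (attach Y d)) :=
  relHomologyIso_of_isPushout R _ ((isPushout_attach Y d).map (tensorLeft X))

instance (X : SSet.{0}) : (tensorLeft X).PreservesMonomorphisms where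
  preserves {Y Z} f hf := by
    have (n : SimplexCategoryᵒᵖ) : Mono (((tensorLeft X).map f).app n) := by
      rw [mono_iff_injective]
      intro a b h
      have h₁ : a.1 = b.1 := congrArg (fun x : X.obj n × Z.obj n => x.1) h
      have h₂ : f.app n a.2 = f.app n b.2 := congrArg (fun x : X.obj n × Z.obj n => x.2) h
      exact Prod.ext h₁ ((mono_iff_injective (f.app n)).1 inferInstance h₂)
    exact NatTrans.mono_of_mono_app _

lemma exists_sk (X : SSet.{0}) (n : ℕ) (x : X _⦋n⦌) : x ∈ (sk X (n + 1)).obj (op ⦋n⦌) := by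
  rw [SSet.skeletonOfMono_obj_eq_top _ (Nat.lt_succ_self n)]
  trivial

/-- A weak form of the Künneth theorem: the product with a simplicial set preserves homology
isomorphisms. -/
theorem homologyIso_whiskerRight {X Y : SSet.{0}} (f : X ⟶ Y) (hf : homologyIso R f)
    (Z : SSet.{0}) : homologyIso R (f ▷ Z) := by
  refine homologyIso_app_of_cells R (F := tensorLeft X) (G := tensorLeft Y)
    ((tensoringLeft SSet.{0}).map f) (fun I n => ?_)
    (fun _ _ => relHomologyIso_tensorLeft_attach R _ _ _)
    (fun _ _ => relHomologyIso_tensorLeft_attach R _ _ _)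
    (fun Z n x => ⟨n + 1, (x.1, ⟨x.2, exists_sk _ _ _⟩), rfl⟩)
    (fun Z n x => ⟨n + 1, (x.1, ⟨x.2, exists_sk _ _ _⟩), rfl⟩) Z
  refine homologyIso_of_isColimit_cofan R
    (isColimitCofanMkObjOfIsColimit (tensorLeft X) _ _ (coproductIsCoproduct fun _ : I => Δ[n]))
    (isColimitCofanMkObjOfIsColimit (tensorLeft Y) _ _ (coproductIsCoproduct fun _ : I => Δ[n]))
    (fun _ => f ▷ Δ[n]) (fun _ => ?_) _ (fun i => whisker_exchange _ _)
  refine (homologyIso R).of_postcomp _ _ (homologyIso_fst R Y n) ?_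
  have := (homologyIso R).comp_mem _ _ (homologyIso_fst R X n) hf
  exact this

lemma homologyIso_whiskerLeft {X Y : SSet.{0}} (f : X ⟶ Y) (hf : homologyIso R f)
    (Z : SSet.{0}) : homologyIso R (Z ◁ f) := by
  have := homologyIso_whiskerRight R f hf Z
  rwa [← MorphismProperty.cancel_right_of_respectsIso (homologyIso R) _ (β_ Y Z).hom,
    BraidedCategory.braiding_naturality_left,
    MorphismProperty.cancel_left_of_respectsIso (homologyIso R)] at this

/-! ### Points of the geometric realization -/

section Points

variable {X Y : SSet.{0}}

/-- The characteristic map of a simplex. -/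
def point {n : ℕ} (x : X _⦋n⦌) : C(Simplex n, |X|) :=
  TopCat.toSSetObjEquiv _ _ ((sSetTopAdj.unit.app X).app _ x)

lemma sing_point {n : ℕ} (x : X _⦋n⦌) : sing (point x) = (sSetTopAdj.unit.app X).app _ x :=
  Equiv.symm_apply_apply _ _

lemma point_map {n m : ℕ} (f : ⦋n⦌ ⟶ ⦋m⦌) (x : X _⦋m⦌) (p : Simplex n) :
    point (X.map f.op x) p = point x (stdSimplex.map f.toOrderHom p) := by
  have e : sing (point (X.map f.op x)) = sing ((point x).comp
      ⟨stdSimplex.map f.toOrderHom, stdSimplex.continuous_map _⟩) := by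
    rw [← map_sing, sing_point, sing_point]
    exact congr($((sSetTopAdj.unit.app X).naturality f.op) x)
  exact congr($(sing_injective e) p)

lemma toTop_map_point (g : X ⟶ Y) {n : ℕ} (x : X _⦋n⦌) (p : Simplex n) :
    SSet.toTop.map g (point x p) = point (g.app _ x) p := by
  have e : sing ((SSet.toTop.map g).hom.comp (point x)) = sing (point (g.app _ x)) := by
    rw [← toSSet_map_sing, sing_point, sing_point]
    exact congr(($(sSetTopAdj.unit.naturality g)).app _ x).symm
  exact congr($(sing_injective e) p)

lemma homEquiv_symm_point {Z : TopCat.{0}} (h : X ⟶ TopCat.toSSet.obj Z) {n : ℕ} (x : X _⦋n⦌)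
    (σ : C(Simplex n, Z)) (hσ : h.app _ x = sing σ) (p : Simplex n) :
    (sSetTopAdj.homEquiv X Z).symm h (point x p) = σ p := by
  have e : sing (((sSetTopAdj.homEquiv X Z).symm h).hom.comp (point x)) = sing σ := by
    rw [← toSSet_map_sing, sing_point, ← hσ]
    have := congr(($((sSetTopAdj.homEquiv X Z).apply_symm_apply h)).app _ x)
    rwa [Adjunction.homEquiv_unit] at this
  exact congr($(sing_injective e) p)

lemma realization_hom_ext {Z : TopCat.{0}} {f g : |X| ⟶ Z}
    (h : ∀ (n : ℕ) (x : X _⦋n⦌) (p : Simplex n), f (point x p) = g (point x p)) : f = g := by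
  apply (sSetTopAdj.homEquiv X Z).injective
  ext ⟨⟨n⟩⟩ x
  rw [Adjunction.homEquiv_unit, Adjunction.homEquiv_unit]
  change (TopCat.toSSet.map f).app _ ((sSetTopAdj.unit.app X).app (op ⦋n⦌) x) =
    (TopCat.toSSet.map g).app _ ((sSetTopAdj.unit.app X).app (op ⦋n⦌) x)
  rw [← sing_point, toSSet_map_sing, toSSet_map_sing]
  exact congrArg sing (ContinuousMap.ext (h n x))

/-- A compatible family of functions on the points of the simplices induces a continuous map on the
realization. -/
lemma exists_realization_desc {Z : TopCat.{0}} (f : ∀ (n : ℕ), X _⦋n⦌ → C(Simplex n, Z))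
    (hf : ∀ (n m : ℕ) (g : ⦋n⦌ ⟶ ⦋m⦌) (x : X _⦋m⦌) (p : Simplex n),
      f n (X.map g.op x) p = f m x (stdSimplex.map g.toOrderHom p)) :
    ∃ F : |X| ⟶ Z, ∀ (n : ℕ) (x : X _⦋n⦌) (p : Simplex n), F (point x p) = f n x p := by
  let h : X ⟶ TopCat.toSSet.obj Z :=
    { app := fun n => ↾ fun x => (TopCat.toSSetObjEquiv Z n).symm (f n.unop.len x)
      naturality := by
        rintro ⟨⟨n⟩⟩ ⟨⟨m⟩⟩ g
        refine ConcreteCategory.hom_ext _ _ fun x => ?_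
        exact (congrArg sing (ContinuousMap.ext (hf m n g.unop x))).trans
          (map_sing g.unop (f n x)).symm }
  exact ⟨(sSetTopAdj.homEquiv X Z).symm h, fun n x p => homEquiv_symm_point h x _ rfl p⟩

lemma exists_point (w : |X|) : ∃ (n : ℕ) (x : X _⦋n⦌) (p : Simplex n), point x p = w := by
  -- two maps to an indiscrete space that agree on the points `point x p` are equal
  let f : |X| ⟶ TopCat.trivial.obj Prop := @TopCat.ofHom _ _ _ ⊤
    (@ContinuousMap.mk _ _ _ ⊤ (fun w => ∃ (n : ℕ) (x : X _⦋n⦌) (p : Simplex n), point x p = w)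
      continuous_top)
  let g : |X| ⟶ TopCat.trivial.obj Prop := @TopCat.ofHom _ _ _ ⊤
    (@ContinuousMap.mk _ _ _ ⊤ (fun w => True) continuous_top)
  have e : f = g := realization_hom_ext (fun n x p => eq_true ⟨n, x, p, rfl⟩)
  exact of_eq_true congr($e w)

lemma isOpen_realization_iff (O : Set |X|) :
    IsOpen O ↔ ∀ (n : ℕ) (x : X _⦋n⦌), IsOpen (point x ⁻¹' O) := by
  refine ⟨fun h n x => h.preimage (point x).continuous, fun h => ?_⟩
  -- the characteristic function of `O` is a continuous map to the Sierpiński space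
  obtain ⟨F, hF⟩ := exists_realization_desc (X := X) (Z := TopCat.of Prop)
    (fun n x => ⟨fun p => point x p ∈ O, isOpen_iff_continuous_mem.1 (h n x)⟩)
    (fun n m g x p => by
      change (_ ∈ O) = (_ ∈ O)
      rw [point_map])
  rw [isOpen_iff_continuous_mem]
  convert F.hom.continuous using 1
  ext w
  obtain ⟨n, x, p, rfl⟩ := exists_point w
  exact (hF n x p).to_iff.symm

lemma isClosed_realization_iff (C : Set |X|) :
    IsClosed C ↔ ∀ (n : ℕ) (x : X _⦋n⦌), IsClosed (point x ⁻¹' C) := by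
  simp only [← isOpen_compl_iff, isOpen_realization_iff, Set.preimage_compl]

/-! ### Normal forms of the points of the geometric realization -/

/-- The interior points of a simplex. -/
def IsInterior {n : ℕ} (p : Simplex n) : Prop := ∀ i, 0 < p i

lemma map_coord {n m : ℕ} (f : Fin (n + 1) → Fin (m + 1)) (p : Simplex n) (j : Fin (m + 1)) :
    stdSimplex.map f p j = ∑ i with f i = j, p i := by
  rw [stdSimplex.map_coe, FunOnFinite.linearMap_apply_apply]

lemma map_coord_of_injective {n m : ℕ} {f : Fin (n + 1) → Fin (m + 1)} (hf : Function.Injective f)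
    (p : Simplex n) (i : Fin (n + 1)) : stdSimplex.map f p (f i) = p i := by
  rw [map_coord, Finset.sum_eq_single_of_mem i (by simp)]
  intro j hj hji
  exact absurd (hf (Finset.mem_filter.1 hj).2) hji

lemma map_coord_pos_iff {n m : ℕ} (f : Fin (n + 1) → Fin (m + 1)) {p : Simplex n}
    (hp : IsInterior p) (j : Fin (m + 1)) : 0 < stdSimplex.map f p j ↔ j ∈ Set.range f := by
  rw [map_coord]
  constructor
  · intro h
    by_contra hj
    rw [Finset.sum_eq_zero] at h
    · exact lt_irrefl _ h
    · intro i hi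
      exact absurd ⟨i, (Finset.mem_filter.1 hi).2⟩ hj
  · rintro ⟨i, rfl⟩
    exact Finset.sum_pos (fun i _ => hp i) ⟨i, by simp⟩

lemma IsInterior.map {n m : ℕ} {f : Fin (n + 1) → Fin (m + 1)} {p : Simplex n}
    (hp : IsInterior p) (hf : Function.Surjective f) : IsInterior (stdSimplex.map f p) :=
  fun j => (map_coord_pos_iff f hp j).2 (hf j)

/-- Each point of a simplex is an interior point of a face. -/
lemma exists_interior_face (n : ℕ) (p : Simplex n) :
    ∃ (k : ℕ) (s : ⦋k⦌ ⟶ ⦋n⦌) (q : Simplex k), Mono s ∧ IsInterior q ∧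
      stdSimplex.map s.toOrderHom q = p := by
  induction n with
  | zero =>
    refine ⟨0, 𝟙 _, p, inferInstance, fun i => ?_, stdSimplex.map_id_apply p⟩
    have : ∑ i, p i = 1 := p.2.2
    rw [Fin.sum_univ_one] at this
    rw [Fin.eq_zero i, this]
    exact one_pos
  | succ n hn =>
    by_cases hp : IsInterior p
    · exact ⟨n + 1, 𝟙 _, p, inferInstance, hp, stdSimplex.map_id_apply p⟩
    · simp only [IsInterior, not_forall, not_lt] at hp
      obtain ⟨i, hi⟩ := hp
      have hi : p i = 0 := le_antisymm hi (p.2.1 i)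
      have h : ∑ j, p (i.succAbove j) = 1 := by
        have : ∑ j, p j = 1 := p.2.2
        rwa [Fin.sum_univ_succAbove _ i, hi, zero_add] at this
      let p' : Simplex n := ⟨fun j => p (i.succAbove j), fun j => p.2.1 _, h⟩
      obtain ⟨k, s, q, hs, hq, hqs⟩ := hn p'
      refine ⟨k, s ≫ SimplexCategory.δ i, q, inferInstance, hq, ?_⟩
      have : stdSimplex.map (SimplexCategory.δ i).toOrderHom p' = p := by
        ext j
        obtain rfl | ⟨j, rfl⟩ := Fin.eq_self_or_eq_succAbove i j
        · rw [map_coord, hi]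
          apply Finset.sum_eq_zero
          intro j hj
          exact absurd (Finset.mem_filter.1 hj).2 (Fin.succAbove_ne _ _)
        · exact map_coord_of_injective Fin.succAbove_right_injective p' j
      rw [← this, ← hqs, stdSimplex.map_comp_apply]
      rfl

lemma interior_face_unique {n k k' : ℕ} (s : ⦋k⦌ ⟶ ⦋n⦌) (s' : ⦋k'⦌ ⟶ ⦋n⦌) [Mono s] [Mono s']
    {q : Simplex k} {q' : Simplex k'} (hq : IsInterior q) (hq' : IsInterior q')
    (h : stdSimplex.map s.toOrderHom q = stdSimplex.map s'.toOrderHom q') :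
    (⟨k, s, q⟩ : Σ k, (⦋k⦌ ⟶ ⦋n⦌) × Simplex k) = ⟨k', s', q'⟩ := by
  have hs := SimplexCategory.mono_iff_injective.1 (inferInstance : Mono s)
  have hs' := SimplexCategory.mono_iff_injective.1 (inferInstance : Mono s')
  have hr : Set.range s.toOrderHom = Set.range s'.toOrderHom := by
    ext j
    rw [← map_coord_pos_iff _ hq, ← map_coord_pos_iff _ hq', h]
  obtain rfl : k = k' := by
    have := congrArg Nat.card (congrArg Set.Elem hr)
    rw [Nat.card_range_of_injective hs, Nat.card_range_of_injective hs'] at this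
    simpa using this
  obtain rfl : s = s' := SimplexCategory.Hom.ext _ _ (OrderHom.ext _ _
    ((StrictMono.range_inj (s.toOrderHom.monotone.strictMono_of_injective hs)
      (s'.toOrderHom.monotone.strictMono_of_injective hs')).1 hr))
  obtain rfl : q = q' := by
    ext i
    rw [← map_coord_of_injective hs, h, map_coord_of_injective hs]
  rfl

/-- `v` is a normal form of the point `p` of the simplex `x`: it consists of a nondegenerate simplex
and an interior point of it, obtained from `(x, p)` by first restricting to the face that contains
`p` in its interior, and then by applying the degeneracy to a nondegenerate simplex. -/
def IsNormalForm {n : ℕ} (x : X _⦋n⦌) (p : Simplex n) (v : Σ l, X _⦋l⦌ × Simplex l) : Prop :=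
  ∃ (k : ℕ) (s : ⦋k⦌ ⟶ ⦋n⦌) (e : ⦋k⦌ ⟶ ⦋v.1⦌) (q : Simplex k), Mono s ∧ Epi e ∧
    v.2.1 ∈ X.nonDegenerate v.1 ∧ IsInterior q ∧ stdSimplex.map s.toOrderHom q = p ∧
    X.map s.op x = X.map e.op v.2.1 ∧ stdSimplex.map e.toOrderHom q = v.2.2

lemma exists_isNormalForm {n : ℕ} (x : X _⦋n⦌) (p : Simplex n) : ∃ v, IsNormalForm x p v := by
  obtain ⟨k, s, q, hs, hq, h⟩ := exists_interior_face n p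
  obtain ⟨l, e, he, y, hy⟩ := X.exists_nonDegenerate (X.map s.op x)
  exact ⟨⟨l, y.1, stdSimplex.map e.toOrderHom q⟩, k, s, e, q, hs, he, y.2, hq, h, hy, rfl⟩

lemma nonDegenerate_unique {n l l' : ℕ} {x : X _⦋n⦌} {e : ⦋n⦌ ⟶ ⦋l⦌} {e' : ⦋n⦌ ⟶ ⦋l'⦌}
    {y : X _⦋l⦌} {y' : X _⦋l'⦌} (he : Epi e) (he' : Epi e') (hy : y ∈ X.nonDegenerate l)
    (hy' : y' ∈ X.nonDegenerate l') (h : x = X.map e.op y) (h' : x = X.map e'.op y') :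
    (⟨l, e, y⟩ : Σ l, (⦋n⦌ ⟶ ⦋l⦌) × X _⦋l⦌) = ⟨l', e', y'⟩ := by
  obtain rfl := X.unique_nonDegenerate_dim x e ⟨y, hy⟩ h e' ⟨y', hy'⟩ h'
  obtain rfl := X.unique_nonDegenerate_map x e ⟨y, hy⟩ h e' ⟨y', hy'⟩ h'
  have := X.unique_nonDegenerate_simplex x e ⟨y, hy⟩ h e ⟨y', hy'⟩ h'
  obtain rfl : y = y' := congrArg Subtype.val this
  rfl

lemma IsNormalForm.unique {n : ℕ} {x : X _⦋n⦌} {p : Simplex n} {v v' : Σ l, X _⦋l⦌ × Simplex l}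
    (h : IsNormalForm x p v) (h' : IsNormalForm x p v') : v = v' := by
  obtain ⟨l, y, r⟩ := v
  obtain ⟨l', y', r'⟩ := v'
  obtain ⟨k, s, e, q, hs, he, hy, hq, rfl, hx, hr⟩ := h
  obtain ⟨k', s', e', q', hs', he', hy', hq', hp, hx', hr'⟩ := h'
  obtain ⟨rfl, h⟩ := Sigma.mk.inj (interior_face_unique s s' hq hq' hp.symm)
  obtain ⟨rfl, rfl⟩ := Prod.mk.inj (eq_of_heq h)
  obtain ⟨h1, h⟩ := Sigma.mk.inj (nonDegenerate_unique he he' hy hy' hx hx')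
  dsimp only at h1
  subst h1
  obtain ⟨rfl, rfl⟩ := Prod.mk.inj (eq_of_heq h)
  dsimp only at hr hr'
  rw [← hr, ← hr']

lemma exists_epi_mono {n m : ℕ} (f : ⦋n⦌ ⟶ ⦋m⦌) :
    ∃ (k : ℕ) (e : ⦋n⦌ ⟶ ⦋k⦌) (i : ⦋k⦌ ⟶ ⦋m⦌), Epi e ∧ Mono i ∧ e ≫ i = f :=
  ⟨(image f).len, factorThruImage f, image.ι f, (inferInstance : Epi (factorThruImage f)),
    (inferInstance : Mono (image.ι f)), image.fac f⟩

lemma IsNormalForm.of_map {n m : ℕ} {f : ⦋n⦌ ⟶ ⦋m⦌} {x : X _⦋m⦌} {p : Simplex n}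
    {v : Σ l, X _⦋l⦌ × Simplex l} (h : IsNormalForm (X.map f.op x) p v) :
    IsNormalForm x (stdSimplex.map f.toOrderHom p) v := by
  obtain ⟨l, y, r⟩ := v
  obtain ⟨k, s, e, q, hs, he, hy, hq, rfl, hx, hr⟩ := h
  obtain ⟨k', g, s', hg, hs', hgs⟩ := exists_epi_mono (s ≫ f)
  obtain ⟨l', e', he', ⟨y', hy'⟩, h'⟩ := X.exists_nonDegenerate (X.map s'.op x)
  have hx' : X.map s.op (X.map f.op x) = X.map (g ≫ e').op y' := by
    rw [← comp_apply, ← Functor.map_comp, ← op_comp, ← hgs, op_comp, op_comp, Functor.map_comp,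
      Functor.map_comp, comp_apply, comp_apply, h']
  obtain ⟨h1, h⟩ := Sigma.mk.inj (nonDegenerate_unique he (epi_comp g e') hy hy' hx hx')
  dsimp only at h1
  subst h1
  obtain ⟨rfl, rfl⟩ := Prod.mk.inj (eq_of_heq h)
  refine ⟨k', s', e', stdSimplex.map g.toOrderHom q, hs', he', hy,
    hq.map (SimplexCategory.epi_iff_surjective.1 hg), ?_, h', ?_⟩
  · rw [stdSimplex.map_comp_apply, stdSimplex.map_comp_apply]
    exact congr(stdSimplex.map (⇑($hgs).toOrderHom) q)
  · rw [← hr, stdSimplex.map_comp_apply]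
    rfl

lemma IsNormalForm.point_eq {n : ℕ} {x : X _⦋n⦌} {p : Simplex n} {v : Σ l, X _⦋l⦌ × Simplex l}
    (h : IsNormalForm x p v) : point x p = point v.2.1 v.2.2 := by
  obtain ⟨k, s, e, q, hs, he, hy, hq, rfl, hx, hr⟩ := h
  rw [← hr, ← point_map, ← point_map, hx]

/-- Two points of the realization are equal only if they have the same normal form. -/
theorem IsNormalForm.eq_of_point_eq {n n' : ℕ} {x : X _⦋n⦌} {x' : X _⦋n'⦌} {p : Simplex n}
    {p' : Simplex n'} {v v' : Σ l, X _⦋l⦌ × Simplex l} (h : IsNormalForm x p v)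
    (h' : IsNormalForm x' p' v') (e : point x p = point x' p') : v = v' := by
  choose f hf using fun (n : ℕ) (x : X _⦋n⦌) (p : Simplex n) => exists_isNormalForm x p
  -- the normal form is a continuous function to an indiscrete space
  obtain ⟨F, hF⟩ := exists_realization_desc (X := X)
    (Z := TopCat.trivial.obj (Σ l, X _⦋l⦌ × Simplex l))
    (fun n x => @ContinuousMap.mk _ _ _ ⊤ (f n x) continuous_top)
    (fun n m g x p => (hf _ _ _).of_map.unique (hf _ _ _))
  have e' : f n x p = f n' x' p' := (hF n x p).symm.trans ((congrArg F e).trans (hF n' x' p'))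
  rw [h.unique (hf n x p), e', h'.unique (hf n' x' p')]

lemma IsNormalForm.map_mono {n : ℕ} {x : X _⦋n⦌} {p : Simplex n} {v : Σ l, X _⦋l⦌ × Simplex l}
    (h : IsNormalForm x p v) (f : X ⟶ Y) [Mono f] :
    IsNormalForm (f.app _ x) p ⟨v.1, f.app _ v.2.1, v.2.2⟩ := by
  obtain ⟨k, s, e, q, hs, he, hy, hq, h, hx, hr⟩ := h
  refine ⟨k, s, e, q, hs, he, (SSet.nonDegenerate_iff_of_mono f _).2 hy, hq, h, ?_, hr⟩
  exact (congr($(f.naturality s.op) x)).symm.trans ((congrArg (f.app _) hx).trans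
    (congr($(f.naturality e.op) v.2.1)))

lemma toTop_map_injective (f : X ⟶ Y) [Mono f] : Function.Injective (SSet.toTop.map f) := by
  intro w w' e
  obtain ⟨n, x, p, rfl⟩ := exists_point w
  obtain ⟨n', x', p', rfl⟩ := exists_point w'
  rw [toTop_map_point, toTop_map_point] at e
  obtain ⟨⟨l, y, r⟩, h⟩ := exists_isNormalForm x p
  obtain ⟨⟨l', y', r'⟩, h'⟩ := exists_isNormalForm x' p'
  rw [h.point_eq, h'.point_eq]
  obtain ⟨rfl, h⟩ := Sigma.mk.inj ((h.map_mono f).eq_of_point_eq (h'.map_mono f) e)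
  obtain ⟨h1, rfl⟩ := Prod.mk.inj (eq_of_heq h)
  dsimp only at h1 ⊢
  rw [(mono_iff_injective (f.app _)).1 inferInstance h1]

instance (n m : ℕ) : Finite (⦋n⦌ ⟶ ⦋m⦌) :=
  Finite.of_injective (fun f i => f.toOrderHom i) (fun _ _ h =>
    SimplexCategory.Hom.ext _ _ (OrderHom.ext _ _ h))

lemma isClosed_map_image {k n : ℕ} (s : Fin (k + 1) → Fin (n + 1)) {C : Set (Simplex k)}
    (hC : IsClosed C) : IsClosed (stdSimplex.map s '' C) :=
  (hC.isCompact.image (stdSimplex.continuous_map s)).isClosed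

/-- The realization of a monomorphism is a closed embedding. -/
theorem isClosedEmbedding_toTop_map (f : X ⟶ Y) [Mono f] :
    Topology.IsClosedEmbedding (SSet.toTop.map f) := by
  refine Topology.IsClosedEmbedding.of_continuous_injective_isClosedMap
    (SSet.toTop.map f).hom.continuous (toTop_map_injective f) (fun C hC => ?_)
  rw [isClosed_realization_iff]
  intro n y
  -- the preimage of the image of `C` in the simplex `y` is a union of closed subsets of faces
  have e : point y ⁻¹' (SSet.toTop.map f '' C) =
      ⋃ (k : Fin (n + 1)) (s : ⦋(k : ℕ)⦌ ⟶ ⦋n⦌), stdSimplex.map s.toOrderHom ''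
        {q | ∃ x, f.app _ x = Y.map s.op y ∧ point x q ∈ C} := by
    ext p
    simp only [Set.mem_preimage, Set.mem_iUnion, Set.mem_image, Set.mem_ofPred_eq]
    constructor
    · rintro ⟨w, hw, h⟩
      obtain ⟨m, x, p', rfl⟩ := exists_point w
      rw [toTop_map_point] at h
      obtain ⟨⟨l, x', r⟩, hv⟩ := exists_isNormalForm x p'
      obtain ⟨⟨l', y', r'⟩, hv'⟩ := exists_isNormalForm y p
      obtain ⟨rfl, h⟩ := Sigma.mk.inj ((hv.map_mono f).eq_of_point_eq hv' h)
      obtain ⟨h1, rfl⟩ := Prod.mk.inj (eq_of_heq h)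
      rw [hv.point_eq] at hw
      obtain ⟨k, s, e, q, hs, he, -, -, hp, hy, hr⟩ := hv'
      refine ⟨⟨k, Nat.lt_succ_of_le (SimplexCategory.le_of_mono s)⟩, s, q,
        ⟨X.map e.op x', ?_, ?_⟩, hp⟩
      · refine (congr($(f.naturality e.op) x')).trans ?_
        exact (congrArg (Y.map e.op) h1).trans hy.symm
      · dsimp only at hw hr
        rwa [point_map, hr]
    · rintro ⟨k, s, q, ⟨x, hx, hq⟩, rfl⟩
      refine ⟨_, hq, ?_⟩
      rw [toTop_map_point, hx, point_map]
  rw [e]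
  refine isClosed_iUnion_of_finite fun k => isClosed_iUnion_of_finite fun s =>
    isClosed_map_image _ ?_
  by_cases hx : ∃ x, f.app _ x = Y.map s.op y
  · obtain ⟨x, hx⟩ := hx
    convert hC.preimage (point x).continuous using 1
    ext q
    simp only [Set.mem_ofPred_eq, Set.mem_preimage]
    constructor
    · rintro ⟨x', hx', h⟩
      rwa [← (mono_iff_injective (f.app _)).1 inferInstance (hx'.trans hx.symm)]
    · exact fun h => ⟨x, hx, h⟩
  · convert isClosed_empty using 1
    ext q
    simp only [Set.mem_ofPred_eq, Set.mem_empty_iff_false, iff_false]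
    rintro ⟨x, hx', -⟩
    exact hx ⟨x, hx'⟩

/-- The points of a realization are closed. -/
instance : T1Space |X| where
  t1 w := by
    obtain ⟨m, x₀, p₀, rfl⟩ := exists_point w
    obtain ⟨⟨l, y, r⟩, h₀⟩ := exists_isNormalForm x₀ p₀
    rw [isClosed_realization_iff]
    intro n x
    have e : point x ⁻¹' {point x₀ p₀} =
        ⋃ (k : Fin (n + 1)) (s : ⦋(k : ℕ)⦌ ⟶ ⦋n⦌) (e : ⦋(k : ℕ)⦌ ⟶ ⦋l⦌)
          (_ : X.map s.op x = X.map e.op y), stdSimplex.map s.toOrderHom ''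
            (stdSimplex.map e.toOrderHom ⁻¹' {r}) := by
      ext p
      simp only [Set.mem_preimage, Set.mem_iUnion, Set.mem_image, Set.mem_singleton_iff]
      constructor
      · intro h
        obtain ⟨v, hv⟩ := exists_isNormalForm x p
        obtain rfl := hv.eq_of_point_eq h₀ h
        obtain ⟨k, s, e, q, hs, he, -, -, hp, hx, hr⟩ := hv
        exact ⟨⟨k, Nat.lt_succ_of_le (SimplexCategory.le_of_mono s)⟩, s, e, hx, q, hr, hp⟩
      · rintro ⟨k, s, e, hx, q, rfl, rfl⟩
        rw [h₀.point_eq, ← point_map, ← point_map, hx]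
    rw [e]
    exact isClosed_iUnion_of_finite fun k => isClosed_iUnion_of_finite fun s =>
      isClosed_iUnion_of_finite fun e => isClosed_iUnion_of_finite fun _ =>
        isClosed_map_image _ (isClosed_singleton.preimage (stdSimplex.continuous_map _))

lemma range_toTop_sk_mono (X : SSet.{0}) {d d' : ℕ} (h : d ≤ d') :
    Set.range (SSet.toTop.map (sk X d).ι) ⊆ Set.range (SSet.toTop.map (sk X d').ι) := by
  rintro _ ⟨w, rfl⟩
  refine ⟨SSet.toTop.map (SSet.Subcomplex.homOfLE ((sk X).monotone h)) w, ?_⟩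
  have : SSet.Subcomplex.homOfLE ((sk X).monotone h) ≫ (sk X d').ι = (sk X d).ι := rfl
  rw [← this, SSet.toTop.map_comp]
  rfl

lemma point_mem_range_sk {n : ℕ} (x : X _⦋n⦌) (p : Simplex n) :
    point x p ∈ Set.range (SSet.toTop.map (sk X (n + 1)).ι) :=
  ⟨point (X := (sk X (n + 1) : SSet)) ⟨x, exists_sk X n x⟩ p, toTop_map_point _ _ _⟩

/-- A compact subset of the realization is contained in a skeleton. -/
theorem exists_subset_range_sk {C : Set |X|} (hC : IsCompact C) :
    ∃ d, C ⊆ Set.range (SSet.toTop.map (sk X d).ι) := by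
  by_contra! h
  choose w hw hw' using fun d => Set.not_subset.1 (h d)
  -- any set of points outside of larger and larger skeleta is closed
  let T (m : ℕ) : Set |X| := w '' Set.Ici m
  have hT (m : ℕ) : IsClosed (T m) := by
    rw [isClosed_realization_iff]
    intro n x
    have e : point x ⁻¹' (T m) = ⋃ d : Fin (n + 1), ⋃ (_ : m ≤ d), point x ⁻¹' {w d} := by
      ext p
      simp only [T, Set.mem_preimage, Set.mem_image, Set.mem_Ici, Set.mem_iUnion,
        Set.mem_singleton_iff]
      constructor
      · rintro ⟨d, hd, hp⟩
        have : d < n + 1 := by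
          by_contra! hd'
          apply hw' d
          rw [hp]
          exact range_toTop_sk_mono X hd' (point_mem_range_sk x p)
        exact ⟨⟨d, this⟩, hd, hp.symm⟩
      · rintro ⟨d, hd, hp⟩
        exact ⟨d, hd, hp.symm⟩
    rw [e]
    exact isClosed_iUnion_of_finite fun d => isClosed_iUnion_of_finite fun _ =>
      isClosed_singleton.preimage (point x).continuous
  have hTC (m : ℕ) : T m ⊆ C := by
    rintro _ ⟨d, -, rfl⟩
    exact hw d
  obtain ⟨y, hy⟩ := IsCompact.nonempty_iInter_of_sequence_nonempty_isCompact_isClosed T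
    (fun m => Set.image_mono (Set.Ici_subset_Ici.2 (Nat.le_succ m)))
    (fun m => ⟨w m, m, Set.mem_Ici.2 le_rfl, rfl⟩)
    (hC.of_isClosed_subset (hT 0) (hTC 0)) hT
  obtain ⟨n, x, p, rfl⟩ := exists_point y
  obtain ⟨d, hd, e⟩ := Set.mem_iInter.1 hy (n + 1)
  apply hw' d
  rw [e]
  exact range_toTop_sk_mono X hd (point_mem_range_sk x p)

end Points

/-! ### The collar of the boundary of a simplex -/

section Radius

variable {n : ℕ}

/-- The smallest coordinate of a point of a simplex, normalized to be `1` at the barycenter. -/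
def radius (u : Simplex n) : ℝ := (n + 1) * Finset.univ.inf' Finset.univ_nonempty (fun i => u i)

lemma continuous_coord (i : Fin (n + 1)) : Continuous (fun u : Simplex n => u i) :=
  (continuous_apply i).comp continuous_subtype_val

lemma continuous_radius : Continuous (radius (n := n)) :=
  continuous_const.mul (Continuous.finset_inf'_apply _ (fun i _ => continuous_coord i))

lemma radius_le (u : Simplex n) (i : Fin (n + 1)) : radius u ≤ (n + 1) * u i :=
  mul_le_mul_of_nonneg_left (Finset.inf'_le _ (Finset.mem_univ i)) (by positivity)

lemma exists_radius_eq (u : Simplex n) : ∃ i, radius u = (n + 1) * u i := by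
  obtain ⟨i, -, hi⟩ := Finset.exists_mem_eq_inf' Finset.univ_nonempty (fun i => u i)
  exact ⟨i, by rw [radius, hi]⟩

lemma radius_nonneg (u : Simplex n) : 0 ≤ radius u := by
  obtain ⟨i, hi⟩ := exists_radius_eq u
  rw [hi]
  exact mul_nonneg (by positivity) (u.2.1 i)

lemma radius_le_one (u : Simplex n) : radius u ≤ 1 := by
  have h : ∑ i, radius u ≤ ∑ i, (n + 1) * u i := Finset.sum_le_sum (fun i _ => radius_le u i)
  have hs : ∑ i, u i = 1 := u.2.2
  rw [← Finset.mul_sum, hs] at h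
  simp only [Finset.sum_const, Finset.card_univ, Fintype.card_fin, nsmul_eq_mul] at h
  push_cast at h
  exact le_of_mul_le_mul_left h (by positivity)

lemma radius_eq_zero_iff (u : Simplex n) : radius u = 0 ↔ ∃ i, u i = 0 := by
  constructor
  · intro h
    obtain ⟨i, hi⟩ := exists_radius_eq u
    exact ⟨i, by
      rw [h] at hi
      exact (mul_eq_zero.1 hi.symm).resolve_left (by positivity)⟩
  · rintro ⟨i, hi⟩
    have := radius_le u i
    rw [hi, mul_zero] at this
    exact le_antisymm this (radius_nonneg u)

/-- The factor by which the distance to the barycenter is divided at time `t`. -/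
def scale (t : unitInterval) (u : Simplex n) : ℝ := max (1 - radius u) (1 / (1 + t))

lemma scale_pos (t : unitInterval) (u : Simplex n) : 0 < scale t u :=
  lt_max_of_lt_right (by have := t.2.1; positivity)

lemma scale_le_one (t : unitInterval) (u : Simplex n) : scale t u ≤ 1 := by
  refine max_le (by linarith [radius_nonneg u]) ?_
  rw [div_le_one (by linarith [t.2.1])]
  linarith [t.2.1]

lemma continuous_scale : Continuous (fun p : unitInterval × Simplex n => scale p.1 p.2) := by
  refine (continuous_const.sub (continuous_radius.comp continuous_snd)).max ?_
  refine continuous_const.div (by fun_prop) (fun p => ?_)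
  have := p.1.2.1
  positivity

/-- The deformation of a simplex that pushes a neighbourhood of the boundary to the boundary, away
from the barycenter. -/
def push : C(unitInterval × Simplex n, Simplex n) where
  toFun p := ⟨fun i => 1 / (n + 1) + (p.2 i - 1 / (n + 1)) / scale p.1 p.2, by
    refine ⟨fun i => ?_, ?_⟩
    · have hs := scale_pos p.1 p.2
      have h1 : 1 - radius p.2 ≤ scale p.1 p.2 := le_max_left _ _
      have h2 := radius_le p.2 i
      have hn : (0 : ℝ) < n + 1 := by positivity
      have h3 : -scale p.1 p.2 ≤ (n + 1) * p.2 i - 1 := by linarith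
      have h4 : 1 / ((n : ℝ) + 1) + (p.2 i - 1 / (n + 1)) / scale p.1 p.2 =
          ((n + 1) * p.2 i - 1 + scale p.1 p.2) / ((n + 1) * scale p.1 p.2) := by
        field_simp
        ring
      change 0 ≤ 1 / ((n : ℝ) + 1) + (p.2 i - 1 / (n + 1)) / scale p.1 p.2
      rw [h4]
      exact div_nonneg (by linarith) (by positivity)
    · have hs : ∑ i, p.2 i = 1 := p.2.2.2
      have hn : (n : ℝ) + 1 ≠ 0 := by positivity
      have h0 : ∑ i, (p.2 i - 1 / ((n : ℝ) + 1)) / scale p.1 p.2 = 0 := by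
        rw [← Finset.sum_div, Finset.sum_sub_distrib, hs]
        simp [hn]
      rw [Finset.sum_add_distrib, h0]
      simp [hn]⟩
  continuous_toFun := by
    refine Continuous.subtype_mk (continuous_pi fun i => continuous_const.add ?_) _
    exact (((continuous_coord i).comp continuous_snd).sub continuous_const).div continuous_scale
      (fun p => (scale_pos _ _).ne')

lemma push_apply (t : unitInterval) (u : Simplex n) (i : Fin (n + 1)) :
    push (t, u) i = 1 / (n + 1) + (u i - 1 / (n + 1)) / scale t u := rfl

lemma push_eq_self {t : unitInterval} {u : Simplex n} (h : scale t u = 1) : push (t, u) = u := by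
  ext i
  rw [push_apply, h]
  ring

lemma push_zero (u : Simplex n) : push (0, u) = u := by
  apply push_eq_self
  rw [scale]
  simp [radius_nonneg u]

lemma push_of_radius_eq_zero {t : unitInterval} {u : Simplex n} (h : radius u = 0) :
    push (t, u) = u :=
  push_eq_self (le_antisymm (scale_le_one _ _) (by rw [scale, h]; simp))

lemma radius_push_le (t : unitInterval) (u : Simplex n) : radius (push (t, u)) ≤ radius u := by
  obtain ⟨i, hi⟩ := exists_radius_eq u
  refine (radius_le _ i).trans ?_
  have hs := scale_pos t u
  have hn : (n : ℝ) + 1 ≠ 0 := by positivity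
  have h : ((n : ℝ) + 1) * push (t, u) i = 1 + (radius u - 1) / scale t u := by
    rw [push_apply, hi]
    field_simp
  rw [h]
  have : (radius u - 1) / scale t u ≤ radius u - 1 := by
    rw [div_le_iff₀ hs]
    nlinarith [radius_le_one u, scale_le_one t u]
  linarith

lemma radius_push_one {u : Simplex n} (h : radius u < 1 / 2) : radius (push (1, u)) = 0 := by
  obtain ⟨i, hi⟩ := exists_radius_eq u
  rw [radius_eq_zero_iff]
  refine ⟨i, ?_⟩
  have hs : scale 1 u = 1 - radius u := max_eq_left (by norm_num; linarith)
  have hn : (n : ℝ) + 1 ≠ 0 := by positivity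
  have h1 : 1 - ((n : ℝ) + 1) * u i ≠ 0 := by rw [← hi]; linarith
  rw [push_apply, hs, hi]
  field_simp
  ring

end Radius

/-! ### Coproducts of simplices and of their boundaries -/

lemma point_eq {X : SSet.{0}} {n : ℕ} (x : X _⦋n⦌) (p : Simplex n) :
    point x p = SSet.toTop.map (SSet.yonedaEquiv.symm x) ((⦋n⦌).toTopHomeo.symm p) :=
  congrArg (fun f : SimplexCategory.toTop.{0}.obj ⦋n⦌ ⟶ |X| => f ⟨p⟩)
    (sSetTopAdj_unit_app_app_down X (op ⦋n⦌) x)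

lemma toTopHomeo_point {n m : ℕ} (x : (Δ[n] : SSet.{0}) _⦋m⦌) (p : Simplex m) :
    (⦋n⦌).toTopHomeo (point x p) = stdSimplex.map (SSet.stdSimplex.asOrderHom x) p := by
  have h : SSet.yonedaEquiv.symm x = SSet.stdSimplex.map (SSet.stdSimplex.objEquiv x) :=
    SSet.yonedaEquiv.injective ((Equiv.apply_symm_apply _ _).trans
      ((Equiv.symm_apply_apply _ _).symm.trans (SSet.yonedaEquiv_map _).symm))
  rw [point_eq, h, SimplexCategory.toTopHomeo_naturality_apply, Homeomorph.apply_symm_apply]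
  rfl

section Sigma

variable (I : Type) [TopologicalSpace I] [DiscreteTopology I] (n : ℕ)

/-- The product of a discrete space with a simplex, as a coproduct of realizations of standard
simplices. -/
def prodCofan : Cofan (fun _ : I => |(Δ[n] : SSet.{0})|) :=
  Cofan.mk (TopCat.of (I × Simplex n)) fun i =>
    TopCat.ofHom ⟨fun w => (i, (⦋n⦌).toTopHomeo w),
      continuous_const.prodMk (⦋n⦌).toTopHomeo.continuous⟩

/-- The product of a discrete space with a simplex is a coproduct of realizations of standard
simplices. -/
def isColimitProdCofan : IsColimit (prodCofan I n) :=
  Cofan.IsColimit.mk _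
    (fun s => TopCat.ofHom ⟨fun v => s.inj v.1 ((⦋n⦌).toTopHomeo.symm v.2),
      continuous_prod_of_discrete_left.2 fun i =>
        (s.inj i).hom.continuous.comp (⦋n⦌).toTopHomeo.symm.continuous⟩)
    (fun s i => by
      ext w
      exact congrArg (s.inj i) (Homeomorph.symm_apply_apply _ w))
    (fun s m hm => by
      ext ⟨i, p⟩
      have := congr($(hm i) ((⦋n⦌).toTopHomeo.symm p))
      refine Eq.trans ?_ this
      exact congrArg (fun q => m (i, q)) (Homeomorph.apply_symm_apply _ p).symm)

/-- The realization of a coproduct of standard simplices. -/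
def sigmaIso : |∐ fun _ : I => (Δ[n] : SSet.{0})| ≅ TopCat.of (I × Simplex n) :=
  (isColimitCofanMkObjOfIsColimit SSet.toTop _ _
    (coproductIsCoproduct fun _ : I => (Δ[n] : SSet.{0}))).coconePointUniqueUpToIso
      (isColimitProdCofan I n)

lemma sigmaIso_hom_ι (i : I) (w : |(Δ[n] : SSet.{0})|) :
    (sigmaIso I n).hom (SSet.toTop.map (Sigma.ι (fun _ : I => (Δ[n] : SSet.{0})) i) w) =
      (i, (⦋n⦌).toTopHomeo w) :=
  congr($((isColimitCofanMkObjOfIsColimit SSet.toTop _ _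
    (coproductIsCoproduct fun _ : I => (Δ[n] : SSet.{0}))).comp_coconePointUniqueUpToIso_hom
      (isColimitProdCofan I n) ⟨i⟩) w)

lemma sigmaIso_hom_point (i : I) {m : ℕ} (x : (Δ[n] : SSet.{0}) _⦋m⦌) (p : Simplex m) :
    (sigmaIso I n).hom (point ((Sigma.ι (fun _ : I => (Δ[n] : SSet.{0})) i).app _ x) p) =
      (i, stdSimplex.map (SSet.stdSimplex.asOrderHom x) p) := by
  rw [← toTop_map_point, sigmaIso_hom_ι, toTopHomeo_point]

/-- The inclusion of a coproduct of boundaries of simplices into the coproduct of simplices. -/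
abbrev sigmaBoundaryι : (∐ fun _ : I => (∂Δ[n] : SSet.{0})) ⟶ ∐ fun _ : I => (Δ[n] : SSet.{0}) :=
  Limits.Sigma.map fun _ => ∂Δ[n].ι

instance : Mono (sigmaBoundaryι I n) := inferInstance

lemma exists_sigma_ι {I : Type} {F : I → SSet.{0}} {m : SimplexCategoryᵒᵖ} (a : (∐ F).obj m) :
    ∃ (i : I) (x : (F i).obj m), (Sigma.ι F i).app m x = a :=
  Cofan.inj_jointly_surjective_of_isColimit
    (isColimitCofanMkObjOfIsColimit ((CategoryTheory.evaluation _ _).obj m) _ _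
      (coproductIsCoproduct F)) a

/-- The coproduct of boundaries of simplices consists of the points with a coordinate equal to zero.
-/
lemma mem_range_sigmaBoundary_iff (v : I × Simplex n) :
    v ∈ Set.range (SSet.toTop.map (sigmaBoundaryι I n) ≫ (sigmaIso I n).hom) ↔ ∃ j, v.2 j = 0 := by
  have key (i : I) {m : ℕ} (x : (∂Δ[n] : SSet.{0}) _⦋m⦌) (p : Simplex m) :
      (SSet.toTop.map (sigmaBoundaryι I n) ≫ (sigmaIso I n).hom)
        (point ((Sigma.ι (fun _ : I => (∂Δ[n] : SSet.{0})) i).app _ x) p) =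
      (i, stdSimplex.map (SSet.stdSimplex.asOrderHom x.1) p) := by
    refine Eq.trans ?_ (sigmaIso_hom_point I n i x.1 p)
    rw [← toTop_map_point]
    have e : (sigmaBoundaryι I n).app _ ((Sigma.ι (fun _ : I => (∂Δ[n] : SSet.{0})) i).app _ x) =
        (Sigma.ι (fun _ : I => (Δ[n] : SSet.{0})) i).app _ x.1 :=
      congr(($(Sigma.ι_map (fun _ : I => ∂Δ[n].ι) i)).app (op ⦋m⦌) x)
    rw [← e]
    exact congrArg (sigmaIso I n).hom ((congrArg (SSet.toTop.map (sigmaBoundaryι I n))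
      (toTop_map_point _ x p)).trans (toTop_map_point _ _ p))
  constructor
  · rintro ⟨w, rfl⟩
    obtain ⟨m, a, p, rfl⟩ := exists_point w
    obtain ⟨i, x, rfl⟩ := exists_sigma_ι a
    obtain ⟨j, hj⟩ := (SSet.mem_boundary_iff_notMem_range x.1).1 x.2
    refine ⟨j, ?_⟩
    rw [key, map_coord]
    exact Finset.sum_eq_zero fun i hi => absurd ⟨i, (Finset.mem_filter.1 hi).2⟩ hj
  · rintro ⟨j, hj⟩
    obtain ⟨k, s, q, hs, hq, h⟩ := exists_interior_face n v.2
    have hx : SSet.stdSimplex.objEquiv.symm s ∈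
        (∂Δ[n] : (Δ[n] : SSet.{0}).Subcomplex).obj (op ⦋k⦌) := by
      rw [SSet.mem_boundary_iff_notMem_range]
      refine ⟨j, fun hj' => ?_⟩
      have := (map_coord_pos_iff s.toOrderHom hq j).2 hj'
      rw [h, hj] at this
      exact lt_irrefl _ this
    exact ⟨_, (key v.1 ⟨_, hx⟩ q).trans (Prod.ext rfl h)⟩

/-- The collar of the inclusion of a coproduct of boundaries of simplices. -/
def sigmaCollar : Collar (SSet.toTop.map (sigmaBoundaryι I n) ≫ (sigmaIso I n).hom) where
  isClosedEmbedding := (TopCat.homeoOfIso (sigmaIso I n)).isClosedEmbedding.comp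
    (isClosedEmbedding_toTop_map (sigmaBoundaryι I n))
  ρ := ⟨fun v => radius v.2, continuous_radius.comp continuous_snd⟩
  ρ_eq_zero s := (radius_eq_zero_iff _).2 ((mem_range_sigmaBoundary_iff I n _).1 ⟨s, rfl⟩)
  mem_range _ hu := (mem_range_sigmaBoundary_iff I n _).2 ((radius_eq_zero_iff _).1 hu)
  ρ_nonneg _ := radius_nonneg _
  φ := ⟨fun p => (p.2.1, push (p.1, p.2.2)), (continuous_fst.comp continuous_snd).prodMk
    (push.continuous.comp (continuous_fst.prodMk (continuous_snd.comp continuous_snd)))⟩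
  φ_zero _ := Prod.ext rfl (push_zero _)
  φ_apply _ s := Prod.ext rfl (push_of_radius_eq_zero
    ((radius_eq_zero_iff _).2 ((mem_range_sigmaBoundary_iff I n _).1 ⟨s, rfl⟩)))
  ρ_φ_le _ _ := radius_push_le _ _
  φ_one_mem _ hu := (mem_range_sigmaBoundary_iff I n _).2
    ((radius_eq_zero_iff _).1 (radius_push_one hu))

end Sigma

/-- The realization is compatible with the attachment of cells. -/
lemma relSingularIso_attach (X : SSet.{0}) (d : ℕ) :
    relSingularIso R (SSet.toTop.mapArrow.map (attach X d)) := by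
  let I := SSet.relativeCellComplexOfMono.Cell (⊥ : X.Subcomplex).ι d
  let _ : TopologicalSpace I := ⊥
  have : DiscreteTopology I := ⟨rfl⟩
  have sq := (isPushout_attach X d).map SSet.toTop
  let e := sigmaIso I d
  have sq' : IsPushout (SSet.toTop.map (sigmaBoundaryι I d) ≫ e.hom)
      (SSet.toTop.map (attach X d).left) (e.inv ≫ SSet.toTop.map (attach X d).right)
      (SSet.toTop.map (SSet.relativeCellComplexOfMono.r (⊥ : X.Subcomplex).ι d)) :=
    sq.of_iso (Iso.refl _) e (Iso.refl _) (Iso.refl _) (Category.id_comp _).symm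
      (by simp) (by simp) (by simp)
  let φ : Arrow.mk (SSet.toTop.map (sigmaBoundaryι I d)) ⟶
      Arrow.mk (SSet.toTop.map (sigmaBoundaryι I d) ≫ e.hom) :=
    Arrow.homMk (𝟙 _) e.hom (Category.id_comp _)
  have hφ : relSingularIso R φ := by
    have : IsIso φ := (Arrow.isoMk (f := Arrow.mk (SSet.toTop.map (sigmaBoundaryι I d)))
      (g := Arrow.mk (SSet.toTop.map (sigmaBoundaryι I d) ≫ e.hom))
      (Iso.refl _) e (Category.id_comp _)).isIso_hom
    exact inferInstanceAs (QuasiIso ((relChains R).map (TopCat.toSSet.mapArrow.map φ)))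
  have h := (relSingularIso R).comp_mem _ _ hφ ((sigmaCollar I d).relSingularIso_of_isPushout R sq')
  have e' : SSet.toTop.mapArrow.map (attach X d) = φ ≫ Arrow.homMk (f := Arrow.mk
      (SSet.toTop.map (sigmaBoundaryι I d) ≫ e.hom)) (g := Arrow.mk (SSet.toTop.map
        (SSet.relativeCellComplexOfMono.r (⊥ : X.Subcomplex).ι d)))
      (SSet.toTop.map (attach X d).left) (e.inv ≫ SSet.toTop.map (attach X d).right)
      sq'.w.symm :=
    CommaMorphism.ext (Category.id_comp _).symm (e.hom_inv_id_assoc _).symm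
  rw [e']
  exact h

/-! ### The unit of the realization -/

lemma homologyIso_const_stdSimplex (n : ℕ) : homologyIso R
    (SSet.const (X := (Δ[n] : SSet.{0})) (SSet.stdSimplex.obj₀Equiv.symm (0 : Fin 1))) := by
  exact homologyIso_of_homotopy R _ (SSet.const (SSet.stdSimplex.obj₀Equiv.symm 0))
    { h := contraction n, h₀ := ι₀_contraction n, h₁ := ι₁_contraction n, rel := bot_hom_ext _ _ }
    { h := CartesianMonoidalCategory.fst _ _
      h₀ := SSet.stdSimplex.isTerminalObj₀.hom_ext _ _
      h₁ := SSet.stdSimplex.isTerminalObj₀.hom_ext _ _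
      rel := bot_hom_ext _ _ }

instance (n : ℕ) : ContractibleSpace |(Δ[n] : SSet.{0})| :=
  (⦋n⦌).toTopHomeo.contractibleSpace_iff.2
    ((convex_stdSimplex ℝ (Fin (n + 1))).contractibleSpace ⟨_, (Classical.arbitrary (Simplex n)).2⟩)

lemma homologyIso_toSSet_of_contractible {A B : TopCat.{0}} [ContractibleSpace A] [Unique B]
    (f : A ⟶ B) : homologyIso R (TopCat.toSSet.map f) := by
  obtain ⟨a, ⟨h⟩⟩ := id_nullhomotopic A
  refine homologyIso_toSSet_of_homotopy R f (TopCat.ofHom (ContinuousMap.const _ a)) h.symm ?_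
  have e : TopCat.ofHom (ContinuousMap.const B a) ≫ f = 𝟙 B := by
    ext
    exact Subsingleton.elim _ _
  rw [e]
  exact ContinuousMap.Homotopy.refl _

lemma homologyIso_unit_stdSimplex (n : ℕ) :
    homologyIso R (sSetTopAdj.unit.app (Δ[n] : SSet.{0})) := by
  have h₀ : IsIso (sSetTopAdj.unit.app (Δ[0] : SSet.{0})) := by
    have (m : SimplexCategoryᵒᵖ) : IsIso ((sSetTopAdj.unit.app (Δ[0] : SSet.{0})).app m) := by
      rw [isIso_iff_bijective]
      refine ⟨fun x y _ => stdSimplex_ext fun i => Subsingleton.elim (α := Fin 1) _ _, fun y =>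
        ⟨SSet.stdSimplex.const 0 0 m, (TopCat.toSSetObjEquiv _ m).injective
          (ContinuousMap.ext fun p => Subsingleton.elim (α := |(Δ[0] : SSet.{0})|) _ _)⟩⟩
    exact NatIso.isIso_of_isIso_app _
  refine (homologyIso R).of_postcomp _ _ (homologyIso_toSSet_of_contractible R (SSet.toTop.map
    (SSet.const (X := (Δ[n] : SSet.{0})) (SSet.stdSimplex.obj₀Equiv.symm (0 : Fin 1))))) ?_
  have := (homologyIso R).comp_mem _ _ (homologyIso_const_stdSimplex R n)
    (homologyIso_of_isIso R (sSetTopAdj.unit.app (Δ[0] : SSet.{0})))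
  have e := sSetTopAdj.unit.naturality
    (SSet.const (X := (Δ[n] : SSet.{0})) (SSet.stdSimplex.obj₀Equiv.symm (0 : Fin 1)))
  exact e ▸ this

/-- Since simplices are connected, the singular simplicial set of the realization of a coproduct of
standard simplices is a coproduct. -/
lemma isIso_sigma_desc (I : Type) (n : ℕ) : IsIso (Sigma.desc fun i =>
    TopCat.toSSet.map (SSet.toTop.map (Sigma.ι (fun _ : I => (Δ[n] : SSet.{0})) i))) := by
  let _ : TopologicalSpace I := ⊥
  have : DiscreteTopology I := ⟨rfl⟩
  let F (_ : I) : SSet.{0} := TopCat.toSSet.obj |(Δ[n] : SSet.{0})|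
  let ψ : ∐ F ⟶ _ := Sigma.desc fun i =>
    TopCat.toSSet.map (SSet.toTop.map (Sigma.ι (fun _ : I => (Δ[n] : SSet.{0})) i))
  let e := sigmaIso I n
  have hψ (i : I) {m : ℕ} (σ : C(Simplex m, |(Δ[n] : SSet.{0})|)) :
      ψ.app _ ((Sigma.ι F i).app (op ⦋m⦌) (sing σ)) =
        sing ((SSet.toTop.map (Sigma.ι (fun _ : I => (Δ[n] : SSet.{0})) i)).hom.comp σ) :=
    congr(($(Sigma.ι_desc (fun i => TopCat.toSSet.map (SSet.toTop.map
      (Sigma.ι (fun _ : I => (Δ[n] : SSet.{0})) i))) i)).app (op ⦋m⦌) (sing σ))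
  have (m : SimplexCategoryᵒᵖ) : IsIso (ψ.app m) := by
    obtain ⟨⟨m⟩⟩ := m
    rw [isIso_iff_bijective]
    constructor
    · intro a b hab
      obtain ⟨i, x, rfl⟩ := exists_sigma_ι a
      obtain ⟨j, y, rfl⟩ := exists_sigma_ι b
      obtain ⟨σ, rfl⟩ := sing_surjective x
      obtain ⟨τ, rfl⟩ := sing_surjective y
      have h (p : Simplex m) : (i, (⦋n⦌).toTopHomeo (σ p)) = (j, (⦋n⦌).toTopHomeo (τ p)) := by
        have := congr(e.hom ($(sing_injective ((hψ i σ).symm.trans (hab.trans (hψ j τ)))) p))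
        exact (sigmaIso_hom_ι I n i (σ p)).symm.trans (this.trans (sigmaIso_hom_ι I n j (τ p)))
      obtain rfl : i = j := congrArg Prod.fst (h (Classical.arbitrary _))
      obtain rfl : σ = τ := ContinuousMap.ext fun p =>
        (⦋n⦌).toTopHomeo.injective (congrArg Prod.snd (h p))
      rfl
    · intro y
      obtain ⟨τ, rfl⟩ := sing_surjective y
      let p₀ : Simplex m := Classical.arbitrary _
      let i : I := (e.hom (τ p₀)).1
      have hi (p : Simplex m) : (e.hom (τ p)).1 = i :=
        PreconnectedSpace.constant inferInstance
          (continuous_fst.comp (e.hom.hom.continuous.comp τ.continuous))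
      let σ : C(Simplex m, |(Δ[n] : SSet.{0})|) := ⟨fun p => (⦋n⦌).toTopHomeo.symm (e.hom (τ p)).2,
        (⦋n⦌).toTopHomeo.symm.continuous.comp
          (continuous_snd.comp (e.hom.hom.continuous.comp τ.continuous))⟩
      refine ⟨(Sigma.ι F i).app (op ⦋m⦌) (sing σ), ?_⟩
      rw [hψ]
      refine congrArg sing (ContinuousMap.ext fun p => (TopCat.homeoOfIso e).injective ?_)
      refine (sigmaIso_hom_ι I n i (σ p)).trans (Prod.ext (hi p).symm ?_)
      exact Homeomorph.apply_symm_apply _ _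
  exact NatIso.isIso_of_isIso_app ψ

/-- The unit map from a simplicial set to the singular simplicial set of its realization is a
homology isomorphism. -/
theorem homologyIso_unit (X : SSet.{0}) : homologyIso R (sSetTopAdj.unit.app X) := by
  have : (SSet.toTop.{0} ⋙ TopCat.toSSet.{0}).PreservesMonomorphisms :=
    ⟨fun f _ => mono_toSSet_map (toTop_map_injective f)⟩
  refine homologyIso_app_of_cells R (F := 𝟭 _) (G := SSet.toTop ⋙ TopCat.toSSet) sSetTopAdj.unit
    (fun I n => ?_) (fun X d => relHomologyIso_of_isPushout R _ (isPushout_attach X d))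
    (fun X d => relSingularIso_attach R X d) (fun X n x => ⟨n + 1, ⟨x, exists_sk X n x⟩, rfl⟩)
    (fun X n x => ?_) X
  · have h := homologyIso_of_isColimit_cofan R (coproductIsCoproduct fun _ : I => (Δ[n] : SSet.{0}))
      (coproductIsCoproduct fun _ : I => TopCat.toSSet.obj |(Δ[n] : SSet.{0})|) _
      (fun _ => homologyIso_unit_stdSimplex R n)
      (Limits.Sigma.map fun _ => sSetTopAdj.unit.app (Δ[n] : SSet.{0})) (fun i => Sigma.ι_map _ _)
    have e : sSetTopAdj.unit.app (∐ fun _ : I => (Δ[n] : SSet.{0})) =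
        (Limits.Sigma.map fun _ => sSetTopAdj.unit.app (Δ[n] : SSet.{0})) ≫ Sigma.desc fun i =>
          TopCat.toSSet.map (SSet.toTop.map (Sigma.ι (fun _ : I => (Δ[n] : SSet.{0})) i)) := by
      apply Sigma.hom_ext
      intro i
      simp
    rw [e]
    exact (homologyIso R).comp_mem _ _ h (@homologyIso_of_isIso K _ R _ _ _ (isIso_sigma_desc I n))
  · obtain ⟨σ, rfl⟩ := sing_surjective x
    obtain ⟨d, hd⟩ := exists_subset_range_sk (isCompact_range σ.continuous)
    have := (sing_mem_range_iff (isClosedEmbedding_toTop_map (sk X d).ι).isEmbedding σ).2 hd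
    obtain ⟨y, hy⟩ := this
    exact ⟨d, y, hy⟩

/-! ### Finite powers -/

/-- Homology isomorphisms can be detected after identifying the source and the target with other
simplicial sets. -/
lemma homologyIso_of_square {A B C D : SSet.{0}} {f : A ⟶ B} {g : C ⟶ D} (α : A ⟶ C) (β : B ⟶ D)
    (w : f ≫ β = α ≫ g) (hα : ∀ n, Function.Bijective (α.app n))
    (hβ : ∀ n, Function.Bijective (β.app n)) (hg : homologyIso R g) : homologyIso R f := by
  have (n : SimplexCategoryᵒᵖ) : IsIso (α.app n) := (isIso_iff_bijective _).2 (hα n)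
  have (n : SimplexCategoryᵒᵖ) : IsIso (β.app n) := (isIso_iff_bijective _).2 (hβ n)
  have := NatIso.isIso_of_isIso_app α
  have := NatIso.isIso_of_isIso_app β
  rw [← MorphismProperty.cancel_right_of_respectsIso (homologyIso R) _ β, w]
  exact (homologyIso R).comp_mem _ _ (homologyIso_of_isIso R α) hg

/-- The power `Y ^ V` of a simplicial set. -/
def power (Y : SSet.{0}) (V : Type) : SSet.{0} where
  obj m := V → Y.obj m
  map g := ↾ fun f v => Y.map g (f v)
  map_id m := ConcreteCategory.hom_ext _ _ fun f => funext fun v =>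
    ConcreteCategory.congr_hom (Y.map_id m) (f v)
  map_comp g h := ConcreteCategory.hom_ext _ _ fun f => funext fun v =>
    ConcreteCategory.congr_hom (Y.map_comp g h) (f v)

/-- Functoriality of the power in the simplicial set. -/
def powerMap {Y Z : SSet.{0}} (f : Y ⟶ Z) (V : Type) : power Y V ⟶ power Z V where
  app m := ↾ fun y v => f.app m (y v)
  naturality _ _ g := ConcreteCategory.hom_ext _ _ fun y => funext fun v =>
    ConcreteCategory.congr_hom (f.naturality g) (y v)

/-- Functoriality of the power in the exponent. -/
def powerComp (Y : SSet.{0}) {V V' : Type} (e : V' → V) : power Y V ⟶ power Y V' where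
  app _ := ↾ fun y v => y (e v)
  naturality _ _ _ := rfl

/-- The power with an additional factor. -/
def powerOption (Y : SSet.{0}) (V : Type) : power Y (Option V) ⟶ Y ⊗ power Y V where
  app _ := ↾ fun y => (y none, fun v => y (some v))
  naturality _ _ _ := rfl

open CartesianMonoidalCategory in
/-- Finite powers of homology isomorphisms are homology isomorphisms. -/
theorem homologyIso_powerMap {Y Z : SSet.{0}} (f : Y ⟶ Z) (hf : homologyIso R f) (V : Type)
    [Finite V] : homologyIso R (powerMap f V) := by
  induction V using Finite.induction_empty_option with
  | of_equiv e h =>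
    refine homologyIso_of_square R (powerComp Y e) (powerComp Z e) rfl (fun n => ?_) (fun n => ?_) h
    · exact (e.arrowCongr (Equiv.refl _)).symm.bijective
    · exact (e.arrowCongr (Equiv.refl _)).symm.bijective
  | h_empty =>
    have (n : SimplexCategoryᵒᵖ) : IsIso ((powerMap f PEmpty).app n) := by
      rw [isIso_iff_bijective]
      exact ⟨fun _ _ _ => funext nofun, fun _ => ⟨nofun, funext nofun⟩⟩
    have := NatIso.isIso_of_isIso_app (powerMap f PEmpty)
    exact homologyIso_of_isIso R _
  | @h_option V _ h =>
    have hb (Y : SSet.{0}) (n : SimplexCategoryᵒᵖ) :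
        Function.Bijective ((powerOption Y V).app n) := by
      refine ⟨fun a b hab => ?_, fun p => ⟨fun v => v.elim p.1 p.2, rfl⟩⟩
      have h₁ : a none = b none := congrArg (fun p : Y.obj n × (V → Y.obj n) => p.1) hab
      have h₂ : (fun v => a (some v)) = fun v => b (some v) :=
        congrArg (fun p : Y.obj n × (V → Y.obj n) => p.2) hab
      funext v
      cases v with
      | none => exact h₁
      | some v => exact congrFun h₂ v
    refine homologyIso_of_square R (g := f ▷ _ ≫ _ ◁ powerMap f V) (powerOption Y V)
      (powerOption Z V) rfl (hb Y) (hb Z) ?_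
    exact (homologyIso R).comp_mem _ _ (homologyIso_whiskerRight R f hf _)
      (homologyIso_whiskerLeft R _ h _)

/-! ### The singular simplicial set of the space of pointed maps to a realization -/

section PointedMaps

variable (X : SimplicialObject FinPointed)

/-- The simplicial set of morphisms from `S` to `X`. -/
def homs (S : FinPointed) : SSet.{0} := X ⋙ coyoneda.obj (op S)

/-- The base point of the realization is the image of any base point of `X`. -/
lemma point_basePoint (n : ℕ) (p : Simplex n) :
    point (X := underlying X) (X.obj (op ⦋n⦌)).obj.point p = basePoint X := by
  have h : (underlying X).map (SimplexCategory.const ⦋n⦌ ⦋0⦌ 0).op (basePoint₀ X) =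
      (X.obj (op ⦋n⦌)).obj.point := (X.map (SimplexCategory.const ⦋n⦌ ⦋0⦌ 0).op).hom.map_point
  rw [← h]
  refine (point_map (X := underlying X) _ _ p).trans ?_
  exact congrArg (point (X := underlying X) (basePoint₀ X)) (Subsingleton.elim (α := Simplex 0) _ _)

/-- A morphism from `S` to the simplices of `X` of dimension `n` defines an `n`-simplex of the space
of pointed maps from `S` to the realization. -/
def pointHom {S : FinPointed} {n : ℕ} (f : S ⟶ X.obj (op ⦋n⦌)) :
    C(Simplex n, pointedMaps (realization X) (basePoint X) S) where
  toFun p := ⟨fun s => point (X := underlying X) (f.hom.toFun s) p,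
    (congrArg (fun s => point (X := underlying X) s p) f.hom.map_point).trans
      (point_basePoint X n p)⟩
  continuous_toFun := Continuous.subtype_mk (continuous_pi fun s =>
    (point (X := underlying X) (f.hom.toFun s)).continuous) _

/-- The comparison map from the simplicial set of morphisms from `S` to `X` to the singular
simplicial set of the space of pointed maps from `S` to the realization of `X`. -/
def comparison (S : FinPointed) :
    homs X S ⟶ TopCat.toSSet.obj (pointedMaps (realization X) (basePoint X) S) where
  app n := ↾ fun f => sing (pointHom X f)
  naturality := by
    rintro ⟨⟨n⟩⟩ ⟨⟨m⟩⟩ g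
    refine ConcreteCategory.hom_ext _ _ fun f => ?_
    refine (congrArg sing (ContinuousMap.ext fun p => Subtype.ext (funext fun s => ?_))).trans
      (map_sing g.unop (pointHom X f)).symm
    exact point_map (X := underlying X) g.unop _ p

/-- The elements of a pointed set other than the base point. -/
abbrev NonBase (S : FinPointed) : Type := {s : S.obj.X // s ≠ S.obj.point}

/-- A pointed map is determined by its values away from the base point. -/
def homsToPower (S : FinPointed) : homs X S ⟶ power (underlying X) (NonBase S) where
  app _ := ↾ fun f v => f.hom.toFun v.1
  naturality _ _ _ := rfl

lemma homsToPower_bijective (S : FinPointed) (n : SimplexCategoryᵒᵖ) :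
    Function.Bijective ((homsToPower X S).app n) := by
  classical
  refine ⟨fun f g h => ?_, fun g => ?_⟩
  · refine ObjectProperty.hom_ext _ (Pointed.Hom.ext (funext fun s => ?_))
    by_cases hs : s = S.obj.point
    · rw [hs, f.hom.map_point, g.hom.map_point]
    · exact congrFun h ⟨s, hs⟩
  · exact ⟨ObjectProperty.homMk ⟨fun s => if hs : s = S.obj.point then (X.obj n).obj.point else
      g ⟨s, hs⟩, dif_pos rfl⟩, funext fun v => dif_neg v.2⟩

section

variable (Y : TopCat.{0}) (y : Y)

/-- The value of a pointed map at a point. -/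
def evalAt (S : FinPointed) (s : S.obj.X) : C(pointedMaps Y y S, Y) :=
  ⟨fun f => f.1 s, (continuous_apply s).comp continuous_subtype_val⟩

/-- A singular simplex of the space of pointed maps is a family of singular simplices. -/
def pointedMapsToPower (S : FinPointed) :
    TopCat.toSSet.obj (pointedMaps Y y S) ⟶ power (TopCat.toSSet.obj Y) (NonBase S) where
  app n := ↾ fun σ v => (TopCat.toSSet.map (TopCat.ofHom (evalAt Y y S v.1))).app n σ
  naturality _ _ _ := rfl

lemma pointedMapsToPower_sing (S : FinPointed) {n : ℕ} (σ : C(Simplex n, pointedMaps Y y S))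
    (v : NonBase S) : (pointedMapsToPower Y y S).app (op ⦋n⦌) (sing σ) v =
      sing ((evalAt Y y S v.1).comp σ) := rfl

lemma pointedMapsToPower_bijective (S : FinPointed) (n : SimplexCategoryᵒᵖ) :
    Function.Bijective ((pointedMapsToPower Y y S).app n) := by
  classical
  obtain ⟨⟨n⟩⟩ := n
  refine ⟨fun a b h => ?_, fun g => ?_⟩
  · obtain ⟨σ, rfl⟩ := sing_surjective a
    obtain ⟨τ, rfl⟩ := sing_surjective b
    refine congrArg sing (ContinuousMap.ext fun p => Subtype.ext (funext fun s => ?_))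
    by_cases hs : s = S.obj.point
    · rw [hs, (σ p).2, (τ p).2]
    · have h' : sing ((evalAt Y y S s).comp σ) = sing ((evalAt Y y S s).comp τ) :=
        congrFun h ⟨s, hs⟩
      exact DFunLike.congr_fun (sing_injective h') p
  · choose σ hσ using fun v => sing_surjective (g v)
    have hc (s : S.obj.X) :
        Continuous fun p => if hs : s = S.obj.point then y else σ ⟨s, hs⟩ p := by
      split_ifs with hs
      · exact continuous_const
      · exact (σ ⟨s, hs⟩).continuous
    let τ : C(Simplex n, pointedMaps Y y S) :=
      ⟨fun p => ⟨fun s => if hs : s = S.obj.point then y else σ ⟨s, hs⟩ p, dif_pos rfl⟩,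
        Continuous.subtype_mk (continuous_pi hc) _⟩
    refine ⟨sing τ, funext fun v => ?_⟩
    refine (pointedMapsToPower_sing Y y S τ v).trans (Eq.trans ?_ (hσ v))
    have h : (evalAt Y y S v.1).comp τ = σ v := ContinuousMap.ext fun p => dif_neg v.2
    rw [h]

end

/-- The comparison map is a homology isomorphism: in terms of the values away from the base point,
it is a finite power of the unit of the adjunction between realization and singular simplices. -/
theorem homologyIso_comparison (S : FinPointed) : homologyIso R (comparison X S) := by
  have : Finite S.obj.X := S.property
  refine homologyIso_of_square R (homsToPower X S)
    (pointedMapsToPower (realization X) (basePoint X) S) ?_ (homsToPower_bijective X S)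
    (pointedMapsToPower_bijective _ _ S)
    (homologyIso_powerMap R (sSetTopAdj.unit.app (underlying X)) (homologyIso_unit R _) (NonBase S))
  refine NatTrans.ext (funext fun n => ConcreteCategory.hom_ext _ _ fun f => funext fun v => ?_)
  obtain ⟨⟨n⟩⟩ := n
  exact (pointedMapsToPower_sing _ _ S (pointHom X f) v).trans
    (sing_point (X := underlying X) (f.hom.toFun v.1))

end PointedMaps

/-! ### The resolution by simplicial chains -/

section Resolution

variable (K) (X : SimplicialObject FinPointed)

/-- The coefficients of the singular chains: the field `K` as a vector space over itself. -/
abbrev coefficients : Vect K := ModuleCat.of K (ULift.{1} K)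

/-- The contravariant functor from `Γ` to simplicial sets that sends `S` to the simplicial set of
morphisms from `S` to `X`. -/
def homsFunctor : FinPointedᵒᵖ ⥤ SSet.{0} :=
  coyoneda ⋙ (Functor.whiskeringLeft _ _ _).obj X

/-- The chains of simplicial sets, as an unbounded complex. -/
def chains : SSet.{0} ⥤ Ch K :=
  (SSet.chainComplexFunctor (Vect K)).obj (coefficients K) ⋙
    ComplexShape.embeddingDownNat.extendFunctor (Vect K)

/-- The right `Γ`-module of simplicial chains on the simplicial sets of morphisms to `X`. In each
degree, it is the free functor generated by one representable functor. -/
def homsModule : RightModule K := homsFunctor X ⋙ chains K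

lemma pointHom_comp {S T : FinPointed} (g : T ⟶ S) {n : ℕ} (f : S ⟶ X.obj (op ⦋n⦌)) :
    pointHom X (g ≫ f) = (precompose (realization X) (basePoint X) g).comp (pointHom X f) := rfl

/-- The comparison map from the simplicial sets of morphisms to `X` to the singular simplicial sets
of the spaces of pointed maps to the realization, as a natural transformation. -/
def comparisonNat :
    homsFunctor X ⟶ powerFunctor (realization X) (basePoint X) ⋙ TopCat.toSSet where
  app S := comparison X S.unop
  naturality S T g := by
    refine NatTrans.ext (funext fun n => ConcreteCategory.hom_ext _ _ fun f => ?_)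
    obtain ⟨⟨n⟩⟩ := n
    exact (congrArg sing (pointHom_comp X g.unop f)).trans
      (toSSet_map_sing (TopCat.ofHom (precompose (realization X) (basePoint X) g.unop))
        (pointHom X f)).symm

/-- The comparison of right `Γ`-modules. -/
def comparisonModule :
    homsModule K X ⟶ singularModule K (realization X) (basePoint X) :=
  Functor.whiskerRight (comparisonNat X) (chains K)

/-- A morphism of right `Γ`-modules as a morphism of complexes of functors. -/
def complexMap {M N : RightModule K} (f : M ⟶ N) : M.complex ⟶ N.complex where
  f n := Functor.whiskerRight f (HomologicalComplex.eval (Vect K) (ComplexShape.up ℤ) n)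
  comm' i j _ := by
    ext S : 2
    exact (f.app S).comm i j

lemma quasiIso_complexMap {M N : RightModule K} (f : M ⟶ N) (hf : ∀ S, QuasiIso (f.app S)) :
    QuasiIso (complexMap K f) :=
  (HomologicalComplex.quasiIso_iff_evaluation _).2 hf

lemma quasiIso_comparisonModule : QuasiIso (complexMap K (comparisonModule K X)) := by
  refine quasiIso_complexMap K _ fun S => ?_
  exact (HomologicalComplex.quasiIso_extendMap_iff _ ComplexShape.embeddingDownNat).2
    (homologyIso_comparison (coefficients K) X S.unop)

end Resolution

/-! ### Maps out of the module of simplicial chains -/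

section Basis

variable (K) (X : SimplicialObject FinPointed)

lemma embeddingDownNat_f {p : ℕ} {a : ℤ} (h : a = -p) : ComplexShape.embeddingDownNat.f p = a :=
  h.symm

lemma extendXIso_inv_extendMap {C D : ChainComplex (Vect K) ℕ} (φ : C ⟶ D) {p : ℕ} {a : ℤ}
    (h : ComplexShape.embeddingDownNat.f p = a) :
    (C.extendXIso _ h).inv ≫ (HomologicalComplex.extendMap φ ComplexShape.embeddingDownNat).f a =
      φ.f p ≫ (D.extendXIso _ h).inv := by
  rw [HomologicalComplex.extendMap_f φ _ h, Iso.inv_hom_id_assoc]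

lemma extendXIso_inv_extend_d (C : ChainComplex (Vect K) ℕ) {p q : ℕ} {a b : ℤ}
    (ha : ComplexShape.embeddingDownNat.f p = a) (hb : ComplexShape.embeddingDownNat.f q = b) :
    (C.extendXIso _ ha).inv ≫ (C.extend ComplexShape.embeddingDownNat).d a b =
      C.d p q ≫ (C.extendXIso _ hb).inv := by
  rw [HomologicalComplex.extend_d_eq C _ ha hb, Iso.inv_hom_id_assoc]

/-- The basis element of the simplicial chains given by a simplex. -/
def simplexChain {Z : SSet.{0}} {p : ℕ} (x : Z _⦋p⦌) : (Z.chainComplex (coefficients K)).X p :=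
  (Z.ιChainComplex (R := coefficients K) x).hom (ULift.up 1)

/-- The basis element, in upper degree `a = -p`, of the unbounded complex of simplicial chains given
by a simplex of dimension `p`. -/
def basis {Z : SSet.{0}} {p : ℕ} {a : ℤ} (h : a = -p) (x : Z _⦋p⦌) : ((chains K).obj Z).X a :=
  ((Z.chainComplex (coefficients K)).extendXIso ComplexShape.embeddingDownNat
    (embeddingDownNat_f h)).inv.hom (simplexChain K x)

variable {K}

lemma simplexChain_hom_ext {Z : SSet.{0}} {p : ℕ} {V : Vect K}
    {f g : (Z.chainComplex (coefficients K)).X p ⟶ V}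
    (h : ∀ x : Z _⦋p⦌, f (simplexChain K x) = g (simplexChain K x)) : f = g := by
  refine SSet.chainComplex_hom_ext fun x => ModuleCat.hom_ext (LinearMap.ext fun ⟨c⟩ => ?_)
  have hc : (ULift.up c : coefficients K) = c • ULift.up 1 :=
    congrArg ULift.up (mul_one c).symm
  rw [hc, map_smul, map_smul]
  exact congrArg (c • ·) (h x)

lemma basis_hom_ext {Z : SSet.{0}} {p : ℕ} {a : ℤ} (ha : a = -p) {V : Vect K}
    {f g : ((chains K).obj Z).X a ⟶ V}
    (h : ∀ x : Z _⦋p⦌, f (basis K ha x) = g (basis K ha x)) : f = g := by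
  exact (cancel_epi ((Z.chainComplex (coefficients K)).extendXIso ComplexShape.embeddingDownNat
    (embeddingDownNat_f ha)).inv).1 (simplexChain_hom_ext h)

lemma exists_basis_desc {Z : SSet.{0}} {p : ℕ} {a : ℤ} (ha : a = -p) {V : Vect K}
    (v : Z _⦋p⦌ → V) :
    ∃ f : ((chains K).obj Z).X a ⟶ V, ∀ x : Z _⦋p⦌, f (basis K ha x) = v x := by
  let g : (Z.chainComplex (coefficients K)).X p ⟶ V :=
    Cofan.IsColimit.desc (Z.isColimitChainComplexXCofan (coefficients K) p)
      fun x => ModuleCat.ofHom ((LinearMap.toSpanSingleton K V (v x)).comp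
        (ULift.moduleEquiv (R := K) (M := K)).toLinearMap)
  refine ⟨((Z.chainComplex (coefficients K)).extendXIso ComplexShape.embeddingDownNat
    (embeddingDownNat_f ha)).hom ≫ g, fun x => ?_⟩
  have h₁ := Cofan.IsColimit.fac (Z.isColimitChainComplexXCofan (coefficients K) p)
    (fun x => ModuleCat.ofHom ((LinearMap.toSpanSingleton K V (v x)).comp
        (ULift.moduleEquiv (R := K) (M := K)).toLinearMap)) x
  have h₂ := ConcreteCategory.congr_hom h₁ (ULift.up 1)
  have h₃ : g (simplexChain K x) = v x := h₂.trans (one_smul K (v x))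
  rw [← h₃]
  exact congrArg g (ConcreteCategory.congr_hom ((Z.chainComplex (coefficients K)).extendXIso
    ComplexShape.embeddingDownNat (embeddingDownNat_f ha)).inv_hom_id (simplexChain K x))

lemma isZero_chains (Z : SSet.{0}) {a : ℤ} (h : 0 < a) : IsZero (((chains K).obj Z).X a) :=
  HomologicalComplex.isZero_extend_X _ _ _ fun i hi => by
    change -(i : ℤ) = a at hi
    lia

lemma chains_map_basis {Z Z' : SSet.{0}} (f : Z ⟶ Z') {p : ℕ} {a : ℤ} (h : a = -p) (x : Z _⦋p⦌) :
    ((chains K).map f).f a (basis K h x) = basis K h (f.app _ x) := by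
  have h₂ := extendXIso_inv_extendMap K (SSet.chainComplexMap f (coefficients K))
    (embeddingDownNat_f h)
  have h₃ := ConcreteCategory.congr_hom
    (SSet.ι_chainComplexMap_f Z Z' f (coefficients K) x) (ULift.up 1)
  exact (ConcreteCategory.congr_hom h₂ (simplexChain K x)).trans
    (congrArg ((Z'.chainComplex (coefficients K)).extendXIso _ (embeddingDownNat_f h)).inv h₃)

lemma chains_d_basis (Z : SSet.{0}) {p : ℕ} {a b : ℤ} (ha : a = -(p + 1 : ℕ)) (hb : b = -p)
    (x : Z _⦋p + 1⦌) : ((chains K).obj Z).d a b (basis K ha x) =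
      ∑ i : Fin (p + 2), (-1 : ℤ) ^ (i : ℕ) • basis K hb (Z.δ i x) := by
  have h₂ := extendXIso_inv_extend_d K (Z.chainComplex (coefficients K))
    (embeddingDownNat_f ha) (embeddingDownNat_f hb)
  have h₃ := ConcreteCategory.congr_hom
    (SSet.ιChainComplex_d Z (coefficients K) x) (ULift.up 1)
  refine (ConcreteCategory.congr_hom h₂ (simplexChain K x)).trans
    ((congrArg ((Z.chainComplex (coefficients K)).extendXIso _
      (embeddingDownNat_f hb)).inv h₃).trans ?_)
  have h₄ := map_sum
    ((Z.chainComplex (coefficients K)).extendXIso _ (embeddingDownNat_f hb)).inv.hom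
    (fun i : Fin (p + 2) => (-1 : ℤ) ^ (i : ℕ) • simplexChain K (Z.δ i x)) Finset.univ
  simp only [map_zsmul] at h₄
  refine Eq.trans (congrArg _ ?_) h₄
  change (∑ i : Fin (p + 2), (-1 : ℤ) ^ (i : ℕ) •
    Z.ιChainComplex (R := coefficients K) (Z.δ i x)).hom (ULift.up 1) = _
  rw [ModuleCat.hom_sum, LinearMap.sum_apply]
  rfl

end Basis

section Yoneda

variable (X : SimplicialObject FinPointed)

variable (K) in
/-- The generator of the module of simplicial chains in upper degree `-p`. -/
def generator {p : ℕ} {a : ℤ} (h : a = -p) :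
    ((homsModule K X).complex.X a).obj (op (X.obj (op ⦋p⦌))) :=
  basis K (Z := homs X (X.obj (op ⦋p⦌))) h (𝟙 (X.obj (op ⦋p⦌)))

lemma homsModule_map_generator {S : FinPointed} {p : ℕ} {a : ℤ} (h : a = -p)
    (f : S ⟶ X.obj (op ⦋p⦌)) :
    ((homsModule K X).complex.X a).map f.op (generator K X h) =
      basis K (Z := homs X S) h f :=
  (chains_map_basis ((homsFunctor X).map f.op) h _).trans
    (congrArg (basis K (Z := homs X S) h) (Category.comp_id f))

lemma app_basis {S : FinPointed} {p : ℕ} {a : ℤ} (h : a = -p) {G : FinPointedᵒᵖ ⥤ Vect K}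
    (φ : (homsModule K X).complex.X a ⟶ G) (f : S ⟶ X.obj (op ⦋p⦌)) :
    φ.app (op S) (basis K (Z := homs X S) h f) =
      G.map f.op (φ.app (op (X.obj (op ⦋p⦌))) (generator K X h)) := by
  rw [← homsModule_map_generator]
  exact ConcreteCategory.congr_hom (φ.naturality f.op) (generator K X h)

/-- A map out of the module of simplicial chains in degree `-p` is determined by the image of the
generator. -/
lemma generator_hom_ext {p : ℕ} {a : ℤ} (h : a = -p) {G : FinPointedᵒᵖ ⥤ Vect K}
    {φ ψ : (homsModule K X).complex.X a ⟶ G}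
    (hφ : φ.app _ (generator K X h) = ψ.app _ (generator K X h)) : φ = ψ := by
  refine NatTrans.ext (funext fun S => basis_hom_ext (Z := homs X S.unop) h fun f => ?_)
  exact (app_basis X h φ f).trans ((congrArg (G.map f.op) hφ).trans (app_basis X h ψ f).symm)

/-- The image of the generator can be chosen freely. -/
lemma exists_generator_desc {p : ℕ} {a : ℤ} (h : a = -p) {G : FinPointedᵒᵖ ⥤ Vect K}
    (v : G.obj (op (X.obj (op ⦋p⦌)))) :
    ∃ φ : (homsModule K X).complex.X a ⟶ G, φ.app _ (generator K X h) = v := by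
  choose φ hφ using fun S : FinPointedᵒᵖ => exists_basis_desc (K := K) (Z := homs X S.unop) h
    (V := G.obj S) fun f : S.unop ⟶ X.obj (op ⦋p⦌) => G.map f.op v
  refine ⟨{ app := φ, naturality := fun S T g => ?_ }, ?_⟩
  · refine basis_hom_ext (Z := homs X S.unop) h fun f => ?_
    refine (congrArg (φ T) (chains_map_basis ((homsFunctor X).map g) h f)).trans ?_
    refine (hφ T _).trans (Eq.trans ?_ (congrArg (G.map g) (hφ S f)).symm)
    exact ConcreteCategory.congr_hom (G.map_comp f.op g) v
  · exact (hφ _ _).trans (ConcreteCategory.congr_hom (G.map_id _) v)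

lemma isZero_homsModule {a : ℤ} (h : 0 < a) : IsZero ((homsModule K X).complex.X a) :=
  Functor.isZero _ fun S => isZero_chains (homs X S.unop) h

lemma projective_homsModule (a : ℤ) : Projective ((homsModule K X).complex.X a) := by
  rcases lt_or_ge 0 a with ha | ha
  · exact Projective.of_iso (isZero_homsModule X ha).isoZero.symm inferInstance
  · obtain ⟨p, hp⟩ := Int.eq_ofNat_of_zero_le (neg_nonneg.2 ha)
    have h : a = -p := by lia
    refine ⟨fun {E G} f e _ => ?_⟩
    obtain ⟨w, hw⟩ := (ModuleCat.epi_iff_surjective (e.app (op (X.obj (op ⦋p⦌))))).1 inferInstance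
      (f.app _ (generator K X h))
    obtain ⟨φ, hφ⟩ := exists_generator_desc X h w
    exact ⟨φ, generator_hom_ext X h ((congrArg (e.app _) hφ).trans hw)⟩

instance : (homsModule K X).complex.IsKProjective := by
  have : (homsModule K X).complex.IsStrictlyLE 0 :=
    (CochainComplex.isStrictlyLE_iff _ _).2 fun a ha => isZero_homsModule X ha
  have := projective_homsModule (K := K) X
  exact CochainComplex.isKProjective_of_projective _ 0

variable (K) in
/-- The resolution of the singular chains of the spaces of pointed maps to the realization by the
simplicial chains of the simplicial sets of morphisms to `X`. -/
def resolution : Resolution (singularModule K (realization X) (basePoint X)) where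
  P := (homsModule K X).complex
  π := complexMap K (comparisonModule K X)
  quasiIso := quasiIso_comparisonModule K X
  isKProjective := inferInstance

end Yoneda

/-! ### Independence of the resolution -/

section Precomposition

open CochainComplex HomComplex

variable {F G : CochainComplex (FinPointedᵒᵖ ⥤ Vect K) ℤ}

/-- Precomposition with a morphism of complexes. -/
def precomp (g : F ⟶ G) (A : CochainComplex (FinPointedᵒᵖ ⥤ Vect K) ℤ) :
    homComplex G A ⟶ homComplex F A where
  f n := ModuleCat.ofHom
    { toFun := fun z : Cochain G A n => (Cochain.ofHom g).comp z (zero_add n)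
      map_add' := fun z w => Cochain.comp_add _ _ _ _
      map_smul' := fun k z => Cochain.comp_smul _ _ _ _ }
  comm' n m h := by
    refine ConcreteCategory.hom_ext _ _ fun (z : Cochain G A n) => ?_
    exact δ_ofHom_comp g z m

/-- Homotopic morphisms have cohomologous composites with a cocycle. -/
lemma exists_δ_eq_of_homotopy {φ ψ : F ⟶ G} (h : Homotopy φ ψ)
    {A : CochainComplex (FinPointedᵒᵖ ⥤ Vect K) ℤ} {i n m : ℤ} (hi : i + 1 = n) (hm : n + 1 = m)
    (z : Cochain G A n) (hz : δ n m z = 0) : ∃ w : Cochain F A i,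
      δ i n w = (Cochain.ofHom φ).comp z (zero_add n) - (Cochain.ofHom ψ).comp z (zero_add n) := by
  refine ⟨n.negOnePow • (Cochain.ofHomotopy h).comp z (by lia), ?_⟩
  rw [δ_units_smul, δ_comp (Cochain.ofHomotopy h) z (by lia : -1 + n = i) 0 m n hi (by simp) hm, hz,
    Cochain.comp_zero, zero_add, δ_ofHomotopy, Cochain.sub_comp, smul_smul, Int.units_mul_self,
    one_smul]

lemma ofHom_comp_ofHom_comp {H A : CochainComplex (FinPointedᵒᵖ ⥤ Vect K) ℤ} (f : F ⟶ G)
    (g : G ⟶ H) {n : ℤ} (z : Cochain H A n) :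
    (Cochain.ofHom f).comp ((Cochain.ofHom g).comp z (zero_add n)) (zero_add n) =
      (Cochain.ofHom (f ≫ g)).comp z (zero_add n) := by
  rw [Cochain.ofHom_comp, Cochain.comp_assoc_of_first_is_zero_cochain]

lemma ofHom_id_comp {A : CochainComplex (FinPointedᵒᵖ ⥤ Vect K) ℤ} {n : ℤ} (z : Cochain F A n) :
    (Cochain.ofHom (𝟙 F)).comp z (zero_add n) = z :=
  Cochain.id_comp z

/-- Precomposition with a homotopy equivalence is injective on cohomology. -/
lemma exists_eq_δ_of_comp_eq (e : HomotopyEquiv F G)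
    {A : CochainComplex (FinPointedᵒᵖ ⥤ Vect K) ℤ} {i n m : ℤ} (hi : i + 1 = n) (hm : n + 1 = m)
    (z : Cochain G A n) (hz : δ n m z = 0) (y : Cochain F A i)
    (hy : (Cochain.ofHom e.hom).comp z (zero_add n) = δ i n y) : ∃ x, z = δ i n x := by
  obtain ⟨w, hw⟩ := exists_δ_eq_of_homotopy e.homotopyInvHomId hi hm z hz
  refine ⟨(Cochain.ofHom e.inv).comp y (zero_add i) - w, ?_⟩
  rw [δ_sub, δ_ofHom_comp, ← hy, hw, ofHom_comp_ofHom_comp, ofHom_id_comp, sub_sub_cancel]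

/-- Precomposition with a homotopy equivalence is surjective on cohomology. -/
lemma exists_comp_add_δ_eq (e : HomotopyEquiv F G)
    {A : CochainComplex (FinPointedᵒᵖ ⥤ Vect K) ℤ} {i n m : ℤ} (hi : i + 1 = n) (hm : n + 1 = m)
    (y : Cochain F A n) (hy : δ n m y = 0) : ∃ x : Cochain G A n, δ n m x = 0 ∧
      ∃ w : Cochain F A i, y = (Cochain.ofHom e.hom).comp x (zero_add n) + δ i n w := by
  obtain ⟨w, hw⟩ := exists_δ_eq_of_homotopy e.homotopyHomInvId hi hm y hy
  refine ⟨(Cochain.ofHom e.inv).comp y (zero_add n), ?_, -w, ?_⟩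
  · rw [δ_ofHom_comp, hy, Cochain.comp_zero]
  · rw [δ_neg, hw, ofHom_comp_ofHom_comp, ofHom_id_comp, neg_sub, add_sub_cancel]

/-- Precomposition with a homotopy equivalence is a quasi-isomorphism. -/
lemma quasiIso_precomp (e : HomotopyEquiv F G)
    (A : CochainComplex (FinPointedᵒᵖ ⥤ Vect K) ℤ) : QuasiIso (precomp e.hom A) := by
  refine quasiIso_of_elements _ ?_ ?_
  · intro i n m hi hm z hz y hy
    exact exists_eq_δ_of_comp_eq e (by rw [← hi]; simp) (by rw [← hm]; simp) z hz y hy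
  · intro i n m hi hm y hy
    exact exists_comp_add_δ_eq e (by rw [← hi]; simp) (by rw [← hm]; simp) y hy

/-- Two K-projective resolutions are homotopy equivalent. -/
lemma nonempty_homotopyEquiv {M : CochainComplex (FinPointedᵒᵖ ⥤ Vect K) ℤ} [F.IsKProjective]
    [G.IsKProjective] (f : F ⟶ M) (g : G ⟶ M) [QuasiIso f] [QuasiIso g] :
    Nonempty (HomotopyEquiv F G) := by
  let := HasDerivedCategory.standard (FinPointedᵒᵖ ⥤ Vect K)
  obtain ⟨h, hh⟩ := (IsKProjective.Qh_map_bijective F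
    ((HomotopyCategory.quotient _ _).obj G)).surjective
      ((DerivedCategory.quotientCompQhIso _).hom.app F ≫ DerivedCategory.Q.map f ≫
        inv (DerivedCategory.Q.map g) ≫ (DerivedCategory.quotientCompQhIso _).inv.app G)
  obtain ⟨k, rfl⟩ := (HomotopyCategory.quotient _ _).map_surjective h
  have : QuasiIso k := by
    rw [← DerivedCategory.isIso_Q_map_iff_quasiIso]
    have : IsIso (DerivedCategory.Qh.map ((HomotopyCategory.quotient _ _).map k)) := by
      rw [hh]; infer_instance
    exact (NatIso.isIso_map_iff (DerivedCategory.quotientCompQhIso _) k).1 this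
  obtain ⟨e, -⟩ := (IsKProjective.quasiIso_iff k).1 this
  exact ⟨e⟩

end Precomposition

/-! ### The totalization as a complex of morphisms -/

section Totalization

open CochainComplex HomComplex

/-- The sign that compares, in cosimplicial degree `p` and total degree `n`, the differential of the
totalization with the differential of the complex of morphisms. -/
def totSign (p : ℕ) (n : ℤ) : ℤˣ := ∏ i ∈ Finset.range p, (n - i).negOnePow

lemma totSign_succ_right (p : ℕ) (n : ℤ) : totSign p (n + 1) = (-1) ^ p * totSign p n := by
  have h (i : ℕ) : (n + 1 - i).negOnePow = -1 * (n - i).negOnePow := by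
    rw [add_sub_right_comm, Int.negOnePow_succ, neg_one_mul]
  simp only [totSign, h, Finset.prod_mul_distrib, Finset.prod_const, Finset.card_range]

lemma totSign_succ_left (p : ℕ) (n : ℤ) :
    totSign (p + 1) (n + 1) * (n + 1).negOnePow = totSign p n := by
  have h (i : ℕ) : n + 1 - ((i + 1 : ℕ) : ℤ) = n - i := by push_cast; ring
  simp only [totSign, Finset.prod_range_succ', h]
  rw [Nat.cast_zero, sub_zero, mul_assoc, Int.units_mul_self, mul_one]

lemma totSign_smul_add {M : Type*} [AddCommGroup M] (p : ℕ) (n : ℤ) (u v : M) :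
    totSign p n • u + (-1 : ℤ) ^ (p + 1) • totSign (p + 1) n • v =
      totSign (p + 1) (n + 1) • (v + (n + 1).negOnePow • u) := by
  have h : (-1 : ℤ) ^ (p + 1) • totSign (p + 1) n • v =
      (-1 : ℤˣ) ^ (p + 1) • totSign (p + 1) n • v := by
    rw [Units.smul_def ((-1 : ℤˣ) ^ (p + 1))]
    simp
  rw [h, smul_add, smul_smul, smul_smul, totSign_succ_left, ← totSign_succ_right, add_comm]

variable (X : SimplicialObject FinPointed) (A : RightModule K)

/-- The value on the generator in degree `-p` of a cochain on the module of simplicial chains. -/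
def cochainEval {p : ℕ} {n a q : ℤ} (ha : a = -p) (h : a + n = q) :
    Cochain (homsModule K X).complex A.complex n →ₗ[K]
      ((evalSimplicial A X).obj ⦋p⦌).X q where
  toFun z := (z.v a q h).app _ (generator K X ha)
  map_add' z w := by rw [Cochain.add_v]; rfl
  map_smul' k z := by rw [Cochain.smul_v]; rfl

lemma cochainEval_app_basis {p : ℕ} {n a q : ℤ} (ha : a = -p) (h : a + n = q)
    (z : Cochain (homsModule K X).complex A.complex n) {S : FinPointed} (f : S ⟶ X.obj (op ⦋p⦌)) :
    (z.v a q h).app (op S) (basis K (Z := homs X S) ha f) =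
      (A.map f.op).f q (cochainEval X A ha h z) :=
  app_basis X ha (z.v a q h) f

lemma homsModule_d_generator {p : ℕ} {a b : ℤ} (ha : a = -(p + 1 : ℕ)) (hb : b = -p) :
    ((homsModule K X).complex.d a b).app _ (generator K X ha) = ∑ i : Fin (p + 2),
      (-1 : ℤ) ^ (i : ℕ) • basis K (Z := homs X (X.obj (op ⦋p + 1⦌))) hb (X.δ i) := by
  refine (chains_d_basis (homs X (X.obj (op ⦋p + 1⦌))) ha hb _).trans ?_
  refine Finset.sum_congr rfl fun i _ => ?_
  exact congrArg (fun f => (-1 : ℤ) ^ (i : ℕ) • basis K (Z := homs X (X.obj (op ⦋p + 1⦌))) hb f)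
    (Category.id_comp (X.δ i))

lemma cofaceSum_apply (B : CosimplicialObject (Ch K)) (p : ℕ) (q : ℤ) (x : (B.obj ⦋p⦌).X q) :
    cofaceSum B p q x = ∑ i : Fin (p + 2), (-1 : ℤ) ^ (i : ℕ) • (B.δ i).f q x := by
  have h : cofaceSum B p q = ∑ i : Fin (p + 2), (-1 : ℤ) ^ (i : ℕ) • (B.δ i).f q :=
    ((HomologicalComplex.eval (Vect K) (ComplexShape.up ℤ) q).map_sum _ _).trans
      (Finset.sum_congr rfl fun i _ => rfl)
  rw [h]
  exact (congrArg (fun f => f x) (ModuleCat.hom_sum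
    (fun i : Fin (p + 2) => (-1 : ℤ) ^ (i : ℕ) • (B.δ i).f q) Finset.univ)).trans
      (LinearMap.sum_apply _ _ _)

lemma cochainEval_δ_zero {n a q : ℤ} (q' : ℤ) (ha : a = -(0 : ℕ)) (h : a + (n + 1) = q)
    (hq : q' + 1 = q) (z : Cochain (homsModule K X).complex A.complex n) :
    cochainEval X A ha h (δ n (n + 1) z) =
      ((evalSimplicial A X).obj ⦋0⦌).d q' q (cochainEval X A ha (by lia : a + n = q') z) := by
  have hd : (homsModule K X).complex.d a (a + 1) = 0 :=
    (isZero_homsModule X (by lia)).eq_of_tgt _ _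
  have h₁ : (δ n (n + 1) z).v a q h = z.v a q' (by lia) ≫ A.complex.d q' q := by
    rw [δ_v n (n + 1) rfl z a q h q' (a + 1) (by lia) rfl, hd, zero_comp, smul_zero, add_zero]
  exact congrArg (fun φ => φ.app (op (X.obj (op ⦋0⦌))) (generator K X ha)) h₁

lemma cochainEval_δ_succ {p : ℕ} {n a b q : ℤ} (q' : ℤ) (ha : a = -(p + 1 : ℕ)) (hb : b = -p)
    (h : a + (n + 1) = q) (hq : q' + 1 = q)
    (z : Cochain (homsModule K X).complex A.complex n) :
    cochainEval X A ha h (δ n (n + 1) z) =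
      ((evalSimplicial A X).obj ⦋p + 1⦌).d q' q (cochainEval X A ha (by lia : a + n = q') z) +
        (n + 1).negOnePow • cofaceSum (evalSimplicial A X) p q
          (cochainEval X A hb (by lia) z) := by
  have h₁ : (δ n (n + 1) z).v a q h = z.v a q' (by lia) ≫ A.complex.d q' q +
      (n + 1).negOnePow • (homsModule K X).complex.d a b ≫ z.v b q (by lia) :=
    δ_v n (n + 1) rfl z a q h q' b (by lia) (by lia)
  refine (congrArg (fun φ => φ.app _ (generator K X ha)) h₁).trans ?_
  refine congrArg (fun y => ((evalSimplicial A X).obj ⦋p + 1⦌).d q' q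
    (cochainEval X A ha (by lia : a + n = q') z) + (n + 1).negOnePow • y) ?_
  refine (congrArg ((z.v b q (by lia)).app _) (homsModule_d_generator X ha hb)).trans ?_
  rw [cofaceSum_apply]
  refine (map_sum ((z.v b q (by lia)).app (op (X.obj (op ⦋p + 1⦌)))).hom _ _).trans ?_
  refine Finset.sum_congr rfl fun i _ => ?_
  exact (map_zsmul ((z.v b q (by lia)).app (op (X.obj (op ⦋p + 1⦌)))).hom _ _).trans
    (congrArg ((-1 : ℤ) ^ (i : ℕ) • ·) (cochainEval_app_basis X A hb (by lia) z (X.δ i)))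

/-- The map from the complex of morphisms out of the module of simplicial chains to the totalization
that evaluates cochains on the generators. -/
def toTot : homComplex (homsModule K X).complex A.complex ⟶ Tot (evalSimplicial A X) where
  f n := ModuleCat.ofHom (LinearMap.pi fun T : Bidegree n =>
    totSign T.p n • cochainEval X A (p := T.p) (a := -T.p) rfl (by have := T.h; lia))
  comm' n m h := by
    obtain rfl : n + 1 = m := h
    refine ConcreteCategory.hom_ext _ _ fun (z : Cochain _ _ n) => funext fun T => ?_
    have hD : totD (evalSimplicial A X) n (n + 1) = totDh _ n _ rfl + totDv _ n _ rfl := dif_pos rfl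
    change totD (evalSimplicial A X) n (n + 1) (fun T : Bidegree n => totSign T.p n •
      cochainEval X A (p := T.p) (a := -T.p) rfl (by have := T.h; lia) z) T =
        totSign T.p (n + 1) • cochainEval X A (p := T.p) (a := -T.p) rfl (by have := T.h; lia)
          (δ n (n + 1) z)
    rw [hD]
    obtain ⟨p, q, hT⟩ := T
    cases p with
    | zero =>
      have h := cochainEval_δ_zero X A (q - 1) (a := -(0 : ℕ)) rfl (by lia : _ + (n + 1) = q)
        (by lia) z
      rw [h]
      change (0 : ((evalSimplicial A X).obj ⦋0⦌).X q) + (-1 : ℤ) ^ 0 •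
        ((evalSimplicial A X).obj ⦋0⦌).d (q - 1) q (totSign 0 n •
          cochainEval X A (a := -(0 : ℕ)) rfl (by lia) z) = _
      rw [zero_add, pow_zero, one_smul]
      simp [totSign]
    | succ p =>
      have h := cochainEval_δ_succ X A (q - 1) (a := -(p + 1 : ℕ)) (b := -p) rfl rfl
        (by lia : _ + (n + 1) = q) (by lia) z
      rw [h]
      change cofaceSum (evalSimplicial A X) p q
          (totSign p n • cochainEval X A (a := -p) rfl (by lia) z) +
        (-1 : ℤ) ^ (p + 1) • ((evalSimplicial A X).obj ⦋p + 1⦌).d (q - 1) q (totSign (p + 1) n •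
          cochainEval X A (a := -(p + 1 : ℕ)) rfl (by lia) z) = _
      refine Eq.trans ?_ (totSign_smul_add p n _ _)
      congr 1
      · exact map_zsmul (cofaceSum (evalSimplicial A X) p q).hom (totSign p n : ℤ) _
      · exact congrArg ((-1 : ℤ) ^ (p + 1) • ·) (map_zsmul
          (((evalSimplicial A X).obj ⦋p + 1⦌).d (q - 1) q).hom (totSign (p + 1) n : ℤ) _)

lemma toTot_f_bijective (n : ℤ) : Function.Bijective ((toTot X A).f n) := by
  refine ⟨fun z w h => ?_, fun y => ?_⟩
  · refine Cochain.ext _ _ fun a q haq => ?_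
    rcases lt_or_ge 0 a with ha | ha
    · exact (isZero_homsModule X ha).eq_of_src _ _
    · obtain ⟨p, hp⟩ := Int.eq_ofNat_of_zero_le (neg_nonneg.2 ha)
      obtain rfl : a = -p := by lia
      have h' : totSign p n • cochainEval X A (p := p) rfl haq z =
        totSign p n • cochainEval X A (p := p) rfl haq w := congrFun h ⟨p, q, by lia⟩
      exact generator_hom_ext X rfl (smul_left_cancel _ h')
  · have hex (a q : ℤ) (haq : a + n = q) :
        ∃ φ : (homsModule K X).complex.X a ⟶ A.complex.X q, ∀ (p : ℕ) (ha : a = -p),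
          φ.app _ (generator K X ha) = totSign p n • y ⟨p, q, by lia⟩ := by
      rcases lt_or_ge 0 a with ha | ha
      · exact ⟨0, fun p _ => by lia⟩
      · obtain ⟨p, hp⟩ := Int.eq_ofNat_of_zero_le (neg_nonneg.2 ha)
        obtain rfl : a = -p := by lia
        obtain ⟨φ, hφ⟩ := exists_generator_desc X (p := p) rfl (G := A.complex.X q)
          (totSign p n • y ⟨p, q, by lia⟩)
        refine ⟨φ, fun p' hp' => ?_⟩
        obtain rfl : p = p' := by lia
        exact hφ
    choose φ hφ using hex
    let z : Cochain (homsModule K X).complex A.complex n := Cochain.mk φ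
    refine ⟨z, funext fun T => ?_⟩
    obtain ⟨p, q, hT⟩ := T
    have hz : cochainEval X A (p := p) rfl (by lia : -(p : ℤ) + n = q) z =
        totSign p n • y ⟨p, q, hT⟩ := hφ _ _ _ p rfl
    refine (congrArg (totSign p n • ·) hz).trans ?_
    rw [smul_smul, Int.units_mul_self, one_smul]

instance : IsIso (toTot X A) := by
  have (n : ℤ) : IsIso ((toTot X A).f n) :=
    (ConcreteCategory.isIso_iff_bijective _).2 (toTot_f_bijective X A n)
  exact HomologicalComplex.Hom.isIso_of_components _

end Totalization

end GammaModules

end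

theorem mainTheorem9 (K : Type u) [Field K] [CharZero K]
    (X : SimplicialObject GammaModules.FinPointed) (A : GammaModules.RightModule K) :
    Nonempty (GammaModules.Resolution
        (GammaModules.singularModule K (GammaModules.realization X) (GammaModules.basePoint X))) ∧
      ∀ R : GammaModules.Resolution
          (GammaModules.singularModule K (GammaModules.realization X) (GammaModules.basePoint X)),
        ∃ f : GammaModules.Tot (GammaModules.evalSimplicial A X) ⟶ GammaModules.hRmod R A,
          QuasiIso f := by
  refine ⟨⟨GammaModules.resolution K X⟩, fun R => ?_⟩
  have := R.isKProjective
  have := R.quasiIso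
  have := GammaModules.quasiIso_comparisonModule K X
  obtain ⟨e⟩ := GammaModules.nonempty_homotopyEquiv R.π
    (GammaModules.complexMap K (GammaModules.comparisonModule K X))
  have : QuasiIso (GammaModules.precomp e.hom A.complex) :=
    GammaModules.quasiIso_precomp e A.complex
  have : QuasiIso (inv (GammaModules.toTot X A) ≫ GammaModules.precomp e.hom A.complex) :=
    inferInstance
  exact ⟨_, this⟩
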